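/- Let $l\ge 2$ and let $q\in\mathbb C^\times$ be such that $q^2$ is a primitive $l$-th root of unity; put $d=q+q^{-1}$ and $[k]_q=(q^k-q^{-k})/(q-q^{-1})$. Let $\mathcal K_d$ be the Temperley–Lieb category: its objects are $X^{\otimes n}$ ($n\ge 0$), $\mathrm{Hom}(X^{\otimes n},X^{\otimes m})$ is the complex vector space with basis the planar non-crossing pairings of $n$ points on the lower and $m$ points on the upper edge of a rectangle, composition is stacking with every closed loop replaced by the scalar $d$, and the tensor product is juxtaposition. The reduced Temperley–Lieb category $\overline{\mathcal K}_d$ has the same objects (written $\overline{X}^{\otimes n}$), and its Hom-spaces are the quotients of those of $\mathcal K_d$ by the tensor ideal of all $f:X^{\otimes n}\to X^{\otimes m}$ such that $\mathrm{tr}(gf)=0$ for every $g:X^{\otimes m}\to X^{\otimes n}$, where $\mathrm{tr}$ is the Markov trace (close diagrams completely and replace each closed loop by $d$); its tensor product is inherited from $\mathcal K_d$. Define $f_k\in\mathrm{End}(X^{\otimes k})$ for $0\le k\le l-2$ by $f_0=1$, $f_1=1_X$ and $$f_{k+1}=f_k\otimes 1_X-\frac{[k]_q}{[k+1]_q}\,(f_k\otimes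 1_X)\,h_k\,(f_k\otimes 1_X)\qquad(k\ge 1),$$ where $h_k\in\mathrm{End}(X^{\otimes(k+1)})$ is the diagram with $k-1$ vertical strands followed by an arc joining the last two lower points and an arc joining the last two upper points. Then each $f_k$ ($0\le k\le l-2$) is idempotent, and, writing $\overline X_k=\overline{f_k}\,\overline X^{\otimes k}$ for the corresponding object $(\overline{f_k},\overline X^{\otimes k})$ of the idempotent completion of $\overline{\mathcal K}_d$, one has for all $0\le j,k\le l-2$ $$\overline X_j\otimes\overline X_k\;\cong\;\overline X_{|j-k|}\oplus\overline X_{|j-k|+2}\oplus\dots\oplus\overline X_m,\qquad m=\begin{cases}j+k&\text{if } j+k\le l-2,\\ 2(l-2)-(j+k)&\text{if } j+k\ge l-2.\end{cases}$$ -/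

import Mathlib

open CategoryTheory

namespace TemperleyLieb

/-- The disjoint union of two equivalence relations. -/
def sumSetoid {α β : Type} (r : Setoid α) (s : Setoid β) : Setoid (α ⊕ β) where
  r := Sum.LiftRel r s
  iseqv :=
    { refl := by
        rintro (a | b)
        · exact .inl (r.refl' a)
        · exact .inr (s.refl' b)
      symm := by
        rintro _ _ (h | h)
        · exact .inl (r.symm' h)
        · exact .inr (s.symm' h)
      trans := by
        rintro _ _ _ (h | h) (h' | h')
        · exact .inl (r.trans' h h')
        · exact .inr (s.trans' h h') }

/-- The number of classes of `r` that contain no point of the form `κ o`. -/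
noncomputable def missing {V O : Type} (r : Setoid V) (κ : O → V) : ℕ :=
  Nat.card {c : Quotient r // ∀ o, Quotient.mk r (κ o) ≠ c}

theorem map_le_iff {α β : Type} (r : Setoid α) (f : α → β) (t : Setoid β) :
    r.map f ≤ t ↔ ∀ a b, r a b → t (f a) (f b) := by
  constructor
  · exact fun h _ _ hab => h (Relation.EqvGen.rel _ _ ⟨_, _, hab, rfl, rfl⟩)
  · intro h
    refine Setoid.eqvGen_le ?_
    rintro _ _ ⟨a, b, hab, rfl, rfl⟩
    exact h a b hab

theorem gen_le_iff {α : Type} (R : α → α → Prop) (t : Setoid α) :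
    Relation.EqvGen.setoid R ≤ t ↔ ∀ a b, R a b → t a b :=
  ⟨fun h _ _ hab => h (Relation.EqvGen.rel _ _ hab), fun h => Setoid.eqvGen_le h⟩

theorem sumSetoid_le_iff {α β : Type} (r : Setoid α) (s : Setoid β) (t : Setoid (α ⊕ β)) :
    sumSetoid r s ≤ t ↔ (∀ a b, r a b → t (.inl a) (.inl b)) ∧
      (∀ a b, s a b → t (.inr a) (.inr b)) := by
  constructor
  · intro h
    exact ⟨fun a b hab => h (Sum.LiftRel.inl hab), fun a b hab => h (Sum.LiftRel.inr hab)⟩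
  · rintro ⟨h1, h2⟩ _ _ (h | h)
    · exact h1 _ _ h
    · exact h2 _ _ h

theorem sumSetoid_comap {α β γ δ : Type} (r : Setoid α) (s : Setoid β) (f : γ → α) (g : δ → β) :
    (sumSetoid r s).comap (Sum.map f g) = sumSetoid (r.comap f) (s.comap g) := by
  ext x y
  rcases x with x | x <;> rcases y with y | y
  · exact ⟨fun h => .inl (by cases h; assumption), fun h => .inl (by cases h; assumption)⟩
  · exact ⟨nofun, nofun⟩
  · exact ⟨nofun, nofun⟩
  · exact ⟨fun h => .inr (by cases h; assumption), fun h => .inr (by cases h; assumption)⟩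

section Elim

variable {U V : Type} (ι : U → V) (r : Setoid V) (s : Setoid U)

/-- An explicit form of the relation obtained from `r` by gluing along `s`. -/
def elimSetoid : Setoid V where
  r x y := r x y ∨ ∃ u v, r x (ι u) ∧ (r.comap ι ⊔ s) u v ∧ r (ι v) y
  iseqv :=
    { refl := fun x => .inl (r.refl' x)
      symm := by
        rintro x y (h | ⟨u, v, h1, h2, h3⟩)
        · exact .inl (r.symm' h)
        · exact .inr ⟨v, u, r.symm' h3, Setoid.symm' _ h2, r.symm' h1⟩
      trans := by
        rintro x y z (h | ⟨u, v, h1, h2, h3⟩) (h' | ⟨u', v', h1', h2', h3'⟩)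
        · exact .inl (r.trans' h h')
        · exact .inr ⟨u', v', r.trans' h h1', h2', h3'⟩
        · exact .inr ⟨u, v, h1, h2, r.trans' h3 h'⟩
        · refine .inr ⟨u, v', h1, ?_, h3'⟩
          refine Setoid.trans' _ h2 (Setoid.trans' _ ?_ h2')
          exact (le_sup_left : r.comap ι ≤ r.comap ι ⊔ s) (r.trans' h3 h1') }

theorem elimSetoid_eq : r ⊔ s.map ι = elimSetoid ι r s := by
  apply le_antisymm
  · refine sup_le (fun _ _ h => .inl h) ?_
    rw [map_le_iff]
    intro a b hab
    exact .inr ⟨a, b, r.refl' _, (le_sup_right : s ≤ r.comap ι ⊔ s) hab, r.refl' _⟩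
  · have key : r.comap ι ⊔ s ≤ (r ⊔ s.map ι).comap ι := by
      refine sup_le ?_ ?_
      · intro a b h
        exact (le_sup_left : r ≤ r ⊔ s.map ι) h
      · intro a b h
        exact (le_sup_right : s.map ι ≤ r ⊔ s.map ι) (Setoid.le_comap_map h)
    rintro x y (h | ⟨u, v, h1, h2, h3⟩)
    · exact (le_sup_left : r ≤ r ⊔ s.map ι) h
    · exact Setoid.trans' _ ((le_sup_left : r ≤ r ⊔ s.map ι) h1)
        (Setoid.trans' _ (key h2) ((le_sup_left : r ≤ r ⊔ s.map ι) h3))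

theorem elimSetoid_comap (u v : U) : elimSetoid ι r s (ι u) (ι v) ↔ (r.comap ι ⊔ s) u v := by
  constructor
  · rintro (h | ⟨a, b, h1, h2, h3⟩)
    · exact (le_sup_left : r.comap ι ≤ r.comap ι ⊔ s) h
    · exact Setoid.trans' _ ((le_sup_left : r.comap ι ≤ r.comap ι ⊔ s) h1)
        (Setoid.trans' _ h2 ((le_sup_left : r.comap ι ≤ r.comap ι ⊔ s) h3))
  · intro h
    exact .inr ⟨u, v, r.refl' _, h, r.refl' _⟩

theorem comap_sup_map : (r ⊔ s.map ι).comap ι = r.comap ι ⊔ s := by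
  rw [elimSetoid_eq]
  ext u v
  exact elimSetoid_comap ι r s u v

theorem missing_sup_map [Finite U] [Finite V] {O : Type} (κ : O → U) :
    missing (r ⊔ s.map ι) (ι ∘ κ) = missing (r.comap ι ⊔ s) κ + missing r ι := by
  rw [elimSetoid_eq]
  unfold missing
  rw [← Nat.card_sum]
  symm
  let f1 : Quotient (r.comap ι ⊔ s) → Quotient (elimSetoid ι r s) :=
    Quotient.map' ι (fun a b h => (elimSetoid_comap ι r s a b).2 h)
  let f2 : Quotient r → Quotient (elimSetoid ι r s) :=
    Quotient.map' id (fun a b h => Or.inl h)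
  have hf1 : ∀ u, f1 (Quotient.mk _ u) = Quotient.mk _ (ι u) := fun u => rfl
  have hf2 : ∀ u, f2 (Quotient.mk _ u) = Quotient.mk _ u := fun u => rfl
  have e : ∀ {x y}, Quotient.mk (elimSetoid ι r s) x = Quotient.mk _ y ↔
      elimSetoid ι r s x y := fun {x y} => Quotient.eq
  have e1 : ∀ {x y}, Quotient.mk (r.comap ι ⊔ s) x = Quotient.mk _ y ↔
      (r.comap ι ⊔ s) x y := fun {x y} => Quotient.eq
  have e2 : ∀ {x y}, Quotient.mk r x = Quotient.mk _ y ↔ r x y := fun {x y} => Quotient.eq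
  have g2 : ∀ c : Quotient r, (∀ o, Quotient.mk r (ι o) ≠ c) →
      ∀ u, Quotient.mk (elimSetoid ι r s) (ι u) ≠ f2 c := by
    intro c hc u h
    induction c using Quotient.ind with | _ y =>
    rw [hf2, e] at h
    rcases h with h | ⟨a, b, h1, h2, h3⟩
    · exact hc u (e2.2 h)
    · exact hc b (e2.2 h3)
  refine Nat.card_eq_of_bijective (Sum.elim
    (fun c => ⟨f1 c.1, fun o h => c.2 o ?_⟩) (fun c => ⟨f2 c.1, fun o h => g2 c.1 c.2 (κ o) h⟩)) ⟨?_, ?_⟩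
  · obtain ⟨c, hc⟩ := c
    induction c using Quotient.ind with | _ y =>
    simp only [Function.comp] at h
    rw [hf1, e, elimSetoid_comap] at h
    exact e1.2 h
  · rintro (⟨c, hc⟩ | ⟨c, hc⟩) (⟨c', hc'⟩ | ⟨c', hc'⟩) h
    · simp only [Sum.elim_inl, Subtype.mk.injEq] at h
      congr 2
      induction c using Quotient.ind with | _ y =>
      induction c' using Quotient.ind with | _ y' =>
      rw [hf1, hf1, e, elimSetoid_comap] at h
      exact e1.2 h
    · exfalso
      simp only [Sum.elim_inl, Sum.elim_inr, Subtype.mk.injEq] at h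
      induction c using Quotient.ind with | _ y =>
      exact g2 c' hc' y h
    · exfalso
      simp only [Sum.elim_inl, Sum.elim_inr, Subtype.mk.injEq] at h
      induction c' using Quotient.ind with | _ y =>
      exact g2 c hc y h.symm
    · simp only [Sum.elim_inr, Subtype.mk.injEq] at h
      congr 2
      induction c using Quotient.ind with | _ y =>
      induction c' using Quotient.ind with | _ y' =>
      rw [hf2, hf2, e] at h
      rcases h with h | ⟨a, b, h1, h2, h3⟩
      · exact e2.2 h
      · exact absurd (e2.2 (r.symm' h1)) (hc a)
  · rintro ⟨c, hc⟩
    induction c using Quotient.ind with | _ y =>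
    by_cases hy : ∃ u, r (ι u) y
    · obtain ⟨u, hu⟩ := hy
      have : Quotient.mk (elimSetoid ι r s) y = f1 (Quotient.mk _ u) := by
        rw [hf1, e]; exact .inl (r.symm' hu)
      refine ⟨.inl ⟨Quotient.mk _ u, fun o h => hc o ?_⟩, ?_⟩
      · rw [this, ← h]; rfl
      · simp only [Sum.elim_inl, Subtype.mk.injEq]; exact this.symm
    · refine ⟨.inr ⟨Quotient.mk _ y, fun u h => hy ⟨u, e2.1 h⟩⟩, ?_⟩
      simp only [Sum.elim_inr, Subtype.mk.injEq]; rfl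

end Elim

theorem missing_comap_surj {V W O : Type} (f : V → W) (hf : Function.Surjective f)
    (t : Setoid W) (κ : O → V) : missing (t.comap f) κ = missing t (f ∘ κ) := by
  unfold missing
  let g : Quotient (t.comap f) → Quotient t := Quotient.map' f (fun a b h => h)
  have e1 : ∀ {x y}, Quotient.mk (t.comap f) x = Quotient.mk _ y ↔
      t (f x) (f y) := fun {x y} => Quotient.eq
  have e2 : ∀ {x y}, Quotient.mk t x = Quotient.mk _ y ↔ t x y := fun {x y} => Quotient.eq
  have hg : ∀ u, g (Quotient.mk _ u) = Quotient.mk _ (f u) := fun u => rfl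
  refine Nat.card_eq_of_bijective (fun c => ⟨g c.1, fun o h => c.2 o ?_⟩) ⟨?_, ?_⟩
  · obtain ⟨c, hc⟩ := c
    induction c using Quotient.ind with | _ y =>
    exact e1.2 (e2.1 h)
  · rintro ⟨c, hc⟩ ⟨c', hc'⟩ h
    simp only [Subtype.mk.injEq] at h
    congr 1
    induction c using Quotient.ind with | _ y =>
    induction c' using Quotient.ind with | _ y' =>
    exact e1.2 (e2.1 h)
  · rintro ⟨c, hc⟩
    induction c using Quotient.ind with | _ y =>
    obtain ⟨x, rfl⟩ := hf y
    exact ⟨⟨Quotient.mk _ x, fun o h => hc o (e2.2 (e1.1 h))⟩, rfl⟩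

theorem missing_sum {α β O P : Type} [Finite α] [Finite β] (r : Setoid α) (s : Setoid β)
    (κ : O → α) (μ : P → β) :
    missing (sumSetoid r s) (Sum.map κ μ) = missing r κ + missing s μ := by
  unfold missing
  rw [← Nat.card_sum]
  symm
  let f1 : Quotient r → Quotient (sumSetoid r s) :=
    Quotient.map' Sum.inl (fun a b h => Sum.LiftRel.inl h)
  let f2 : Quotient s → Quotient (sumSetoid r s) :=
    Quotient.map' Sum.inr (fun a b h => Sum.LiftRel.inr h)
  have e : ∀ {x y}, Quotient.mk (sumSetoid r s) x = Quotient.mk _ y ↔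
      Sum.LiftRel r s x y := fun {x y} => Quotient.eq
  have e1 : ∀ {x y}, Quotient.mk r x = Quotient.mk _ y ↔ r x y := fun {x y} => Quotient.eq
  have e2 : ∀ {x y}, Quotient.mk s x = Quotient.mk _ y ↔ s x y := fun {x y} => Quotient.eq
  refine Nat.card_eq_of_bijective (Sum.elim
    (fun c => ⟨f1 c.1, fun o h => ?_⟩) (fun c => ⟨f2 c.1, fun o h => ?_⟩)) ⟨?_, ?_⟩
  · obtain ⟨c, hc⟩ := c
    induction c using Quotient.ind with | _ y =>
    have h := e.1 h
    rcases o with o | o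
    · exact hc o (e1.2 (by simpa using h))
    · simp at h
  · obtain ⟨c, hc⟩ := c
    induction c using Quotient.ind with | _ y =>
    have h := e.1 h
    rcases o with o | o
    · simp at h
    · exact hc o (e2.2 (by simpa using h))
  · rintro (⟨c, hc⟩ | ⟨c, hc⟩) (⟨c', hc'⟩ | ⟨c', hc'⟩) h <;>
      simp only [Sum.elim_inl, Sum.elim_inr, Subtype.mk.injEq] at h <;>
      induction c using Quotient.ind with | _ y =>
      induction c' using Quotient.ind with | _ y' =>
      have h := e.1 h
      simp at h
      try congr 2
      try exact Quotient.sound h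
  · rintro ⟨c, hc⟩
    induction c using Quotient.ind with | _ y =>
    rcases y with y | y
    · exact ⟨.inl ⟨Quotient.mk _ y, fun o h => hc (.inl o) (e.2 (.inl (e1.1 h)))⟩, rfl⟩
    · exact ⟨.inr ⟨Quotient.mk _ y, fun o h => hc (.inr o) (e.2 (.inr (e2.1 h)))⟩, rfl⟩

theorem missing_eq_zero {V O : Type} (r : Setoid V) (κ : O → V)
    (h : ∀ v, ∃ o, r (κ o) v) : missing r κ = 0 := by
  unfold missing
  rw [Nat.card_eq_zero]
  left
  constructor
  rintro ⟨c, hc⟩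
  induction c using Quotient.ind with | _ y =>
  obtain ⟨o, ho⟩ := h y
  exact hc o (Quotient.sound ho)

theorem card_quotient_eq {V : Type} (r : Setoid V) :
    Nat.card (Quotient r) = missing r (Empty.elim : Empty → V) := by
  unfold missing
  refine Nat.card_congr ⟨fun c => ⟨c, fun o => o.elim⟩, fun c => c.1, fun _ => rfl, fun _ => rfl⟩

/-- `t` restricts on `S` to a perfect pairing which is noncrossing for the order given by `pos`. -/
structure PlanarPairing {V : Type} (pos : V → ℕ) (S : Set V) (t : Setoid V) : Prop where
  exists_partner : ∀ x ∈ S, ∃ y ∈ S, y ≠ x ∧ t x y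
  partner_unique : ∀ x ∈ S, ∀ y ∈ S, ∀ z ∈ S, y ≠ x → z ≠ x → t x y → t x z → y = z
  planar : ∀ a ∈ S, ∀ b ∈ S, ∀ c ∈ S, ∀ d ∈ S,
    pos a < pos b → pos b < pos c → pos c < pos d → t a c → t b d → False

/-- Join two points `x` and `y` by a strand. -/
def joinSetoid {V : Type} (t : Setoid V) (x y : V) : Setoid V where
  r u v := t u v ∨ (t u x ∧ t y v) ∨ (t u y ∧ t x v)
  iseqv :=
    { refl := fun u => .inl (t.refl' u)
      symm := by
        rintro u v (h | ⟨h1, h2⟩ | ⟨h1, h2⟩)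
        · exact .inl (t.symm' h)
        · exact .inr (.inr ⟨t.symm' h2, t.symm' h1⟩)
        · exact .inr (.inl ⟨t.symm' h2, t.symm' h1⟩)
      trans := by
        rintro u v w (h | ⟨h1, h2⟩ | ⟨h1, h2⟩) (h' | ⟨h1', h2'⟩ | ⟨h1', h2'⟩)
        · exact .inl (t.trans' h h')
        · exact .inr (.inl ⟨t.trans' h h1', h2'⟩)
        · exact .inr (.inr ⟨t.trans' h h1', h2'⟩)
        · exact .inr (.inl ⟨h1, t.trans' h2 h'⟩)
        · exact .inr (.inl ⟨h1, h2'⟩)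
        · exact .inl (t.trans' h1 h2')
        · exact .inr (.inr ⟨h1, t.trans' h2 h'⟩)
        · exact .inl (t.trans' h1 h2')
        · exact .inr (.inr ⟨h1, h2'⟩) }

theorem joinSetoid_eq {V : Type} (t : Setoid V) (R : V → V → Prop) (x y : V) :
    joinSetoid (t ⊔ Relation.EqvGen.setoid R) x y =
      t ⊔ Relation.EqvGen.setoid (fun u v => R u v ∨ (u = x ∧ v = y)) := by
  apply le_antisymm
  · have h0 : t ⊔ Relation.EqvGen.setoid R ≤
        t ⊔ Relation.EqvGen.setoid (fun u v => R u v ∨ (u = x ∧ v = y)) :=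
      sup_le_sup_left (Setoid.eqvGen_mono fun _ _ h => .inl h) _
    have h1 : (t ⊔ Relation.EqvGen.setoid (fun u v => R u v ∨ (u = x ∧ v = y))) x y :=
      (le_sup_right : _ ≤ t ⊔ Relation.EqvGen.setoid (fun u v => R u v ∨ (u = x ∧ v = y)))
        (Relation.EqvGen.rel _ _ (.inr ⟨rfl, rfl⟩))
    rintro u v (h | ⟨h2, h3⟩ | ⟨h2, h3⟩)
    · exact h0 h
    · exact Setoid.trans' _ (h0 h2) (Setoid.trans' _ h1 (h0 h3))
    · exact Setoid.trans' _ (h0 h2) (Setoid.trans' _ (Setoid.symm' _ h1) (h0 h3))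
  · refine sup_le ?_ ?_
    · intro u v h
      exact .inl ((le_sup_left : t ≤ t ⊔ Relation.EqvGen.setoid R) h)
    · rw [gen_le_iff]
      rintro u v (h | ⟨rfl, rfl⟩)
      · exact .inl ((le_sup_right : _ ≤ t ⊔ Relation.EqvGen.setoid R)
          (Relation.EqvGen.rel _ _ h))
      · exact .inr (.inl ⟨Setoid.refl' _ _, Setoid.refl' _ _⟩)

theorem PlanarPairing.join_aux {V : Type} {pos : V → ℕ} {S S' : Set V} {t : Setoid V}
    (h : PlanarPairing pos S t) {x y : V} (hx : x ∈ S) (hy : y ∈ S)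
    (hS' : ∀ a ∈ S', a ∈ S)
    (hinj : ∀ a ∈ S', pos a ≠ pos x ∧ pos a ≠ pos y)
    (hadj : (∀ a ∈ S', (pos x < pos a ↔ pos y < pos a)) ∨
      (∀ a ∈ S', pos x < pos a ∧ pos a < pos y))
    {a b c d : V} (ha : a ∈ S') (hb : b ∈ S') (hc : c ∈ S') (hd : d ∈ S')
    (hlt : pos a < pos c) (hac : t a c)
    (hord : (pos a < pos b ∧ pos b < pos c ∧ pos c < pos d) ∨
      (pos d < pos a ∧ pos a < pos b ∧ pos b < pos c))
    (hbd : (t b x ∧ t y d) ∨ (t b y ∧ t x d)) : False := by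
  have sy : ∀ {a b}, t a b → t b a := fun h => t.symm' h
  have pl := h.planar
  have side : ∀ z ∈ S, ∀ w ∈ S, pos a ≠ pos z → pos c ≠ pos z → t b z → t w d →
      (pos a < pos z ∧ pos z < pos c) ∧ ¬ (pos a < pos w ∧ pos w < pos c) := by
    intro z hz w hw iza izc hbz hwd
    have hb' : pos a < pos b ∧ pos b < pos c := by
      rcases hord with ⟨h1, h2, h3⟩ | ⟨h1, h2, h3⟩
      · exact ⟨h1, h2⟩
      · exact ⟨h2, h3⟩
    constructor
    · by_contra hcon
      rcases Nat.lt_or_ge (pos z) (pos a) with hlt' | hge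
      · exact pl z hz a (hS' a ha) b (hS' b hb) c (hS' c hc) hlt' hb'.1 hb'.2 (sy hbz) hac
      · exact pl a (hS' a ha) b (hS' b hb) c (hS' c hc) z hz hb'.1 hb'.2 (by omega) hac hbz
    · rintro ⟨h4, h5⟩
      rcases hord with ⟨h1, h2, h3⟩ | ⟨h1, h2, h3⟩
      · exact pl a (hS' a ha) w hw c (hS' c hc) d (hS' d hd) h4 h5 h3 hac hwd
      · exact pl d (hS' d hd) a (hS' a ha) w hw c (hS' c hc) h1 h4 h5 (sy hwd) hac
  obtain ⟨iax, iay⟩ := hinj a ha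
  obtain ⟨icx, icy⟩ := hinj c hc
  clear pl sy h hinj hord
  rcases hbd with ⟨h1, h2⟩ | ⟨h1, h2⟩
  · have := side x hx y hy iax icx h1 h2
    clear side
    rcases hadj with hadj | hadj
    · have h1 := hadj a ha
      have h2 := hadj c hc
      omega
    · have h1 := hadj a ha
      omega
  · have := side y hy x hx iay icy h1 h2
    clear side
    rcases hadj with hadj | hadj
    · have h1 := hadj a ha
      have h2 := hadj c hc
      omega
    · have h1 := hadj c hc
      omega

/-- Joining two points that are next to each other on the boundary circle keeps a planar
pairing planar. -/
theorem PlanarPairing.join {V : Type} {pos : V → ℕ} {S S' : Set V} {t : Setoid V}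
    (h : PlanarPairing pos S t) {x y : V} (hx : x ∈ S) (hy : y ∈ S) (hxy : x ≠ y)
    (hS' : ∀ a, a ∈ S' ↔ a ∈ S ∧ a ≠ x ∧ a ≠ y)
    (hinj : ∀ a ∈ S', pos a ≠ pos x ∧ pos a ≠ pos y)
    (hadj : (∀ a ∈ S', (pos x < pos a ↔ pos y < pos a)) ∨
      (∀ a ∈ S', pos x < pos a ∧ pos a < pos y)) :
    PlanarPairing pos S' (joinSetoid t x y) := by
  have sy : ∀ {a b}, t a b → t b a := fun h => t.symm' h
  have tr : ∀ {a b c}, t a b → t b c → t a c := fun h h' => t.trans' h h'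
  have uniq := h.partner_unique
  refine ⟨?_, ?_, ?_⟩
  · intro u hu
    obtain ⟨huS, hux, huy⟩ := (hS' u).1 hu
    obtain ⟨w, hw, hwu, huw⟩ := h.exists_partner u huS
    by_cases hwx : w = x
    · subst hwx
      obtain ⟨v, hv, hvy, hyv⟩ := h.exists_partner y hy
      refine ⟨v, (hS' v).2 ⟨hv, ?_, hvy⟩, ?_, .inr (.inl ⟨huw, hyv⟩)⟩
      · rintro rfl
        exact huy (uniq v hv u huS y hy hux hxy.symm (sy huw) (sy hyv))
      · rintro rfl
        exact hxy (uniq v hv w hw y hy hux.symm huy.symm huw (sy hyv))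
    · by_cases hwy : w = y
      · subst hwy
        obtain ⟨v, hv, hvx, hxv⟩ := h.exists_partner x hx
        refine ⟨v, (hS' v).2 ⟨hv, hvx, ?_⟩, ?_, .inr (.inr ⟨huw, hxv⟩)⟩
        · rintro rfl
          exact hux (uniq v hv u huS x hx huy hxy (sy huw) (sy hxv))
        · rintro rfl
          exact hxy (uniq v hv x hx w hw hux.symm huy.symm (sy hxv) huw)
      · exact ⟨w, (hS' w).2 ⟨hw, hwx, hwy⟩, hwu, .inl huw⟩
  · intro u hu v hv w hw hvu hwu huv huw
    obtain ⟨huS, hux, huy⟩ := (hS' u).1 hu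
    obtain ⟨hvS, hvx, hvy⟩ := (hS' v).1 hv
    obtain ⟨hwS, hwx, hwy⟩ := (hS' w).1 hw
    rcases huv with huv | ⟨h1, h2⟩ | ⟨h1, h2⟩ <;> rcases huw with huw | ⟨h1', h2'⟩ | ⟨h1', h2'⟩
    · exact uniq u huS v hvS w hwS hvu hwu huv huw
    · exact absurd (uniq u huS v hvS x hx hvu hux.symm huv h1') hvx
    · exact absurd (uniq u huS v hvS y hy hvu huy.symm huv h1') hvy
    · exact absurd (uniq u huS w hwS x hx hwu hux.symm huw h1) hwx
    · exact uniq y hy v hvS w hwS hvy hwy h2 h2'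
    · exact absurd (uniq u huS x hx y hy hux.symm huy.symm h1 h1') hxy
    · exact absurd (uniq u huS w hwS y hy hwu huy.symm huw h1) hwy
    · exact absurd (uniq u huS x hx y hy hux.symm huy.symm h1' h1) hxy
    · exact uniq x hx v hvS w hwS hvx hwx h2 h2'
  · intro a ha b hb c hc d hd hab hbc hcd hac hbd
    have pl := h.planar
    obtain ⟨haS, hax, hay⟩ := (hS' a).1 ha
    obtain ⟨hbS, hbx, hby⟩ := (hS' b).1 hb
    obtain ⟨hcS, hcx, hcy⟩ := (hS' c).1 hc
    obtain ⟨hdS, hdx, hdy⟩ := (hS' d).1 hd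
    have iax := hinj a ha
    have ibx := hinj b hb
    have icx := hinj c hc
    have idx := hinj d hd
    have nac : a ≠ c := by rintro rfl; omega
    have nbd : b ≠ d := by rintro rfl; omega
    have nab : a ≠ b := by rintro rfl; omega
    have nad : a ≠ d := by rintro rfl; omega
    have nbc : b ≠ c := by rintro rfl; omega
    have ncd : c ≠ d := by rintro rfl; omega
    have one := fun a b c d (h1 : a ∈ S') (h2 : b ∈ S') (h3 : c ∈ S') (h4 : d ∈ S') h5 =>
      h.join_aux hx hy (fun a ha => ((hS' a).1 ha).1) hinj hadj h1 h2 h3 h4 h5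
    rcases hac with hac | hac
    · rcases hbd with hbd | hbd
      · exact pl a haS b hbS c hcS d hdS hab hbc hcd hac hbd
      · exact one a b c d ha hb hc hd (by omega) hac (.inl ⟨hab, hbc, hcd⟩) hbd
    · rcases hbd with hbd | hbd
      · refine one b c d a hb hc hd ha (by omega) hbd (.inr ⟨hab, hbc, hcd⟩) ?_
        rcases hac with ⟨h1, h2⟩ | ⟨h1, h2⟩
        · exact .inr ⟨sy h2, sy h1⟩
        · exact .inl ⟨sy h2, sy h1⟩
      · rcases hac with ⟨h1, h2⟩ | ⟨h1, h2⟩ <;> rcases hbd with ⟨h3, h4⟩ | ⟨h3, h4⟩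
        · exact nab (uniq x hx a haS b hbS hax hbx (sy h1) (sy h3))
        · exact nad (uniq x hx a haS d hdS hax hdx (sy h1) h4)
        · exact nad (uniq y hy a haS d hdS hay hdy (sy h1) h4)
        · exact nab (uniq y hy a haS b hbS hay hby (sy h1) (sy h3))

/-- Joining a nested family of pairs of points keeps a planar pairing planar. -/
theorem PlanarPairing.joinAll {V : Type} {pos : V → ℕ} {t : Setoid V} {N : ℕ}
    (x y : Fin N → V) (h : PlanarPairing pos Set.univ t) (hpos : Function.Injective pos)
    (hx : Function.Injective x) (hy : Function.Injective y) (hxy : ∀ i j, x i ≠ y j)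
    (hadj : ∀ i, (∀ a, (∀ j, j ≤ i → a ≠ x j ∧ a ≠ y j) → (pos (x i) < pos a ↔ pos (y i) < pos a)) ∨
      (∀ a, (∀ j, j ≤ i → a ≠ x j ∧ a ≠ y j) → pos (x i) < pos a ∧ pos a < pos (y i))) :
    PlanarPairing pos {a | ∀ j, a ≠ x j ∧ a ≠ y j}
      (t ⊔ Relation.EqvGen.setoid (fun u v => ∃ j, u = x j ∧ v = y j)) := by
  have key : ∀ k, k ≤ N → PlanarPairing pos {a | ∀ j : Fin N, j.val < k → a ≠ x j ∧ a ≠ y j}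
      (t ⊔ Relation.EqvGen.setoid (fun u v => ∃ j : Fin N, j.val < k ∧ u = x j ∧ v = y j)) := by
    intro k
    induction k with
    | zero =>
      intro _
      have h1 : {a | ∀ j : Fin N, j.val < 0 → a ≠ x j ∧ a ≠ y j} = Set.univ := by
        ext a; simp
      have h2 : Relation.EqvGen.setoid (fun u v => ∃ j : Fin N, j.val < 0 ∧ u = x j ∧ v = y j)
          ≤ t := by
        rw [gen_le_iff]
        rintro a b ⟨j, hj, _⟩
        omega
      rw [h1, sup_eq_left.2 h2]
      exact h
    | succ k ih =>
      intro hk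
      have ih := ih (by omega)
      let i : Fin N := ⟨k, hk⟩
      have e : (fun u v => ∃ j : Fin N, j.val < k + 1 ∧ u = x j ∧ v = y j) =
          (fun u v => (∃ j : Fin N, j.val < k ∧ u = x j ∧ v = y j) ∨ (u = x i ∧ v = y i)) := by
        funext u v
        apply propext
        constructor
        · rintro ⟨j, hj, h1, h2⟩
          rcases Nat.lt_or_ge j.val k with h3 | h3
          · exact .inl ⟨j, h3, h1, h2⟩
          · have : j = i := Fin.ext (by simp only [i]; omega)
            subst this
            exact .inr ⟨h1, h2⟩
        · rintro (⟨j, hj, h1, h2⟩ | ⟨h1, h2⟩)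
          · exact ⟨j, by omega, h1, h2⟩
          · exact ⟨i, by simp [i], h1, h2⟩
      rw [e, ← joinSetoid_eq]
      refine ih.join (x := x i) (y := y i) ?_ ?_ (hxy i i) ?_ ?_ ?_
      · intro j hj
        refine ⟨fun h => ?_, hxy i j⟩
        have := congrArg Fin.val (hx h)
        simp only [i] at this
        omega
      · intro j hj
        refine ⟨fun h => hxy j i h.symm, fun h => ?_⟩
        have := congrArg Fin.val (hy h)
        simp only [i] at this
        omega
      · intro a
        constructor
        · intro ha
          exact ⟨fun j hj => ha j (by omega), ha i (by simp [i])⟩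
        · rintro ⟨ha, ha'⟩ j hj
          rcases Nat.lt_or_ge j.val k with h3 | h3
          · exact ha j h3
          · have : j = i := Fin.ext (by simp only [i]; omega)
            subst this
            exact ha'
      · intro a ha
        have := ha i (by simp [i])
        exact ⟨fun h => this.1 (hpos h), fun h => this.2 (hpos h)⟩
      · refine (hadj i).imp ?_ ?_
        · intro hh a ha
          exact hh a fun j hj => ha j (by have : j.val ≤ k := hj; omega)
        · intro hh a ha
          exact hh a fun j hj => ha j (by have : j.val ≤ k := hj; omega)
  have h3 := key N le_rfl
  simpa using h3

/-- Transport of planar pairings to the remaining points. -/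
theorem PlanarPairing.comap {V W : Type} {pos : V → ℕ} {pos' : W → ℕ} {S : Set V} {t : Setoid V}
    (h : PlanarPairing pos S t) (f : W → V) (hf : Function.Injective f) (hS : Set.range f = S)
    (hpos : ∀ a b, pos' a < pos' b → pos (f a) < pos (f b)) :
    PlanarPairing pos' Set.univ (t.comap f) := by
  subst hS
  refine ⟨?_, ?_, ?_⟩
  · intro u _
    obtain ⟨_, ⟨v, rfl⟩, hv, huv⟩ := h.exists_partner (f u) ⟨u, rfl⟩
    exact ⟨v, trivial, fun e => hv (by rw [e]), huv⟩
  · intro u _ v _ w _ hvu hwu huv huw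
    exact hf (h.partner_unique (f u) ⟨u, rfl⟩ (f v) ⟨v, rfl⟩ (f w) ⟨w, rfl⟩
      (fun e => hvu (hf e)) (fun e => hwu (hf e)) huv huw)
  · intro a _ b _ c _ d _ h1 h2 h3 hac hbd
    exact h.planar (f a) ⟨a, rfl⟩ (f b) ⟨b, rfl⟩ (f c) ⟨c, rfl⟩ (f d) ⟨d, rfl⟩
      (hpos _ _ h1) (hpos _ _ h2) (hpos _ _ h3) hac hbd

/-- Position of an end point on the boundary of a rectangle with `n` points on the lower edge and
`m` points on the upper edge: the boundary is traversed once, first along the lower edge from left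
to right, then along the upper edge from right to left. -/
def boundaryPos (n m : ℕ) : Fin n ⊕ Fin m → ℕ :=
  Sum.elim (fun i => i.val) (fun j => n + m - 1 - j.val)

@[simp] theorem boundaryPos_inl (n m : ℕ) (i : Fin n) : boundaryPos n m (.inl i) = i.val := rfl

@[simp] theorem boundaryPos_inr (n m : ℕ) (j : Fin m) :
    boundaryPos n m (.inr j) = n + m - 1 - j.val := rfl

theorem boundaryPos_injective (n m : ℕ) : Function.Injective (boundaryPos n m) := by
  rintro (i | i) (j | j) h <;> simp at h
  · exact congrArg _ (Fin.ext h)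
  · omega
  · omega
  · exact congrArg _ (Fin.ext (by omega))

theorem boundaryPos_lt (n m : ℕ) (x : Fin n ⊕ Fin m) : boundaryPos n m x < n + m := by
  rcases x with x | x <;> simp <;> omega

/-- A Kauffman diagram with `n` end points on the lower edge (`Fin n`, on the left of the sum type)
and `m` end points on the upper edge: an isotopy class of `(n + m) / 2` non-crossing planar curves
in the rectangle joining the end points in pairs. It is recorded by the relation `rel` of being
joined by a curve. -/
@[ext]
structure Diagram (n m : ℕ) where
  /-- two end points are related when they are equal or the ends of the same curve -/
  rel : Setoid (Fin n ⊕ Fin m)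
  /-- each end point is joined to exactly one other end point -/
  pairing : ∀ x, ∃! y, y ≠ x ∧ rel x y
  /-- the curves do not cross -/
  noncrossing : ∀ a b c d, boundaryPos n m a < boundaryPos n m b →
    boundaryPos n m b < boundaryPos n m c → boundaryPos n m c < boundaryPos n m d →
    rel a c → rel b d → False

theorem Diagram.planarPairing {n m : ℕ} (D : Diagram n m) :
    PlanarPairing (boundaryPos n m) Set.univ D.rel where
  exists_partner x _ := by
    obtain ⟨y, hy, _⟩ := D.pairing x
    exact ⟨y, trivial, hy⟩
  partner_unique x _ y _ z _ hy hz hxy hxz := (D.pairing x).unique ⟨hy, hxy⟩ ⟨hz, hxz⟩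
  planar a _ b _ c _ d _ := D.noncrossing a b c d

/-- The diagram given by a planar pairing of the end points. -/
def Diagram.ofPlanarPairing {n m : ℕ} (t : Setoid (Fin n ⊕ Fin m))
    (h : PlanarPairing (boundaryPos n m) Set.univ t) : Diagram n m where
  rel := t
  pairing x := by
    obtain ⟨y, _, hy⟩ := h.exists_partner x trivial
    exact ⟨y, hy, fun z hz =>
      h.partner_unique x trivial z trivial y trivial hz.1 hy.1 hz.2 hy.2⟩
  noncrossing a b c d := h.planar a trivial b trivial c trivial d trivial

/-- Vertical strands: the `i`-th lower end point is related to the `i`-th upper one. -/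
def strands (n : ℕ) : Setoid (Fin n ⊕ Fin n) := Setoid.ker (Sum.elim id id)

/-- The diagram with `n` vertical strands. -/
def Diagram.id (n : ℕ) : Diagram n n where
  rel := strands n
  pairing := by
    have h : ∀ x y, strands n x y ↔ Sum.elim _root_.id _root_.id x
        = (Sum.elim _root_.id _root_.id y : Fin n) := fun x y => Iff.rfl
    rintro (i | i)
    · refine ⟨.inr i, ⟨by simp, rfl⟩, ?_⟩
      rintro (j | j) ⟨h1, h2⟩
      · rw [h] at h2; simp at h1 h2; exact absurd h2.symm h1
      · rw [h] at h2; simp at h2; rw [h2]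
    · refine ⟨.inl i, ⟨by simp, rfl⟩, ?_⟩
      rintro (j | j) ⟨h1, h2⟩
      · rw [h] at h2; simp at h2; rw [h2]
      · rw [h] at h2; simp at h1 h2; exact absurd h2.symm h1
  noncrossing := by
    have h : ∀ x y, strands n x y ↔ Sum.elim _root_.id _root_.id x
        = (Sum.elim _root_.id _root_.id y : Fin n) := fun x y => Iff.rfl
    rintro (a | a) (b | b) (c | c) (d | d) h1 h2 h3 h4 h5 <;> rw [h] at h4 h5 <;>
      simp at h1 h2 h3 h4 h5 <;> subst h4 <;> subst h5 <;> omega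

/-- The relation of joining the `j`-th upper end point of a box to the `j`-th lower end point of
the box stacked on top of it. -/
def seam (n m p : ℕ) : Setoid ((Fin n ⊕ Fin m) ⊕ (Fin m ⊕ Fin p)) :=
  Relation.EqvGen.setoid (fun u v => ∃ j : Fin m, u = .inl (.inr j) ∧ v = .inr (.inl j))

/-- Connectedness in the picture obtained by stacking `E` on top of `D`. -/
def glue {n m p : ℕ} (D : Diagram n m) (E : Diagram m p) :
    Setoid ((Fin n ⊕ Fin m) ⊕ (Fin m ⊕ Fin p)) :=
  sumSetoid D.rel E.rel ⊔ seam n m p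

/-- The end points that survive after stacking: the lower edge of the lower box and the upper edge
of the upper box. -/
def outer (n m p : ℕ) : Fin n ⊕ Fin p → (Fin n ⊕ Fin m) ⊕ (Fin m ⊕ Fin p) :=
  Sum.map Sum.inl Sum.inr

/-- The number of closed loops that appear when `E` is stacked on top of `D`. -/
noncomputable def loops {n m p : ℕ} (D : Diagram n m) (E : Diagram m p) : ℕ :=
  missing (glue D E) (outer n m p)

theorem sum_planarPairing {V W : Type} {f : V → ℕ} {g : W → ℕ} {r : Setoid V} {s : Setoid W}
    (hr : PlanarPairing f Set.univ r) (hs : PlanarPairing g Set.univ s)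
    (pos : V ⊕ W → ℕ)
    (hf : ∀ a b, pos (.inl a) < pos (.inl b) → f a < f b)
    (hg : ∀ a b, pos (.inr a) < pos (.inr b) → g a < g b)
    (hsep : ∀ a b b', pos (.inl a) < pos (.inr b) → pos (.inl a) < pos (.inr b')) :
    PlanarPairing pos Set.univ (sumSetoid r s) := by
  refine ⟨?_, ?_, ?_⟩
  · rintro (x | x) _
    · obtain ⟨y, _, h1, h2⟩ := hr.exists_partner x trivial
      exact ⟨.inl y, trivial, fun h => h1 (Sum.inl.inj h), .inl h2⟩
    · obtain ⟨y, _, h1, h2⟩ := hs.exists_partner x trivial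
      exact ⟨.inr y, trivial, fun h => h1 (Sum.inr.inj h), .inr h2⟩
  · rintro x _ y _ z _ hy hz (h | h) (h' | h')
    · exact congrArg _ (hr.partner_unique _ trivial _ trivial _ trivial
        (fun e => hy (by rw [e])) (fun e => hz (by rw [e])) h h')
    · exact congrArg _ (hs.partner_unique _ trivial _ trivial _ trivial
        (fun e => hy (by rw [e])) (fun e => hz (by rw [e])) h h')
  · rintro a _ b _ c _ d _ hab hbc hcd (hac | hac) (hbd | hbd)
    · exact hr.planar _ trivial _ trivial _ trivial _ trivial
        (hf _ _ hab) (hf _ _ hbc) (hf _ _ hcd) hac hbd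
    · exact absurd (hsep _ _ _ hcd) (Nat.not_lt.2 hbc.le)
    · exact absurd (hsep _ _ _ hbc) (Nat.not_lt.2 hab.le)
    · exact hs.planar _ trivial _ trivial _ trivial _ trivial
        (hg _ _ hab) (hg _ _ hbc) (hg _ _ hcd) hac hbd

/-- Positions along the boundary of two boxes drawn side by side. -/
def glueBoundaryPos (n m p : ℕ) : (Fin n ⊕ Fin m) ⊕ (Fin m ⊕ Fin p) → ℕ :=
  Sum.elim (boundaryPos n m) (fun x => n + m + boundaryPos m p x)

theorem outer_injective (n m p : ℕ) : Function.Injective (outer n m p) :=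
  Sum.map_injective.2 ⟨Sum.inl_injective, Sum.inr_injective⟩

theorem glue_planarPairing {n m p : ℕ} (D : Diagram n m) (E : Diagram m p) :
    PlanarPairing (boundaryPos n p) Set.univ ((glue D E).comap (outer n m p)) := by
  have h0 : PlanarPairing (glueBoundaryPos n m p) Set.univ (sumSetoid D.rel E.rel) := by
    refine sum_planarPairing D.planarPairing E.planarPairing _ (fun a b h => h) ?_ ?_
    · intro a b h
      simp only [glueBoundaryPos, Sum.elim_inr] at h
      omega
    · intro a b b' _
      simp only [glueBoundaryPos, Sum.elim_inr, Sum.elim_inl]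
      have := boundaryPos_lt n m a
      omega
  have hinj : Function.Injective (glueBoundaryPos n m p) := by
    rintro (a | a) (b | b) h <;> simp only [glueBoundaryPos, Sum.elim_inr, Sum.elim_inl] at h
    · exact congrArg _ (boundaryPos_injective _ _ h)
    · have := boundaryPos_lt n m a
      omega
    · have := boundaryPos_lt n m b
      omega
    · exact congrArg _ (boundaryPos_injective _ _ (by omega))
  have h1 := h0.joinAll (N := m) (fun j => .inl (.inr j)) (fun j => .inr (.inl j)) hinj
    (fun a b h => by simpa using h) (fun a b h => by simpa using h) (by simp) ?_
  · refine h1.comap (outer n m p) (outer_injective n m p) ?_ ?_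
    · ext x
      constructor
      · rintro ⟨(a | a), rfl⟩ j <;> simp [outer]
      · intro h
        rcases x with (x | x) | (x | x)
        · exact ⟨.inl x, rfl⟩
        · exact absurd rfl (h x).1
        · exact absurd rfl (h x).2
        · exact ⟨.inr x, rfl⟩
    · rintro (a | a) (b | b) h <;> simp [outer, glueBoundaryPos] at h ⊢ <;> omega
  · intro i
    left
    rintro ((a | a) | (a | a)) ha
    · simp [glueBoundaryPos]; omega
    · have : i.val < a.val := by
        by_contra hcon
        exact (ha a (by simpa using hcon)).1 rfl
      simp [glueBoundaryPos]; omega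
    · have : i.val < a.val := by
        by_contra hcon
        exact (ha a (by simpa using hcon)).2 rfl
      simp [glueBoundaryPos]; omega
    · simp [glueBoundaryPos]; omega

/-- Concatenation of diagrams, with `E` on top of `D` and closed loops removed. -/
def Diagram.comp {n m p : ℕ} (D : Diagram n m) (E : Diagram m p) : Diagram n p :=
  Diagram.ofPlanarPairing ((glue D E).comap (outer n m p)) (glue_planarPairing D E)

theorem Diagram.comp_rel {n m p : ℕ} (D : Diagram n m) (E : Diagram m p) :
    (D.comp E).rel = (glue D E).comap (outer n m p) := rfl

theorem glue_left {n m p : ℕ} (D : Diagram n m) (E : Diagram m p) {a b} (h : D.rel a b) :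
    glue D E (.inl a) (.inl b) :=
  (le_sup_left : _ ≤ glue D E) (Sum.LiftRel.inl h)

theorem glue_right {n m p : ℕ} (D : Diagram n m) (E : Diagram m p) {a b} (h : E.rel a b) :
    glue D E (.inr a) (.inr b) :=
  (le_sup_left : _ ≤ glue D E) (Sum.LiftRel.inr h)

theorem glue_seam {n m p : ℕ} (D : Diagram n m) (E : Diagram m p) (j : Fin m) :
    glue D E (.inl (.inr j)) (.inr (.inl j)) :=
  (le_sup_right : _ ≤ glue D E) (Relation.EqvGen.rel _ _ ⟨j, rfl, rfl⟩)

theorem glue_le_iff {n m p : ℕ} (D : Diagram n m) (E : Diagram m p) (t) :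
    glue D E ≤ t ↔ (∀ a b, D.rel a b → t (.inl a) (.inl b)) ∧
      (∀ a b, E.rel a b → t (.inr a) (.inr b)) ∧
      (∀ j, t (.inl (.inr j)) (.inr (.inl j))) := by
  unfold glue seam
  rw [sup_le_iff, sumSetoid_le_iff, gen_le_iff, and_assoc]
  refine and_congr_right fun _ => and_congr_right fun _ => ?_
  constructor
  · exact fun h j => h _ _ ⟨j, rfl, rfl⟩
  · rintro h _ _ ⟨j, rfl, rfl⟩
    exact h j

/-! ### Identity laws -/

theorem strands_iff {n : ℕ} (x y : Fin n ⊕ Fin n) :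
    strands n x y ↔ Sum.elim id id x = (Sum.elim id id y : Fin n) := Iff.rfl

theorem glue_id_left {n p : ℕ} (D : Diagram n p) :
    glue (Diagram.id n) D = D.rel.comap (Sum.elim (fun x => .inl (Sum.elim id id x)) id) := by
  apply le_antisymm
  · rw [glue_le_iff]
    refine ⟨?_, ?_, ?_⟩
    · intro a b h
      have h : Sum.elim id id a = (Sum.elim id id b : Fin n) := h
      simp only [Setoid.comap_rel, Sum.elim_inl, h]
      exact D.rel.refl' _
    · intro a b h
      exact h
    · intro j
      exact D.rel.refl' _
  · have key : ∀ x, glue (Diagram.id n) D x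
        (.inr (Sum.elim (fun x => .inl (Sum.elim id id x)) id x)) := by
      rintro ((x | x) | x)
      · exact Setoid.trans' _ (glue_left _ _ (b := .inr x) (by exact rfl)) (glue_seam _ _ x)
      · exact glue_seam _ _ x
      · exact Setoid.refl' _ _
    intro x y h
    exact Setoid.trans' _ (key x) (Setoid.trans' _ (glue_right _ _ h) (Setoid.symm' _ (key y)))

theorem glue_id_right {n p : ℕ} (D : Diagram n p) :
    glue D (Diagram.id p) = D.rel.comap (Sum.elim id (fun x => .inr (Sum.elim id id x))) := by
  apply le_antisymm
  · rw [glue_le_iff]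
    refine ⟨?_, ?_, ?_⟩
    · intro a b h
      exact h
    · intro a b h
      have h : Sum.elim id id a = (Sum.elim id id b : Fin p) := h
      simp only [Setoid.comap_rel, Sum.elim_inr, h]
      exact D.rel.refl' _
    · intro j
      exact D.rel.refl' _
  · have key : ∀ x, glue D (Diagram.id p) x
        (.inl (Sum.elim id (fun x => .inr (Sum.elim id id x)) x)) := by
      rintro (x | (x | x))
      · exact Setoid.refl' _ _
      · exact Setoid.symm' _ (glue_seam _ _ x)
      · exact Setoid.trans' _ (glue_right _ _ (b := .inl x) (by exact rfl))
          (Setoid.symm' _ (glue_seam _ _ x))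
    intro x y h
    exact Setoid.trans' _ (key x) (Setoid.trans' _ (glue_left _ _ h) (Setoid.symm' _ (key y)))

theorem Diagram.id_comp {n p : ℕ} (D : Diagram n p) : (Diagram.id n).comp D = D := by
  ext1
  rw [Diagram.comp_rel, glue_id_left, ← Setoid.comap_comp]
  have : (Sum.elim (fun x => .inl (Sum.elim _root_.id _root_.id x)) _root_.id) ∘ outer n n p
      = (_root_.id : Fin n ⊕ Fin p → _) := by
    funext x; rcases x with x | x <;> rfl
  rw [this, Setoid.comap_id]

theorem Diagram.comp_id {n p : ℕ} (D : Diagram n p) : D.comp (Diagram.id p) = D := by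
  ext1
  rw [Diagram.comp_rel, glue_id_right, ← Setoid.comap_comp]
  have : (Sum.elim _root_.id (fun x => .inr (Sum.elim _root_.id _root_.id x))) ∘ outer n p p
      = (_root_.id : Fin n ⊕ Fin p → _) := by
    funext x; rcases x with x | x <;> rfl
  rw [this, Setoid.comap_id]

theorem loops_id_left {n p : ℕ} (D : Diagram n p) : loops (Diagram.id n) D = 0 := by
  refine missing_eq_zero _ _ ?_
  rw [glue_id_left]
  rintro ((x | x) | (x | x))
  · exact ⟨.inl x, D.rel.refl' _⟩
  · exact ⟨.inl x, D.rel.refl' _⟩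
  · exact ⟨.inl x, D.rel.refl' _⟩
  · exact ⟨.inr x, D.rel.refl' _⟩

theorem loops_id_right {n p : ℕ} (D : Diagram n p) : loops D (Diagram.id p) = 0 := by
  refine missing_eq_zero _ _ ?_
  rw [glue_id_right]
  rintro ((x | x) | (x | x))
  · exact ⟨.inl x, D.rel.refl' _⟩
  · exact ⟨.inr x, D.rel.refl' _⟩
  · exact ⟨.inr x, D.rel.refl' _⟩
  · exact ⟨.inr x, D.rel.refl' _⟩

/-! ### Associativity -/

section Assoc

variable {n m p q : ℕ} (D : Diagram n m) (E : Diagram m p) (F : Diagram p q)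

/-- The three boxes with the two lower ones glued. -/
def glueL : Setoid (((Fin n ⊕ Fin m) ⊕ (Fin m ⊕ Fin p)) ⊕ (Fin p ⊕ Fin q)) :=
  sumSetoid (glue D E) F.rel ⊔ (seam n p q).map (Sum.map (outer n m p) id)

/-- The three boxes with the two upper ones glued. -/
def glueR : Setoid ((Fin n ⊕ Fin m) ⊕ ((Fin m ⊕ Fin p) ⊕ (Fin p ⊕ Fin q))) :=
  sumSetoid D.rel (glue E F) ⊔ (seam n m q).map (Sum.map id (outer m p q))

theorem glueL_comap : (glueL D E F).comap (Sum.map (outer n m p) id) = glue (D.comp E) F := by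
  unfold glueL
  rw [comap_sup_map, sumSetoid_comap]
  rfl

theorem glueR_comap : (glueR D E F).comap (Sum.map id (outer m p q)) = glue D (E.comp F) := by
  unfold glueR
  rw [comap_sup_map, sumSetoid_comap]
  rfl

theorem missing_id {V : Type} (r : Setoid V) : missing r (id : V → V) = 0 :=
  missing_eq_zero _ _ fun v => ⟨v, r.refl' v⟩

theorem glueL_missing : missing (glueL D E F) (Sum.map (outer n m p) id ∘ outer n p q) =
    loops (D.comp E) F + loops D E := by
  have h := missing_sup_map (Sum.map (outer n m p) id) (sumSetoid (glue D E) F.rel) (seam n p q)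
    (outer n p q)
  rw [← comap_sup_map (Sum.map (outer n m p) id), missing_sum, missing_id, add_zero] at h
  have h2 := glueL_comap D E F
  unfold glueL at h2
  rw [h2] at h
  exact h

theorem glueR_missing : missing (glueR D E F) (Sum.map id (outer m p q) ∘ outer n m q) =
    loops D (E.comp F) + loops E F := by
  have h := missing_sup_map (Sum.map id (outer m p q)) (sumSetoid D.rel (glue E F)) (seam n m q)
    (outer n m q)
  rw [← comap_sup_map (Sum.map id (outer m p q)), missing_sum, missing_id, zero_add] at h
  have h2 := glueR_comap D E F
  unfold glueR at h2
  rw [h2] at h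
  exact h

theorem glueL_eq : glueL D E F = (glueR D E F).comap (Equiv.sumAssoc _ _ _) := by
  have l1 : ∀ {x y}, glue D E x y → glueL D E F (.inl x) (.inl y) := fun h =>
    (le_sup_left : _ ≤ glueL D E F) (Sum.LiftRel.inl h)
  have l2 : ∀ {x y}, F.rel x y → glueL D E F (.inr x) (.inr y) := fun h =>
    (le_sup_left : _ ≤ glueL D E F) (Sum.LiftRel.inr h)
  have l3 : ∀ j, glueL D E F (.inl (.inr (.inr j))) (.inr (.inl j)) := fun j =>
    (map_le_iff _ _ _).1 (le_sup_right : _ ≤ glueL D E F) _ _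
      (Relation.EqvGen.rel _ _ ⟨j, rfl, rfl⟩)
  have r1 : ∀ {x y}, D.rel x y → glueR D E F (.inl x) (.inl y) := fun h =>
    (le_sup_left : _ ≤ glueR D E F) (Sum.LiftRel.inl h)
  have r2 : ∀ {x y}, glue E F x y → glueR D E F (.inr x) (.inr y) := fun h =>
    (le_sup_left : _ ≤ glueR D E F) (Sum.LiftRel.inr h)
  have r3 : ∀ j, glueR D E F (.inl (.inr j)) (.inr (.inl (.inl j))) := fun j =>
    (map_le_iff _ _ _).1 (le_sup_right : _ ≤ glueR D E F) _ _
      (Relation.EqvGen.rel _ _ ⟨j, rfl, rfl⟩)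
  apply le_antisymm
  · refine sup_le ?_ ?_
    · rw [sumSetoid_le_iff]
      refine ⟨?_, fun a b h => r2 (glue_right _ _ h)⟩
      have : glue D E ≤ ((glueR D E F).comap (Equiv.sumAssoc _ _ _)).comap Sum.inl := by
        rw [glue_le_iff]
        exact ⟨fun a b h => r1 h, fun a b h => r2 (glue_left _ _ h), fun j => r3 j⟩
      exact fun a b h => this h
    · rw [map_le_iff]
      have : seam n p q ≤ ((glueR D E F).comap (Equiv.sumAssoc _ _ _)).comap
          (Sum.map (outer n m p) id) := by
        unfold seam
        rw [gen_le_iff]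
        rintro _ _ ⟨j, rfl, rfl⟩
        exact r2 (glue_seam _ _ j)
      exact fun a b h => this h
  · have : glueR D E F ≤ (glueL D E F).comap (Equiv.sumAssoc _ _ _).symm := by
      refine sup_le ?_ ?_
      · rw [sumSetoid_le_iff]
        refine ⟨fun a b h => l1 (glue_left _ _ h), ?_⟩
        have : glue E F ≤ ((glueL D E F).comap (Equiv.sumAssoc _ _ _).symm).comap Sum.inr := by
          rw [glue_le_iff]
          exact ⟨fun a b h => l1 (glue_right _ _ h), fun a b h => l2 h, fun j => l3 j⟩
        exact fun a b h => this h
      · rw [map_le_iff]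
        have : seam n m q ≤ ((glueL D E F).comap (Equiv.sumAssoc _ _ _).symm).comap
            (Sum.map id (outer m p q)) := by
          unfold seam
          rw [gen_le_iff]
          rintro _ _ ⟨j, rfl, rfl⟩
          exact l1 (glue_seam _ _ j)
        exact fun a b h => this h
    intro x y h
    have := this h
    simpa [Setoid.comap_rel] using this

theorem assoc_outer : (Equiv.sumAssoc (Fin n ⊕ Fin m) (Fin m ⊕ Fin p) (Fin p ⊕ Fin q)) ∘
    (Sum.map (outer n m p) id ∘ outer n p q) = Sum.map id (outer m p q) ∘ outer n m q := by
  funext x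
  rcases x with x | x <;> rfl

theorem Diagram.comp_assoc : (D.comp E).comp F = D.comp (E.comp F) := by
  ext1
  rw [Diagram.comp_rel, Diagram.comp_rel, ← glueL_comap, ← glueR_comap, glueL_eq,
    ← Setoid.comap_comp, ← Setoid.comap_comp]
  exact congrArg (fun f => (glueR D E F).comap f) assoc_outer

theorem loops_assoc : loops D E + loops (D.comp E) F = loops E F + loops D (E.comp F) := by
  rw [add_comm, ← glueL_missing, add_comm, ← glueR_missing, glueL_eq,
    missing_comap_surj _ (Equiv.surjective _), assoc_outer]

end Assoc

/-! ### Juxtaposition -/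

/-- The end points of two boxes drawn side by side. -/
def boxEquiv (n m n' m' : ℕ) :
    (Fin n ⊕ Fin m) ⊕ (Fin n' ⊕ Fin m') ≃ Fin (n + n') ⊕ Fin (m + m') :=
  (Equiv.sumSumSumComm _ _ _ _).trans (Equiv.sumCongr finSumFinEquiv finSumFinEquiv)

@[simp] theorem boxEquiv_inl_inl (n m n' m' : ℕ) (i : Fin n) :
    boxEquiv n m n' m' (.inl (.inl i)) = .inl (Fin.castAdd n' i) := rfl
@[simp] theorem boxEquiv_inl_inr (n m n' m' : ℕ) (i : Fin m) :
    boxEquiv n m n' m' (.inl (.inr i)) = .inr (Fin.castAdd m' i) := rfl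
@[simp] theorem boxEquiv_inr_inl (n m n' m' : ℕ) (i : Fin n') :
    boxEquiv n m n' m' (.inr (.inl i)) = .inl (Fin.natAdd n i) := rfl
@[simp] theorem boxEquiv_inr_inr (n m n' m' : ℕ) (i : Fin m') :
    boxEquiv n m n' m' (.inr (.inr i)) = .inr (Fin.natAdd m i) := rfl

theorem tensor_planarPairing {n m n' m' : ℕ} (D : Diagram n m) (D' : Diagram n' m') :
    PlanarPairing (boundaryPos (n + n') (m + m')) Set.univ
      ((sumSetoid D.rel D'.rel).comap (boxEquiv n m n' m').symm) := by
  have h : PlanarPairing (boundaryPos (n + n') (m + m') ∘ boxEquiv n m n' m') Set.univ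
      (sumSetoid D.rel D'.rel) := by
    refine sum_planarPairing D.planarPairing D'.planarPairing _ ?_ ?_ ?_
    · rintro (a | a) (b | b) h <;> simp at h ⊢ <;> omega
    · rintro (a | a) (b | b) h <;> simp at h ⊢ <;> omega
    · rintro (a | a) (b | b) (c | c) h <;> simp at h ⊢ <;> omega
  refine h.comap _ (Equiv.injective _) (Equiv.range_eq_univ _) ?_
  intro a b hab
  simpa using hab

/-- Juxtaposition: `D` is drawn to the left of `D'`. -/
def Diagram.tensor {n m n' m' : ℕ} (D : Diagram n m) (D' : Diagram n' m') :
    Diagram (n + n') (m + m') :=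
  Diagram.ofPlanarPairing ((sumSetoid D.rel D'.rel).comap (boxEquiv n m n' m').symm)
    (tensor_planarPairing D D')

theorem Diagram.tensor_rel {n m n' m' : ℕ} (D : Diagram n m) (D' : Diagram n' m') :
    (D.tensor D').rel = (sumSetoid D.rel D'.rel).comap (boxEquiv n m n' m').symm := rfl

theorem Diagram.tensor_rel_iff {n m n' m' : ℕ} (D : Diagram n m) (D' : Diagram n' m') (x y) :
    (D.tensor D').rel (boxEquiv n m n' m' x) (boxEquiv n m n' m' y) ↔
      sumSetoid D.rel D'.rel x y := by
  rw [Diagram.tensor_rel, Setoid.comap_rel, Equiv.symm_apply_apply, Equiv.symm_apply_apply]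

theorem Diagram.tensor_le_iff {n m n' m' : ℕ} (D : Diagram n m) (D' : Diagram n' m') (t) :
    (D.tensor D').rel ≤ t ↔
      (∀ a b, D.rel a b → t (boxEquiv n m n' m' (.inl a)) (boxEquiv n m n' m' (.inl b))) ∧
      (∀ a b, D'.rel a b → t (boxEquiv n m n' m' (.inr a)) (boxEquiv n m n' m' (.inr b))) := by
  have : (D.tensor D').rel ≤ t ↔ sumSetoid D.rel D'.rel ≤ t.comap (boxEquiv n m n' m') := by
    constructor
    · intro h x y hxy
      exact h ((Diagram.tensor_rel_iff D D' x y).2 hxy)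
    · intro h x y hxy
      have h2 := h hxy
      simpa [Setoid.comap_rel] using h2
  rw [this, sumSetoid_le_iff]
  rfl

theorem Diagram.id_tensor_id (n k : ℕ) :
    (Diagram.id n).tensor (Diagram.id k) = Diagram.id (n + k) := by
  have hs : ∀ {n : ℕ} (x y : Fin n ⊕ Fin n), (Diagram.id n).rel x y ↔
    Sum.elim _root_.id _root_.id x = (Sum.elim _root_.id _root_.id y : Fin n) := fun x y => Iff.rfl
  ext x y
  obtain ⟨x, rfl⟩ := (boxEquiv _ _ _ _).surjective x
  obtain ⟨y, rfl⟩ := (boxEquiv _ _ _ _).surjective y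
  rw [Diagram.tensor_rel_iff]
  constructor
  · rintro (h | h)
    · rename_i a b
      rw [hs] at h ⊢
      rcases a with a | a <;> rcases b with b | b <;> simp at h <;> subst h <;> rfl
    · rename_i a b
      rw [hs] at h ⊢
      rcases a with a | a <;> rcases b with b | b <;> simp at h <;> subst h <;> rfl
  · intro h
    rw [hs] at h
    rcases x with (x | x) | (x | x) <;> rcases y with (y | y) | (y | y) <;>
      simp [Fin.ext_iff] at h <;>
      first
      | exact .inl (by rw [hs]; exact Fin.ext h)
      | exact .inr (by rw [hs]; exact Fin.ext h)
      | (exfalso; omega)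

section Interchange

variable {n m p n' m' p' : ℕ} (D : Diagram n m) (E : Diagram m p)
  (D' : Diagram n' m') (E' : Diagram m' p')

/-- The end points of four boxes, first stacked then juxtaposed or conversely. -/
def fourEquiv (n m p n' m' p' : ℕ) :
    ((Fin n ⊕ Fin m) ⊕ (Fin m ⊕ Fin p)) ⊕ ((Fin n' ⊕ Fin m') ⊕ (Fin m' ⊕ Fin p')) ≃
      (Fin (n + n') ⊕ Fin (m + m')) ⊕ (Fin (m + m') ⊕ Fin (p + p')) :=
  (Equiv.sumSumSumComm _ _ _ _).trans (Equiv.sumCongr (boxEquiv n m n' m') (boxEquiv m p m' p'))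

theorem glue_tensor : (glue (D.tensor D') (E.tensor E')).comap (fourEquiv n m p n' m' p') =
    sumSetoid (glue D E) (glue D' E') := by
  apply le_antisymm
  · have : glue (D.tensor D') (E.tensor E') ≤
        (sumSetoid (glue D E) (glue D' E')).comap (fourEquiv n m p n' m' p').symm := by
      have e : ∀ x, (fourEquiv n m p n' m' p').symm (fourEquiv n m p n' m' p' x) = x :=
        fun x => Equiv.symm_apply_apply _ _
      rw [glue_le_iff]
      refine ⟨?_, ?_, ?_⟩
      · have : (D.tensor D').rel ≤ ((sumSetoid (glue D E) (glue D' E')).comap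
            (fourEquiv n m p n' m' p').symm).comap Sum.inl := by
          rw [Diagram.tensor_le_iff]
          constructor
          · intro a b h
            have := (Sum.LiftRel.inl (glue_left D E h) :
              sumSetoid (glue D E) (glue D' E') (.inl (.inl a)) (.inl (.inl b)))
            rw [← e (.inl (.inl a)), ← e (.inl (.inl b))] at this
            exact this
          · intro a b h
            have := (Sum.LiftRel.inr (glue_left D' E' h) :
              sumSetoid (glue D E) (glue D' E') (.inr (.inl a)) (.inr (.inl b)))
            rw [← e (.inr (.inl a)), ← e (.inr (.inl b))] at this
            exact this
        exact fun a b h => this h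
      · have : (E.tensor E').rel ≤ ((sumSetoid (glue D E) (glue D' E')).comap
            (fourEquiv n m p n' m' p').symm).comap Sum.inr := by
          rw [Diagram.tensor_le_iff]
          constructor
          · intro a b h
            have := (Sum.LiftRel.inl (glue_right D E h) :
              sumSetoid (glue D E) (glue D' E') (.inl (.inr a)) (.inl (.inr b)))
            rw [← e (.inl (.inr a)), ← e (.inl (.inr b))] at this
            exact this
          · intro a b h
            have := (Sum.LiftRel.inr (glue_right D' E' h) :
              sumSetoid (glue D E) (glue D' E') (.inr (.inr a)) (.inr (.inr b)))
            rw [← e (.inr (.inr a)), ← e (.inr (.inr b))] at this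
            exact this
        exact fun a b h => this h
      · intro j
        obtain ⟨j, rfl⟩ := finSumFinEquiv.surjective j
        rcases j with j | j
        · have := (Sum.LiftRel.inl (glue_seam D E j) :
            sumSetoid (glue D E) (glue D' E') (.inl (.inl (.inr j))) (.inl (.inr (.inl j))))
          rw [← e (.inl (.inl (.inr j))), ← e (.inl (.inr (.inl j)))] at this
          exact this
        · have := (Sum.LiftRel.inr (glue_seam D' E' j) :
            sumSetoid (glue D E) (glue D' E') (.inr (.inl (.inr j))) (.inr (.inr (.inl j))))
          rw [← e (.inr (.inl (.inr j))), ← e (.inr (.inr (.inl j)))] at this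
          exact this
    intro x y h
    have h2 : (glue (D.tensor D') (E.tensor E')) (fourEquiv n m p n' m' p' x)
      (fourEquiv n m p n' m' p' y) := h
    have := this h2
    rw [Setoid.comap_rel, Equiv.symm_apply_apply, Equiv.symm_apply_apply] at this
    exact this
  · rw [sumSetoid_le_iff]
    constructor
    · have : glue D E ≤ ((glue (D.tensor D') (E.tensor E')).comap
          (fourEquiv n m p n' m' p')).comap Sum.inl := by
        rw [glue_le_iff]
        refine ⟨fun a b h => ?_, fun a b h => ?_, fun j => ?_⟩
        · exact glue_left _ _ ((Diagram.tensor_rel_iff D D' (.inl a) (.inl b)).2 (.inl h))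
        · exact glue_right _ _ ((Diagram.tensor_rel_iff E E' (.inl a) (.inl b)).2 (.inl h))
        · exact glue_seam (D.tensor D') (E.tensor E') (Fin.castAdd m' j)
      exact fun a b h => this h
    · have : glue D' E' ≤ ((glue (D.tensor D') (E.tensor E')).comap
          (fourEquiv n m p n' m' p')).comap Sum.inr := by
        rw [glue_le_iff]
        refine ⟨fun a b h => ?_, fun a b h => ?_, fun j => ?_⟩
        · exact glue_left _ _ ((Diagram.tensor_rel_iff D D' (.inr a) (.inr b)).2 (.inr h))
        · exact glue_right _ _ ((Diagram.tensor_rel_iff E E' (.inr a) (.inr b)).2 (.inr h))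
        · exact glue_seam (D.tensor D') (E.tensor E') (Fin.natAdd m j)
      exact fun a b h => this h

theorem four_outer : fourEquiv n m p n' m' p' ∘ Sum.map (outer n m p) (outer n' m' p') =
    outer (n + n') (m + m') (p + p') ∘ boxEquiv n p n' p' := by
  funext x
  rcases x with (x | x) | (x | x) <;> rfl

theorem Diagram.tensor_comp :
    (D.tensor D').comp (E.tensor E') = (D.comp E).tensor (D'.comp E') := by
  have h : ((D.tensor D').comp (E.tensor E')).rel.comap (boxEquiv n p n' p') =
      ((D.comp E).tensor (D'.comp E')).rel.comap (boxEquiv n p n' p') := by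
    have h2 : ((D.comp E).tensor (D'.comp E')).rel.comap (boxEquiv n p n' p') =
        sumSetoid (D.comp E).rel (D'.comp E').rel := by
      ext x y
      exact Diagram.tensor_rel_iff _ _ x y
    rw [h2, Diagram.comp_rel, Diagram.comp_rel, Diagram.comp_rel, ← sumSetoid_comap,
      ← glue_tensor, ← Setoid.comap_comp, ← Setoid.comap_comp]
    exact congrArg (fun f => (glue (D.tensor D') (E.tensor E')).comap f) four_outer.symm
  ext1
  exact Setoid.comap_injective _ (Equiv.surjective _) h

theorem missing_comp_surj {V O P : Type} (r : Setoid V) (κ : O → V) (f : P → O)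
    (hf : Function.Surjective f) : missing r (κ ∘ f) = missing r κ := by
  unfold missing
  congr 1
  congr 1
  funext c
  exact propext ⟨fun h o => by obtain ⟨p, rfl⟩ := hf o; exact h p, fun h p => h (f p)⟩

theorem loops_tensor :
    loops (D.tensor D') (E.tensor E') = loops D E + loops D' E' := by
  have h := missing_sum (glue D E) (glue D' E') (outer n m p) (outer n' m' p')
  rw [← glue_tensor, missing_comap_surj _ (Equiv.surjective _), four_outer,
    missing_comp_surj _ _ _ (Equiv.surjective _)] at h
  exact h

end Interchange

/-! ### Closing diagrams -/

/-- The number of closed curves obtained by closing the diagram `A` completely, that is, by joining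
the `i`-th lower end point to the `i`-th upper end point for all `i`. -/
noncomputable def closedLoops {n : ℕ} (A : Diagram n n) : ℕ :=
  Nat.card (Quotient (A.rel ⊔ strands n))

/-- The number of closed curves when the ends of `D` and `E` are joined to each other. -/
noncomputable def pairLoops {n m : ℕ} (D : Diagram n m) (E : Diagram m n) : ℕ :=
  Nat.card (Quotient (E.rel ⊔ D.rel.comap Sum.swap))

theorem pairLoops_comm {n m : ℕ} (D : Diagram n m) (E : Diagram m n) :
    pairLoops D E = pairLoops E D := by
  unfold pairLoops
  have h : E.rel ⊔ D.rel.comap Sum.swap = (D.rel ⊔ E.rel.comap Sum.swap).comap Sum.swap := by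
    have aux : ∀ {n m : ℕ} (D : Diagram n m) (E : Diagram m n),
        E.rel ⊔ D.rel.comap Sum.swap ≤ (D.rel ⊔ E.rel.comap Sum.swap).comap Sum.swap := by
      intro n m D E
      refine sup_le ?_ ?_
      · intro a b h
        refine (le_sup_right : _ ≤ D.rel ⊔ E.rel.comap Sum.swap) ?_
        simpa [Setoid.comap_rel] using h
      · intro a b h
        exact (le_sup_left : _ ≤ D.rel ⊔ E.rel.comap Sum.swap) h
    apply le_antisymm (aux D E)
    intro a b h
    have := aux E D h
    simpa [Setoid.comap_rel] using this
  rw [h, card_quotient_eq, card_quotient_eq, missing_comap_surj _ Sum.swap_rightInverse.surjective]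
  congr 1
  funext x
  exact x.elim

theorem closedLoops_comp {n m : ℕ} (D : Diagram n m) (E : Diagram m n) :
    closedLoops (D.comp E) + loops D E = pairLoops D E := by
  have h := missing_sup_map (outer n m n) (glue D E) (strands n) (Empty.elim : Empty → _)
  have e0 : outer n m n ∘ (Empty.elim : Empty → _) = Empty.elim := by
    funext x; exact x.elim
  rw [e0, ← card_quotient_eq, ← card_quotient_eq] at h
  unfold closedLoops
  rw [Diagram.comp_rel]
  refine h.symm.trans ?_
  have e1 : glue D E ⊔ (strands n).map (outer n m n) =
      (E.rel ⊔ D.rel.comap Sum.swap).comap (Sum.elim Sum.swap id) := by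
    apply le_antisymm
    · refine sup_le ?_ ?_
      · rw [glue_le_iff]
        refine ⟨fun a b h => ?_, fun a b h => ?_, fun j => (E.rel ⊔ D.rel.comap Sum.swap).refl' _⟩
        · refine (le_sup_right : _ ≤ E.rel ⊔ D.rel.comap Sum.swap) ?_
          simpa [Setoid.comap_rel] using h
        · exact (le_sup_left : _ ≤ E.rel ⊔ D.rel.comap Sum.swap) h
      · rw [map_le_iff]
        rintro (a | a) (b | b) h <;> rw [strands_iff] at h <;> simp at h <;> subst h <;>
          exact (E.rel ⊔ D.rel.comap Sum.swap).refl' _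
    · have l1 : glue D E ≤ glue D E ⊔ (strands n).map (outer n m n) := le_sup_left
      have l2 := (map_le_iff _ _ _).1
        (le_sup_right : _ ≤ glue D E ⊔ (strands n).map (outer n m n))
      have key : ∀ x, (glue D E ⊔ (strands n).map (outer n m n)) (.inl (Sum.swap x)) (.inr x) := by
        rintro (x | x)
        · exact l1 (glue_seam D E x)
        · exact l2 (.inl x) (.inr x) (by exact rfl)
      have key2 : ∀ x, (glue D E ⊔ (strands n).map (outer n m n)) x
          (.inr (Sum.elim Sum.swap id x)) := by
        rintro (x | x)
        · have := key (Sum.swap x)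
          rwa [Sum.swap_swap] at this
        · exact Setoid.refl' _ _
      have key3 : E.rel ⊔ D.rel.comap Sum.swap ≤
          (glue D E ⊔ (strands n).map (outer n m n)).comap Sum.inr := by
        refine sup_le (fun a b h => l1 (glue_right D E h)) ?_
        intro a b h
        have h2 : (glue D E ⊔ (strands n).map (outer n m n)) (.inr a) (.inr b) :=
          Setoid.trans' _ (Setoid.symm' _ (key a))
            (Setoid.trans' _ (l1 (glue_left D E h)) (key b))
        exact h2
      intro x y h
      exact Setoid.trans' _ (key2 x) (Setoid.trans' _ (key3 h) (Setoid.symm' _ (key2 y)))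
  rw [e1, card_quotient_eq, missing_comap_surj _ (fun x => ⟨.inr x, rfl⟩)]
  unfold pairLoops
  rw [card_quotient_eq]
  congr 1
  funext x
  exact x.elim

/-! ### Partial closing -/

section Partial

variable {n m k : ℕ}

/-- Joining the last `k` lower end points to the last `k` upper ones. -/
def seamRight (m n k : ℕ) : Setoid (Fin (m + k) ⊕ Fin (n + k)) :=
  Relation.EqvGen.setoid (fun u v => ∃ j : Fin k, u = .inl (Fin.natAdd m j) ∧
    v = .inr (Fin.natAdd n j))

/-- Joining the first `k` lower end points to the first `k` upper ones. -/
def seamLeft (m n k : ℕ) : Setoid (Fin (k + m) ⊕ Fin (k + n)) :=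
  Relation.EqvGen.setoid (fun u v => ∃ j : Fin k, u = .inl (Fin.castAdd m j) ∧
    v = .inr (Fin.castAdd n j))

/-- The end points that survive after closing the last `k` strands. -/
def keepRight (m n k : ℕ) : Fin m ⊕ Fin n → Fin (m + k) ⊕ Fin (n + k) :=
  Sum.map (Fin.castAdd k) (Fin.castAdd k)

/-- The end points that survive after closing the first `k` strands. -/
def keepLeft (m n k : ℕ) : Fin m ⊕ Fin n → Fin (k + m) ⊕ Fin (k + n) :=
  Sum.map (Fin.natAdd k) (Fin.natAdd k)

theorem closeRight_planarPairing (E : Diagram (m + k) (n + k)) :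
    PlanarPairing (boundaryPos m n) Set.univ ((E.rel ⊔ seamRight m n k).comap (keepRight m n k)) := by
  have h1 := E.planarPairing.joinAll (N := k) (fun j => .inl (Fin.natAdd m j.rev))
    (fun j => .inr (Fin.natAdd n j.rev)) (boundaryPos_injective _ _)
    (fun a b h => by simpa using h) (fun a b h => by simpa using h) (by simp) ?_
  · have e : (fun u v => ∃ j : Fin k, u = (.inl (Fin.natAdd m j.rev) : Fin (m + k) ⊕ Fin (n + k)) ∧
        v = (.inr (Fin.natAdd n j.rev) : Fin (m + k) ⊕ Fin (n + k))) =
        (fun u v => ∃ j : Fin k, u = .inl (Fin.natAdd m j) ∧ v = .inr (Fin.natAdd n j)) := by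
      funext u v
      exact propext ⟨fun ⟨j, h⟩ => ⟨j.rev, h⟩, fun ⟨j, h⟩ => ⟨j.rev, by rwa [Fin.rev_rev]⟩⟩
    rw [e] at h1
    refine h1.comap (keepRight m n k) ?_ ?_ ?_
    · exact Sum.map_injective.2 ⟨Fin.castAdd_injective _ _, Fin.castAdd_injective _ _⟩
    · ext x
      constructor
      · rintro ⟨(a | a), rfl⟩ j <;> simp [keepRight, Fin.ext_iff] <;> omega
      · intro h
        rcases x with x | x <;> induction x using Fin.addCases with
        | left i => first | exact ⟨.inl i, rfl⟩ | exact ⟨.inr i, rfl⟩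
        | right i =>
          have := h i.rev
          simp at this
    · rintro (a | a) (b | b) h <;> simp [keepRight] at h ⊢ <;> omega
  · intro i
    left
    rintro (a | a) ha <;> induction a using Fin.addCases with
      | left j => simp; omega
      | right j =>
        have : i.val < j.rev.val := by
          by_contra hcon
          have := ha j.rev (Fin.le_def.2 (Nat.le_of_not_lt hcon))
          simp at this
        simp at this ⊢
        omega

theorem closeLeft_planarPairing (E : Diagram (k + m) (k + n)) :
    PlanarPairing (boundaryPos m n) Set.univ ((E.rel ⊔ seamLeft m n k).comap (keepLeft m n k)) := by
  have h1 := E.planarPairing.joinAll (N := k) (fun j => .inl (Fin.castAdd m j))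
    (fun j => .inr (Fin.castAdd n j)) (boundaryPos_injective _ _)
    (fun a b h => by simpa using h) (fun a b h => by simpa using h) (by simp) ?_
  · refine h1.comap (keepLeft m n k) ?_ ?_ ?_
    · exact Sum.map_injective.2 ⟨Fin.natAdd_injective _ _, Fin.natAdd_injective _ _⟩
    · ext x
      constructor
      · rintro ⟨(a | a), rfl⟩ j <;> simp [keepLeft, Fin.ext_iff] <;> omega
      · intro h
        rcases x with x | x <;> induction x using Fin.addCases with
        | right i => first | exact ⟨.inl i, rfl⟩ | exact ⟨.inr i, rfl⟩
        | left i =>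
          have := h i
          simp at this
    · rintro (a | a) (b | b) h <;> simp [keepLeft] at h ⊢ <;> omega
  · intro i
    right
    rintro (a | a) ha <;> induction a using Fin.addCases with
      | right j => simp; omega
      | left j =>
        have : i.val < j.val := by
          by_contra hcon
          have := ha j (Fin.le_def.2 (Nat.le_of_not_lt hcon))
          simp at this
        simp at this ⊢
        omega

/-- Close the last `k` strands and remove the loops. -/
def Diagram.closeRight (E : Diagram (m + k) (n + k)) : Diagram m n :=
  Diagram.ofPlanarPairing _ (closeRight_planarPairing E)

/-- Close the first `k` strands and remove the loops. -/
def Diagram.closeLeft (E : Diagram (k + m) (k + n)) : Diagram m n :=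
  Diagram.ofPlanarPairing _ (closeLeft_planarPairing E)

theorem pairLoops_closeRight (D : Diagram n m) (E : Diagram (m + k) (n + k)) :
    pairLoops (D.tensor (Diagram.id k)) E =
      pairLoops D E.closeRight + missing (E.rel ⊔ seamRight m n k) (keepRight m n k) := by
  have h := missing_sup_map (keepRight m n k) (E.rel ⊔ seamRight m n k) (D.rel.comap Sum.swap)
    (Empty.elim : Empty → _)
  have e0 : keepRight m n k ∘ (Empty.elim : Empty → _) = Empty.elim := by
    funext x; exact x.elim
  rw [e0, ← card_quotient_eq, ← card_quotient_eq] at h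
  unfold pairLoops
  refine Eq.trans ?_ h
  have : (D.tensor (Diagram.id k)).rel.comap Sum.swap =
      seamRight m n k ⊔ (D.rel.comap Sum.swap).map (keepRight m n k) := by
    apply le_antisymm
    · have : (D.tensor (Diagram.id k)).rel ≤
        (seamRight m n k ⊔ (D.rel.comap Sum.swap).map (keepRight m n k)).comap Sum.swap := by
        have l2 := (map_le_iff _ _ _).1
          (le_sup_right : _ ≤ seamRight m n k ⊔ (D.rel.comap Sum.swap).map (keepRight m n k))
        have l1 : ∀ j, (seamRight m n k ⊔ (D.rel.comap Sum.swap).map (keepRight m n k))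
          (.inl (Fin.natAdd m j)) (.inr (Fin.natAdd n j)) := fun j =>
          (le_sup_left : seamRight m n k ≤ _) (Relation.EqvGen.rel _ _ ⟨j, rfl, rfl⟩)
        rw [Diagram.tensor_le_iff]
        constructor
        · intro a b h
          have := l2 (Sum.swap a) (Sum.swap b) (by simpa [Setoid.comap_rel] using h)
          rcases a with a | a <;> rcases b with b | b <;> exact this
        · intro a b h
          have h : Sum.elim id id a = (Sum.elim id id b : Fin k) := h
          rcases a with a | a <;> rcases b with b | b <;> simp at h <;> subst h
          · exact Setoid.refl' _ _
          · exact Setoid.symm' _ (l1 a)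
          · exact l1 a
          · exact Setoid.refl' _ _
      intro x y h
      have := this h
      simpa [Setoid.comap_rel] using this
    · refine sup_le ?_ ?_
      · unfold seamRight
        rw [gen_le_iff]
        rintro _ _ ⟨j, rfl, rfl⟩
        exact (Diagram.tensor_rel_iff D (Diagram.id k) (.inr (.inr j)) (.inr (.inl j))).2
          (.inr (by exact rfl))
      · rw [map_le_iff]
        intro a b h
        have := (Diagram.tensor_rel_iff D (Diagram.id k) (.inl (Sum.swap a)) (.inl (Sum.swap b))).2
          (.inl h)
        rcases a with a | a <;> rcases b with b | b <;> exact this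
  rw [this, sup_assoc]

theorem pairLoops_closeLeft (D : Diagram n m) (E : Diagram (k + m) (k + n)) :
    pairLoops ((Diagram.id k).tensor D) E =
      pairLoops D E.closeLeft + missing (E.rel ⊔ seamLeft m n k) (keepLeft m n k) := by
  have h := missing_sup_map (keepLeft m n k) (E.rel ⊔ seamLeft m n k) (D.rel.comap Sum.swap)
    (Empty.elim : Empty → _)
  have e0 : keepLeft m n k ∘ (Empty.elim : Empty → _) = Empty.elim := by
    funext x; exact x.elim
  rw [e0, ← card_quotient_eq, ← card_quotient_eq] at h
  unfold pairLoops
  refine Eq.trans ?_ h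
  have : ((Diagram.id k).tensor D).rel.comap Sum.swap =
      seamLeft m n k ⊔ (D.rel.comap Sum.swap).map (keepLeft m n k) := by
    apply le_antisymm
    · have : ((Diagram.id k).tensor D).rel ≤
        (seamLeft m n k ⊔ (D.rel.comap Sum.swap).map (keepLeft m n k)).comap Sum.swap := by
        have l2 := (map_le_iff _ _ _).1
          (le_sup_right : _ ≤ seamLeft m n k ⊔ (D.rel.comap Sum.swap).map (keepLeft m n k))
        have l1 : ∀ j, (seamLeft m n k ⊔ (D.rel.comap Sum.swap).map (keepLeft m n k))
          (.inl (Fin.castAdd m j)) (.inr (Fin.castAdd n j)) := fun j =>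
          (le_sup_left : seamLeft m n k ≤ _) (Relation.EqvGen.rel _ _ ⟨j, rfl, rfl⟩)
        rw [Diagram.tensor_le_iff]
        constructor
        · intro a b h
          have h : Sum.elim id id a = (Sum.elim id id b : Fin k) := h
          rcases a with a | a <;> rcases b with b | b <;> simp at h <;> subst h
          · exact Setoid.refl' _ _
          · exact Setoid.symm' _ (l1 a)
          · exact l1 a
          · exact Setoid.refl' _ _
        · intro a b h
          have := l2 (Sum.swap a) (Sum.swap b) (by simpa [Setoid.comap_rel] using h)
          rcases a with a | a <;> rcases b with b | b <;> exact this
      intro x y h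
      have := this h
      simpa [Setoid.comap_rel] using this
    · refine sup_le ?_ ?_
      · unfold seamLeft
        rw [gen_le_iff]
        rintro _ _ ⟨j, rfl, rfl⟩
        exact (Diagram.tensor_rel_iff (Diagram.id k) D (.inl (.inr j)) (.inl (.inl j))).2
          (.inl (by exact rfl))
      · rw [map_le_iff]
        intro a b h
        have := (Diagram.tensor_rel_iff (Diagram.id k) D (.inr (Sum.swap a)) (.inr (Sum.swap b))).2
          (.inr h)
        rcases a with a | a <;> rcases b with b | b <;> exact this
  rw [this, sup_assoc]

end Partial

/-! ### The Temperley-Lieb category -/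

/-- The free vector space on the diagrams with `n` lower and `m` upper end points. -/
abbrev DiagramSpace (n m : ℕ) : Type := Diagram n m →₀ ℂ

/-- Bilinear extension of concatenation (the second argument on top of the first), every closed
loop being replaced by the scalar `d`. -/
noncomputable def compLin (d : ℂ) (n m p : ℕ) :
    DiagramSpace n m →ₗ[ℂ] DiagramSpace m p →ₗ[ℂ] DiagramSpace n p :=
  Finsupp.linearCombination ℂ fun D => Finsupp.linearCombination ℂ fun E =>
    Finsupp.single (D.comp E) (d ^ loops D E)

/-- Bilinear extension of juxtaposition. -/
noncomputable def tensorLin (n m n' m' : ℕ) :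
    DiagramSpace n m →ₗ[ℂ] DiagramSpace n' m' →ₗ[ℂ] DiagramSpace (n + n') (m + m') :=
  Finsupp.linearCombination ℂ fun D => Finsupp.linearCombination ℂ fun D' =>
    Finsupp.single (D.tensor D') 1

/-- The Markov trace: close diagrams completely and replace every closed curve by `d`. -/
noncomputable def markovTrace (d : ℂ) (n : ℕ) : DiagramSpace n n →ₗ[ℂ] ℂ :=
  Finsupp.linearCombination ℂ fun A => d ^ closedLoops A

@[simp] theorem compLin_single (d : ℂ) {n m p : ℕ} (D : Diagram n m) (E : Diagram m p) (a b : ℂ) :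
    compLin d n m p (Finsupp.single D a) (Finsupp.single E b) =
      Finsupp.single (D.comp E) (a * b * d ^ loops D E) := by
  unfold compLin
  rw [Finsupp.linearCombination_single, LinearMap.smul_apply, Finsupp.linearCombination_single,
    Finsupp.smul_single, Finsupp.smul_single, smul_eq_mul, smul_eq_mul, mul_assoc]

@[simp] theorem tensorLin_single {n m n' m' : ℕ} (D : Diagram n m) (D' : Diagram n' m') (a b : ℂ) :
    tensorLin n m n' m' (Finsupp.single D a) (Finsupp.single D' b) =
      Finsupp.single (D.tensor D') (a * b) := by
  simp [tensorLin, Finsupp.linearCombination_single]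

@[simp] theorem markovTrace_single (d : ℂ) {n : ℕ} (A : Diagram n n) (a : ℂ) :
    markovTrace d n (Finsupp.single A a) = a * d ^ closedLoops A := by
  simp [markovTrace, Finsupp.linearCombination_single]

/-- The identity of `X ^ n`. -/
noncomputable def idLin (n : ℕ) : DiagramSpace n n := Finsupp.single (Diagram.id n) 1

theorem id_compLin (d : ℂ) {n m : ℕ} (f : DiagramSpace n m) :
    compLin d n n m (idLin n) f = f := by
  induction f using Finsupp.induction_linear with
  | zero => simp
  | add f g hf hg => rw [map_add, hf, hg]
  | single D a => simp [idLin, Diagram.id_comp, loops_id_left]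

theorem compLin_id (d : ℂ) {n m : ℕ} (f : DiagramSpace n m) :
    compLin d n m m f (idLin m) = f := by
  induction f using Finsupp.induction_linear with
  | zero => simp
  | add f g hf hg => rw [map_add, LinearMap.add_apply, hf, hg]
  | single D a => simp [idLin, Diagram.comp_id, loops_id_right]

theorem compLin_assoc (d : ℂ) {n m p q : ℕ} (f : DiagramSpace n m) (g : DiagramSpace m p)
    (h : DiagramSpace p q) :
    compLin d n p q (compLin d n m p f g) h = compLin d n m q f (compLin d m p q g h) := by
  induction f using Finsupp.induction_linear with
  | zero => simp
  | add f f' hf hf' => simp only [map_add, LinearMap.add_apply, hf, hf']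
  | single D a =>
  induction g using Finsupp.induction_linear with
  | zero => simp
  | add f f' hf hf' => simp only [map_add, LinearMap.add_apply, hf, hf']
  | single E b =>
  induction h using Finsupp.induction_linear with
  | zero => simp
  | add f f' hf hf' => simp only [map_add, hf, hf']
  | single F c =>
    rw [compLin_single, compLin_single, compLin_single, compLin_single, Diagram.comp_assoc]
    congr 1
    have h := loops_assoc D E F
    calc a * b * d ^ loops D E * c * d ^ loops (D.comp E) F
        = a * b * c * d ^ (loops D E + loops (D.comp E) F) := by rw [pow_add]; ring
      _ = _ := by rw [h, pow_add]; ring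

theorem tensorLin_comp (d : ℂ) {n m p n' m' p' : ℕ} (f : DiagramSpace n m) (g : DiagramSpace m p)
    (f' : DiagramSpace n' m') (g' : DiagramSpace m' p') :
    compLin d _ _ _ (tensorLin n m n' m' f f') (tensorLin m p m' p' g g') =
      tensorLin n p n' p' (compLin d n m p f g) (compLin d n' m' p' f' g') := by
  induction f using Finsupp.induction_linear with
  | zero => simp
  | add f f' hf hf' => simp only [map_add, LinearMap.add_apply, hf, hf']
  | single D a =>
  induction g using Finsupp.induction_linear with
  | zero => simp
  | add f f' hf hf' => simp only [map_add, LinearMap.add_apply, hf, hf']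
  | single E b =>
  induction f' using Finsupp.induction_linear with
  | zero => simp
  | add f f' hf hf' => simp only [map_add, LinearMap.add_apply, hf, hf']
  | single D' a' =>
  induction g' using Finsupp.induction_linear with
  | zero => simp
  | add f f' hf hf' => simp only [map_add, hf, hf']
  | single E' b' =>
    simp only [tensorLin_single, compLin_single, Diagram.tensor_comp, loops_tensor, pow_add]
    congr 1
    ring

theorem idLin_tensor (n k : ℕ) : tensorLin n n k k (idLin n) (idLin k) = idLin (n + k) := by
  simp [idLin, Diagram.id_tensor_id]

theorem markovTrace_comm (d : ℂ) {n m : ℕ} (f : DiagramSpace n m) (g : DiagramSpace m n) :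
    markovTrace d n (compLin d n m n f g) = markovTrace d m (compLin d m n m g f) := by
  induction f using Finsupp.induction_linear with
  | zero => simp
  | add f f' hf hf' => simp only [map_add, LinearMap.add_apply, hf, hf']
  | single D a =>
  induction g using Finsupp.induction_linear with
  | zero => simp
  | add f f' hf hf' => simp only [map_add, LinearMap.add_apply, hf, hf']
  | single E b =>
    have h : closedLoops (D.comp E) + loops D E = closedLoops (E.comp D) + loops E D := by
      rw [closedLoops_comp, closedLoops_comp, pairLoops_comm]
    simp only [compLin_single, markovTrace_single]
    rw [mul_assoc, ← pow_add, add_comm, h, add_comm, pow_add]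
    ring

/-- `Ker (X ^ n, X ^ m)`: the radical of the trace pairing. -/
noncomputable def traceKer (d : ℂ) (n m : ℕ) : Submodule ℂ (DiagramSpace n m) where
  carrier := {f | ∀ g : DiagramSpace m n, markovTrace d n (compLin d n m n f g) = 0}
  zero_mem' := by simp
  add_mem' := by
    intro f f' hf hf' g
    rw [map_add, LinearMap.add_apply, map_add, hf g, hf' g, add_zero]
  smul_mem' := by
    intro c f hf g
    rw [map_smul, LinearMap.smul_apply, map_smul, hf g, smul_zero]

theorem mem_traceKer {d : ℂ} {n m : ℕ} {f : DiagramSpace n m} : f ∈ traceKer d n m ↔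
    ∀ g : DiagramSpace m n, markovTrace d n (compLin d n m n f g) = 0 := Iff.rfl

theorem traceKer_comp_right {d : ℂ} {n m p : ℕ} {f : DiagramSpace n m} (hf : f ∈ traceKer d n m)
    (g : DiagramSpace m p) : compLin d n m p f g ∈ traceKer d n p := by
  intro h
  rw [compLin_assoc]
  exact hf _

theorem traceKer_comp_left {d : ℂ} {n m p : ℕ} {f : DiagramSpace m p} (hf : f ∈ traceKer d m p)
    (g : DiagramSpace n m) : compLin d n m p g f ∈ traceKer d n p := by
  intro h
  rw [compLin_assoc, markovTrace_comm, compLin_assoc]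
  exact hf _

theorem traceKer_tensor_id {d : ℂ} {n m : ℕ} {f : DiagramSpace n m} (hf : f ∈ traceKer d n m)
    (k : ℕ) : tensorLin n m k k f (idLin k) ∈ traceKer d (n + k) (m + k) := by
  intro g
  let c : DiagramSpace (m + k) (n + k) →ₗ[ℂ] DiagramSpace m n :=
    Finsupp.linearCombination ℂ fun E =>
      Finsupp.single E.closeRight (d ^ missing (E.rel ⊔ seamRight m n k) (keepRight m n k))
  have key : markovTrace d _ (compLin d _ _ _ (tensorLin n m k k f (idLin k)) g) =
      markovTrace d n (compLin d n m n f (c g)) := by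
    clear hf
    induction f using Finsupp.induction_linear with
    | zero => simp
    | add f f' hf hf' => simp only [map_add, LinearMap.add_apply, hf, hf']
    | single D a =>
    induction g using Finsupp.induction_linear with
    | zero => simp
    | add f f' hf hf' => simp only [map_add, hf, hf']
    | single E b =>
      have hc : c (Finsupp.single E b) = Finsupp.single E.closeRight
          (b * d ^ missing (E.rel ⊔ seamRight m n k) (keepRight m n k)) := by
        simp [c, Finsupp.linearCombination_single]
      have h1 := closedLoops_comp (D.tensor (Diagram.id k)) E
      rw [pairLoops_closeRight, ← closedLoops_comp] at h1
      simp only [hc, idLin, tensorLin_single, compLin_single, markovTrace_single, mul_one]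
      calc a * b * d ^ loops (D.tensor (Diagram.id k)) E *
            d ^ closedLoops ((D.tensor (Diagram.id k)).comp E)
          = a * b * d ^ (closedLoops ((D.tensor (Diagram.id k)).comp E) +
              loops (D.tensor (Diagram.id k)) E) := by rw [pow_add]; ring
        _ = _ := by rw [h1, pow_add, pow_add]; ring
  rw [key]
  exact hf _

theorem traceKer_id_tensor {d : ℂ} {n m : ℕ} {f : DiagramSpace n m} (hf : f ∈ traceKer d n m)
    (k : ℕ) : tensorLin k k n m (idLin k) f ∈ traceKer d (k + n) (k + m) := by
  intro g
  let c : DiagramSpace (k + m) (k + n) →ₗ[ℂ] DiagramSpace m n :=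
    Finsupp.linearCombination ℂ fun E =>
      Finsupp.single E.closeLeft (d ^ missing (E.rel ⊔ seamLeft m n k) (keepLeft m n k))
  have key : markovTrace d _ (compLin d _ _ _ (tensorLin k k n m (idLin k) f) g) =
      markovTrace d n (compLin d n m n f (c g)) := by
    clear hf
    induction f using Finsupp.induction_linear with
    | zero => simp
    | add f f' hf hf' => simp only [map_add, LinearMap.add_apply, hf, hf']
    | single D a =>
    induction g using Finsupp.induction_linear with
    | zero => simp
    | add f f' hf hf' => simp only [map_add, hf, hf']
    | single E b =>
      have hc : c (Finsupp.single E b) = Finsupp.single E.closeLeft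
          (b * d ^ missing (E.rel ⊔ seamLeft m n k) (keepLeft m n k)) := by
        simp [c, Finsupp.linearCombination_single]
      have h1 := closedLoops_comp ((Diagram.id k).tensor D) E
      rw [pairLoops_closeLeft, ← closedLoops_comp] at h1
      simp only [hc, idLin, tensorLin_single, compLin_single, markovTrace_single, one_mul]
      calc a * b * d ^ loops ((Diagram.id k).tensor D) E *
            d ^ closedLoops (((Diagram.id k).tensor D).comp E)
          = a * b * d ^ (closedLoops (((Diagram.id k).tensor D).comp E) +
              loops ((Diagram.id k).tensor D) E) := by rw [pow_add]; ring
        _ = _ := by rw [h1, pow_add, pow_add]; ring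
  rw [key]
  exact hf _

theorem traceKer_tensor_right {d : ℂ} {n m n' m' : ℕ} {f : DiagramSpace n m}
    (hf : f ∈ traceKer d n m) (g : DiagramSpace n' m') :
    tensorLin n m n' m' f g ∈ traceKer d (n + n') (m + m') := by
  have h := tensorLin_comp d f (idLin m) (idLin n') g
  rw [compLin_id, id_compLin] at h
  rw [← h]
  exact traceKer_comp_right (traceKer_tensor_id hf n') _

theorem traceKer_tensor_left {d : ℂ} {n m n' m' : ℕ} {f : DiagramSpace n' m'}
    (hf : f ∈ traceKer d n' m') (g : DiagramSpace n m) :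
    tensorLin n m n' m' g f ∈ traceKer d (n + n') (m + m') := by
  have h := tensorLin_comp d (idLin n) g f (idLin m')
  rw [compLin_id, id_compLin] at h
  rw [← h]
  exact traceKer_comp_right (traceKer_id_tensor hf n) _

/-- The Temperley-Lieb category with loop parameter `d`. The object `⟨n⟩` is `X ^ n`, the `n`-fold
tensor power of the generating object `X = ⟨1⟩`. -/
structure TL (d : ℂ) where
  /-- the number of strands -/
  exponent : ℕ

noncomputable instance (d : ℂ) : Category (TL d) where
  Hom X Y := DiagramSpace X.exponent Y.exponent
  id X := idLin X.exponent
  comp f g := compLin d _ _ _ f g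
  id_comp f := id_compLin d f
  comp_id f := compLin_id d f
  assoc f g h := compLin_assoc d f g h

noncomputable instance (d : ℂ) : Preadditive (TL d) where
  homGroup X Y := inferInstanceAs (AddCommGroup (DiagramSpace X.exponent Y.exponent))
  add_comp _ _ _ f f' g := LinearMap.map_add₂ (compLin d _ _ _) f f' g
  comp_add _ _ _ f g g' := LinearMap.map_add (compLin d _ _ _ f) g g'

noncomputable instance (d : ℂ) : Linear ℂ (TL d) where
  homModule X Y := inferInstanceAs (Module ℂ (DiagramSpace X.exponent Y.exponent))
  smul_comp _ _ _ c f g := LinearMap.map_smul₂ (compLin d _ _ _) c f g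
  comp_smul _ _ _ f c g := LinearMap.map_smul (compLin d _ _ _ f) c g

/-- The tensor product of objects of the Temperley-Lieb category. -/
def TL.tensorObj {d : ℂ} (X Y : TL d) : TL d := ⟨X.exponent + Y.exponent⟩

/-- The tensor product of morphisms of the Temperley-Lieb category. -/
noncomputable def TL.tensorHom {d : ℂ} {X Y X' Y' : TL d} (f : X ⟶ Y) (g : X' ⟶ Y') :
    X.tensorObj X' ⟶ Y.tensorObj Y' :=
  tensorLin X.exponent Y.exponent X'.exponent Y'.exponent f g

/-- The reduced Temperley-Lieb category: the objects are those of the Temperley-Lieb category, and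
the morphism spaces are the quotients by `traceKer`. -/
structure ReducedTL (d : ℂ) where
  /-- the number of strands -/
  exponent : ℕ

/-- Composition in the reduced Temperley-Lieb category. -/
noncomputable def reducedComp (d : ℂ) (n m p : ℕ) :
    DiagramSpace n m ⧸ traceKer d n m → DiagramSpace m p ⧸ traceKer d m p →
      DiagramSpace n p ⧸ traceKer d n p :=
  Quotient.map₂ (fun f g => compLin d n m p f g) (by
    intro f f' hf g g' hg
    have hf := (Submodule.quotientRel_def _).1 hf
    have hg := (Submodule.quotientRel_def _).1 hg
    refine (Submodule.quotientRel_def _).2 ?_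
    have : compLin d n m p f g - compLin d n m p f' g' =
        compLin d n m p (f - f') g + compLin d n m p f' (g - g') := by
      rw [map_sub, map_sub, LinearMap.sub_apply]; abel
    rw [this]
    exact Submodule.add_mem _ (traceKer_comp_right hf g) (traceKer_comp_left hg f'))

/-- Tensor product of morphisms in the reduced Temperley-Lieb category. -/
noncomputable def reducedTensor (d : ℂ) (n m n' m' : ℕ) :
    DiagramSpace n m ⧸ traceKer d n m → DiagramSpace n' m' ⧸ traceKer d n' m' →
      DiagramSpace (n + n') (m + m') ⧸ traceKer d (n + n') (m + m') :=
  Quotient.map₂ (fun f g => tensorLin n m n' m' f g) (by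
    intro f f' hf g g' hg
    have hf := (Submodule.quotientRel_def _).1 hf
    have hg := (Submodule.quotientRel_def _).1 hg
    refine (Submodule.quotientRel_def _).2 ?_
    have : tensorLin n m n' m' f g - tensorLin n m n' m' f' g' =
        tensorLin n m n' m' (f - f') g + tensorLin n m n' m' f' (g - g') := by
      rw [map_sub, map_sub, LinearMap.sub_apply]; abel
    rw [this]
    exact Submodule.add_mem _ (traceKer_tensor_right hf g) (traceKer_tensor_left hg f'))

theorem reducedComp_mk (d : ℂ) {n m p : ℕ} (f : DiagramSpace n m) (g : DiagramSpace m p) :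
    reducedComp d n m p (Submodule.Quotient.mk f) (Submodule.Quotient.mk g) =
      Submodule.Quotient.mk (compLin d n m p f g) := rfl

theorem reducedTensor_mk (d : ℂ) {n m n' m' : ℕ} (f : DiagramSpace n m) (g : DiagramSpace n' m') :
    reducedTensor d n m n' m' (Submodule.Quotient.mk f) (Submodule.Quotient.mk g) =
      Submodule.Quotient.mk (tensorLin n m n' m' f g) := rfl

noncomputable instance (d : ℂ) : Category (ReducedTL d) where
  Hom X Y := DiagramSpace X.exponent Y.exponent ⧸ traceKer d X.exponent Y.exponent
  id X := Submodule.Quotient.mk (idLin X.exponent)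
  comp f g := reducedComp d _ _ _ f g
  id_comp f := by
    induction f using Submodule.Quotient.induction_on with | _ f =>
    rw [reducedComp_mk, id_compLin]
  comp_id f := by
    induction f using Submodule.Quotient.induction_on with | _ f =>
    rw [reducedComp_mk, compLin_id]
  assoc f g h := by
    induction f using Submodule.Quotient.induction_on with | _ f =>
    induction g using Submodule.Quotient.induction_on with | _ g =>
    induction h using Submodule.Quotient.induction_on with | _ h =>
    rw [reducedComp_mk, reducedComp_mk, reducedComp_mk, reducedComp_mk, compLin_assoc]

noncomputable instance (d : ℂ) : Preadditive (ReducedTL d) where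
  homGroup X Y := inferInstanceAs
    (AddCommGroup (DiagramSpace X.exponent Y.exponent ⧸ traceKer d X.exponent Y.exponent))
  add_comp X Y Z f f' g := by
    induction f using Submodule.Quotient.induction_on with | _ f =>
    induction f' using Submodule.Quotient.induction_on with | _ f' =>
    induction g using Submodule.Quotient.induction_on with | _ g =>
    exact congrArg Submodule.Quotient.mk (LinearMap.map_add₂ (compLin d _ _ _) f f' g)
  comp_add X Y Z f g g' := by
    induction f using Submodule.Quotient.induction_on with | _ f =>
    induction g using Submodule.Quotient.induction_on with | _ g =>
    induction g' using Submodule.Quotient.induction_on with | _ g' =>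
    exact congrArg Submodule.Quotient.mk (map_add (compLin d _ _ _ f) g g')

noncomputable instance (d : ℂ) : Linear ℂ (ReducedTL d) where
  homModule X Y := inferInstanceAs
    (Module ℂ (DiagramSpace X.exponent Y.exponent ⧸ traceKer d X.exponent Y.exponent))
  smul_comp X Y Z c f g := by
    induction f using Submodule.Quotient.induction_on with | _ f =>
    induction g using Submodule.Quotient.induction_on with | _ g =>
    exact congrArg Submodule.Quotient.mk (LinearMap.map_smul₂ (compLin d _ _ _) c f g)
  comp_smul X Y Z f c g := by
    induction f using Submodule.Quotient.induction_on with | _ f =>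
    induction g using Submodule.Quotient.induction_on with | _ g =>
    exact congrArg Submodule.Quotient.mk (map_smul (compLin d _ _ _ f) c g)

/-- The quotient functor, `Y ↦ Ȳ`. -/
noncomputable def reduction (d : ℂ) : TL d ⥤ ReducedTL d where
  obj X := ⟨X.exponent⟩
  map {X Y} f := (Submodule.Quotient.mk f :
    DiagramSpace X.exponent Y.exponent ⧸ traceKer d X.exponent Y.exponent)
  map_id _ := rfl
  map_comp _ _ := rfl

/-- The tensor product of objects of the reduced Temperley-Lieb category. -/
def ReducedTL.tensorObj {d : ℂ} (X Y : ReducedTL d) : ReducedTL d := ⟨X.exponent + Y.exponent⟩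

/-- The tensor product of morphisms of the reduced Temperley-Lieb category, inherited from the
Temperley-Lieb category. -/
noncomputable def ReducedTL.tensorHom {d : ℂ} {X Y X' Y' : ReducedTL d} (f : X ⟶ Y) (g : X' ⟶ Y') :
    X.tensorObj X' ⟶ Y.tensorObj Y' :=
  reducedTensor d X.exponent Y.exponent X'.exponent Y'.exponent f g

theorem reduction_tensorHom {d : ℂ} {X Y X' Y' : TL d} (f : X ⟶ Y) (g : X' ⟶ Y') :
    (reduction d).map (TL.tensorHom f g) =
      ReducedTL.tensorHom ((reduction d).map f) ((reduction d).map g) := rfl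

theorem ReducedTL.tensorHom_comp {d : ℂ} {X Y Z X' Y' Z' : ReducedTL d}
    (f : X ⟶ Y) (g : Y ⟶ Z) (f' : X' ⟶ Y') (g' : Y' ⟶ Z') :
    ReducedTL.tensorHom f f' ≫ ReducedTL.tensorHom g g' =
      ReducedTL.tensorHom (f ≫ g) (f' ≫ g') := by
  induction f using Submodule.Quotient.induction_on with | _ f =>
  induction g using Submodule.Quotient.induction_on with | _ g =>
  induction f' using Submodule.Quotient.induction_on with | _ f' =>
  induction g' using Submodule.Quotient.induction_on with | _ g' =>
  exact congrArg Submodule.Quotient.mk (tensorLin_comp d f g f' g')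

/-- The tensor product `pX ⊗ qY = (p ⊗ q)(X ⊗ Y)` in the idempotent completion of the reduced
Temperley-Lieb category. -/
noncomputable def karoubiTensor {d : ℂ} (P Q : Idempotents.Karoubi (ReducedTL d)) :
    Idempotents.Karoubi (ReducedTL d) where
  X := P.X.tensorObj Q.X
  p := ReducedTL.tensorHom P.p Q.p
  idem := by rw [ReducedTL.tensorHom_comp, P.idem, Q.idem]

/-! ### The idempotents and the simple objects -/

/-- The diagram with no upper and two lower end points, joined by an arc. -/
def capDiagram : Diagram 2 0 where
  rel := ⊤
  pairing := by
    rintro (i | i)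
    · refine ⟨.inl i.rev, ⟨?_, trivial⟩, ?_⟩
      · intro h
        have := congrArg Fin.val (Sum.inl.inj h)
        simp at this
        omega
      · rintro (j | j) ⟨h, _⟩
        · have h2 : j ≠ i := fun e => h (by rw [e])
          congr 1
          apply Fin.ext
          have := fun e => h2 (Fin.ext e)
          simp
          omega
        · exact j.elim0
    · exact i.elim0
  noncrossing := by
    rintro (a | a) (b | b) (c | c) (d | d) h1 h2 h3 _ _
    all_goals first
      | exact a.elim0
      | exact b.elim0
      | exact c.elim0
      | exact d.elim0
      | (simp at h1 h2 h3; omega)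

/-- The diagram with no lower and two upper end points, joined by an arc. -/
def cupDiagram : Diagram 0 2 where
  rel := ⊤
  pairing := by
    rintro (i | i)
    · exact i.elim0
    · refine ⟨.inr i.rev, ⟨?_, trivial⟩, ?_⟩
      · intro h
        have := congrArg Fin.val (Sum.inr.inj h)
        simp at this
        omega
      · rintro (j | j) ⟨h, _⟩
        · exact j.elim0
        · have h2 : j ≠ i := fun e => h (by rw [e])
          congr 1
          apply Fin.ext
          have := fun e => h2 (Fin.ext e)
          simp
          omega
  noncrossing := by
    rintro (a | a) (b | b) (c | c) (d | d) h1 h2 h3 _ _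
    all_goals first
      | exact a.elim0
      | exact b.elim0
      | exact c.elim0
      | exact d.elim0
      | (simp at h1 h2 h3; omega)

/-- The object `X ^ n` of the Temperley-Lieb category. -/
abbrev TL.X (d : ℂ) (n : ℕ) : TL d := ⟨n⟩

/-- The pairing `ε : X ⊗ X ⟶ I`. -/
noncomputable def TL.ε (d : ℂ) : TL.X d 2 ⟶ TL.X d 0 := Finsupp.single capDiagram (1 : ℂ)

/-- The copairing `δ : I ⟶ X ⊗ X`. -/
noncomputable def TL.δ (d : ℂ) : TL.X d 0 ⟶ TL.X d 2 := Finsupp.single cupDiagram (1 : ℂ)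

/-- The elementary diagram `h_{n+1} = 1 ⊗ (δ ε)` in `End (X ^ (n + 2))`, which has an arc at the
last two lower end points, one at the last two upper end points, and `n` vertical strands. -/
noncomputable def TL.hLast (d : ℂ) (n : ℕ) : TL.X d (n + 2) ⟶ TL.X d (n + 2) :=
  TL.tensorHom (𝟙 (TL.X d n)) (TL.ε d ≫ TL.δ d)

/-- The quantum integer `[k]_q`. -/
noncomputable def qInt (q : ℂ) (k : ℕ) : ℂ := (q ^ k - q⁻¹ ^ k) / (q - q⁻¹)

/-- `f ↦ f ⊗ 1`, adding a vertical strand on the right. -/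
noncomputable def TL.addStrand {d : ℂ} {n : ℕ} (f : TL.X d n ⟶ TL.X d n) :
    TL.X d (n + 1) ⟶ TL.X d (n + 1) :=
  TL.tensorHom f (𝟙 (TL.X d 1))

/-- The elements `f_k` of `End (X ^ k)` in the Temperley-Lieb category with loop parameter
`q + q⁻¹`, given by Wenzl's recursive formula. -/
noncomputable def wenzl (q : ℂ) : (k : ℕ) → (TL.X (q + q⁻¹) k ⟶ TL.X (q + q⁻¹) k)
  | 0 => 𝟙 _
  | 1 => 𝟙 _
  | (n + 2) =>
    TL.addStrand (wenzl q (n + 1)) - (qInt q (n + 1) / qInt q (n + 2)) •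
      (TL.addStrand (wenzl q (n + 1)) ≫ TL.hLast (q + q⁻¹) n ≫ TL.addStrand (wenzl q (n + 1)))

/-- The object `X̄_k = f_k X ^ k` in the idempotent completion of the reduced Temperley-Lieb
category. -/
noncomputable def simpleObj (q : ℂ) (k : ℕ) (h : wenzl q k ≫ wenzl q k = wenzl q k) :
    Idempotents.Karoubi (ReducedTL (q + q⁻¹)) where
  X := (reduction _).obj (TL.X _ k)
  p := (reduction _).map (wenzl q k)
  idem := by rw [← Functor.map_comp, h]

/-- `Y ≅ Y_1 ⊕ ... ⊕ Y_r` in a linear category: there are morphisms `α i : Y_i ⟶ Y` and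
`β i : Y ⟶ Y_i` such that `β i ∘ α j = δ_{ij}` and `∑ i, α i ∘ β i = 1`. -/
def IsDirectSum {C : Type} [Category.{0} C] [Preadditive C] {ι : Type} [Fintype ι]
    (Y : C) (Z : ι → C) : Prop :=
  ∃ (α : ∀ i, Z i ⟶ Y) (β : ∀ i, Y ⟶ Z i),
    (∀ i, α i ≫ β i = 𝟙 (Z i)) ∧ (∀ i j, i ≠ j → α j ≫ β i = 0) ∧ ∑ i, β i ≫ α i = 𝟙 Y

/-- The last index in the truncated Clebsch-Gordan rule. -/
def fusionTop (l j k : ℕ) : ℕ := if j + k ≤ l - 2 then j + k else 2 * (l - 2) - (j + k)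

/-- The indices `|j - k|, |j - k| + 2, ..., fusionTop l j k` in the truncated Clebsch-Gordan
rule. -/
def fusionIndex (l j k : ℕ) (i : Fin ((fusionTop l j k - Nat.dist j k) / 2 + 1)) : ℕ :=
  Nat.dist j k + 2 * i

theorem fusionIndex_le {l j k : ℕ} (hj : j ≤ l - 2) (hk : k ≤ l - 2)
    (i : Fin ((fusionTop l j k - Nat.dist j k) / 2 + 1)) : fusionIndex l j k i ≤ l - 2 := by
  have hi := i.2
  unfold fusionIndex
  generalize i.val = i at *
  unfold fusionTop Nat.dist at *
  split_ifs at hi <;> omega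

/-- The last index is `fusionTop l j k`. -/
theorem fusionIndex_last {l j k : ℕ} (hj : j ≤ l - 2) (hk : k ≤ l - 2) :
    fusionIndex l j k (Fin.last _) = fusionTop l j k := by
  unfold fusionIndex fusionTop Nat.dist
  simp only [Fin.val_last]
  split_ifs <;> omega

end TemperleyLieb

namespace TemperleyLieb

open Idempotents TL

/-! ### Equality of diagrams -/

/-! The Jones–Wenzl elements `f_n` are controlled for all `n < l`, one step beyond the range of the
theorem, because their recursion divides only by quantum integers `[k]` with `0 < k < l`, and `[k] =
0` exactly when `l ∣ k`. A single induction (`WenzlStep.succ`) shows that `f_n` is idempotent, that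
`f_{n+1}` absorbs `f_n ⊗ 1`, and that closing the last strand of `f_{n+1}` gives `[n+2]/[n+1]` times
`f_n`. This coefficient is exactly what makes `f_n` kill every arc joining neighbouring end points.

A planar diagram with no arc between neighbours on either edge consists of vertical strands
(`Diagram.eq_strands_of_no_arcs`). Hence the space of all `f_n φ f_m` is zero for `n ≠ m` and
consists of multiples of `f_n` for `n = m`: the images of the `f_n` satisfy Schur's lemma. Iterated
partial closing gives `tr f_n = [n+1]`. This is nonzero for `n ≤ l - 2`, so these `X̄_n` survive the
reduction; it vanishes for `n = l - 1`, and Schur's lemma then makes `f_{l-1}` negligible, so that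
`X̄_{l-1} = 0`.

Read backwards, the recursion decomposes `f_{n+1} ⊗ 1` into orthogonal idempotents and yields
`X̄_{n+1} ⊗ X̄ ≅ X̄_{n+2} ⊕ X̄_n` whenever `n + 2 < l` (`isDirectSum_strand_wenzl`). For `n + 2 = l
- 1` the first summand is zero; this is the only source of the truncation.

The general rule follows by induction on the second index. The object `X̄_j ⊗ X̄_{n+1} ⊗ X̄` is
computed in two ways, and dimensions of Hom-spaces out of the simple objects are compared; the
multiplicities for `X̄_j ⊗ X̄_{n+2}` come out by subtracting the known ones for `X̄_j ⊗ X̄_n`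
(`fusionRule_succ`). No general semisimplicity or Krull–Schmidt theorem is needed. It suffices that
the identity of each object involved is a sum of morphisms through simple objects, a property
inherited by summands, and that all multiplicities are 0 or 1 (`IsSchurFamily.isDirectSum`). -/

/-- Both relations are perfect pairings of the same points, so neither can properly contain the
other. All later equalities of diagrams need one inclusion only. -/
theorem Diagram.eq_of_le {n m : ℕ} {D E : Diagram n m} (h : D.rel ≤ E.rel) : D = E := by
  ext1
  refine le_antisymm h fun x y hxy => ?_
  by_cases hyx : y = x
  · rw [hyx]
  · obtain ⟨z, ⟨hz, hxz⟩, -⟩ := D.pairing x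
    rw [(E.pairing x).unique ⟨hyx, hxy⟩ ⟨hz, h hxz⟩]
    exact hxz

/-- `D` joins the end points with labels `u` and `v`. -/
def Diagram.Joins {n m : ℕ} (D : Diagram n m) (u v : ℕ ⊕ ℕ) : Prop :=
  ∃ x y, Sum.map Fin.val Fin.val x = u ∧ Sum.map Fin.val Fin.val y = v ∧ D.rel x y

theorem Diagram.eq_of_joins {n m : ℕ} {D E : Diagram n m}
    (h : ∀ u v, D.Joins u v → E.Joins u v) : D = E := by
  refine Diagram.eq_of_le fun x y hxy => ?_
  obtain ⟨x', y', hx, hy, h'⟩ := h _ _ ⟨x, y, rfl, rfl, hxy⟩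
  have inj : Function.Injective (Sum.map Fin.val Fin.val : Fin n ⊕ Fin m → ℕ ⊕ ℕ) :=
    Sum.map_injective.2 ⟨Fin.val_injective, Fin.val_injective⟩
  rwa [inj hx, inj hy] at h'

theorem Diagram.tensor_joins_iff {n m n' m' : ℕ} (D : Diagram n m) (D' : Diagram n' m')
    (u v : ℕ ⊕ ℕ) : (D.tensor D').Joins u v ↔ D.Joins u v ∨
      ∃ u' v', D'.Joins u' v' ∧ u = Sum.map (n + ·) (m + ·) u' ∧
        v = Sum.map (n + ·) (m + ·) v' := by
  have e : ∀ x : (Fin n ⊕ Fin m) ⊕ (Fin n' ⊕ Fin m'),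
      Sum.map Fin.val Fin.val (boxEquiv n m n' m' x) = Sum.elim (Sum.map Fin.val Fin.val)
        (fun y => Sum.map (n + ·) (m + ·) (Sum.map Fin.val Fin.val y)) x := by
    rintro ((x | x) | (x | x)) <;> rfl
  constructor
  · rintro ⟨x, y, rfl, rfl, h⟩
    obtain ⟨x, rfl⟩ := (boxEquiv n m n' m').surjective x
    obtain ⟨y, rfl⟩ := (boxEquiv n m n' m').surjective y
    rw [e, e]
    rcases (Diagram.tensor_rel_iff D D' x y).1 h with h' | h'
    · exact .inl ⟨_, _, rfl, rfl, h'⟩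
    · exact .inr ⟨_, _, ⟨_, _, rfl, rfl, h'⟩, rfl, rfl⟩
  · rintro (⟨x, y, rfl, rfl, h⟩ | ⟨_, _, ⟨x, y, rfl, rfl, h⟩, rfl, rfl⟩)
    · exact ⟨_, _, e (.inl x), e (.inl y), (Diagram.tensor_rel_iff D D' _ _).2 (.inl h)⟩
    · exact ⟨_, _, e (.inr x), e (.inr y), (Diagram.tensor_rel_iff D D' _ _).2 (.inr h)⟩

/-- The two diagrams have different types, the exponents being bracketed differently. Labelling end
points by natural numbers lets their curves be compared without casts. -/
theorem Diagram.tensor_assoc_joins {n m n' m' n'' m'' : ℕ} (D : Diagram n m) (E : Diagram n' m')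
    (F : Diagram n'' m'') (u v : ℕ ⊕ ℕ) :
    ((D.tensor E).tensor F).Joins u v ↔ (D.tensor (E.tensor F)).Joins u v := by
  have e : ∀ w, Sum.map (n + ·) (m + ·) (Sum.map (n' + ·) (m' + ·) w) =
      Sum.map (n + n' + ·) (m + m' + ·) w := by
    rintro (w | w) <;> simp [Nat.add_assoc]
  simp only [Diagram.tensor_joins_iff]
  constructor
  · rintro ((h | ⟨u', v', h, rfl, rfl⟩) | ⟨u', v', h, rfl, rfl⟩)
    · exact .inl h
    · exact .inr ⟨_, _, .inl h, rfl, rfl⟩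
    · exact .inr ⟨_, _, .inr ⟨_, _, h, rfl, rfl⟩, (e _).symm, (e _).symm⟩
  · rintro (h | ⟨_, _, h | ⟨_, _, h, rfl, rfl⟩, rfl, rfl⟩)
    · exact .inl (.inl h)
    · exact .inl (.inr ⟨_, _, h, rfl, rfl⟩)
    · exact .inr ⟨_, _, h, e _, e _⟩

/-- Associativity of juxtaposition, when the exponents are definitionally associative. -/
theorem Diagram.tensor_assoc_one {n m n' m' : ℕ} (D : Diagram n m) (E : Diagram n' m')
    (F : Diagram 1 1) : (D.tensor E).tensor F = D.tensor (E.tensor F) :=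
  Diagram.eq_of_joins fun u v => (Diagram.tensor_assoc_joins D E F u v).1

theorem Diagram.tensor_assoc_cap {n : ℕ} : (Diagram.id (n + 1)).tensor capDiagram =
    (Diagram.id n).tensor ((Diagram.id 1).tensor capDiagram) := by
  rw [← Diagram.id_tensor_id]
  exact Diagram.eq_of_joins fun u v => (Diagram.tensor_assoc_joins _ _ _ u v).1

theorem Diagram.tensor_assoc_cup {n : ℕ} : (Diagram.id (n + 1)).tensor cupDiagram =
    (Diagram.id n).tensor ((Diagram.id 1).tensor cupDiagram) := by
  rw [← Diagram.id_tensor_id]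
  exact Diagram.eq_of_joins fun u v => (Diagram.tensor_assoc_joins _ _ _ u v).1

theorem Diagram.tensor_id_zero {n m : ℕ} (D : Diagram n m) : D.tensor (Diagram.id 0) = D := by
  refine Diagram.eq_of_joins (D := D.tensor (Diagram.id 0)) (E := D) fun u v h => ?_
  rcases (Diagram.tensor_joins_iff D _ u v).1 h with h | ⟨_, _, ⟨x, _, -⟩, -⟩
  · exact h
  · rcases x with x | x <;> exact x.elim0

instance : Subsingleton (Diagram 0 0) :=
  ⟨fun D E => Diagram.eq_of_le fun x => by rcases x with x | x <;> exact x.elim0⟩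

/-- The only lower point must be joined to the only upper one. The zigzag composites are therefore
identities for free, and only their loops remain to be counted. -/
instance : Subsingleton (Diagram 1 1) := by
  have key : ∀ D : Diagram 1 1, D.rel = ⊤ := by
    intro D
    have h : D.rel (.inl 0) (.inr 0) := by
      obtain ⟨(y | y), ⟨hy, h⟩, -⟩ := D.pairing (.inl 0)
      · exact absurd (congrArg _ (Subsingleton.elim _ _)) hy
      · rwa [Subsingleton.elim y 0] at h
    refine eq_top_iff.2 ?_
    rintro (x | x) (y | y) - <;> rw [Subsingleton.elim x 0, Subsingleton.elim y 0]
    · exact h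
    · exact D.rel.symm' h
  exact ⟨fun D E => Diagram.ext ((key D).trans (key E).symm)⟩

/-! ### Elementary compositions -/

theorem cup_comp_cap : cupDiagram.comp capDiagram = Diagram.id 0 := Subsingleton.elim _ _

theorem loops_cup_cap : loops cupDiagram capDiagram = 1 := by
  unfold loops missing
  -- All glued points lie on one curve, and there are no outer end points for it to reach: exactly
  -- one loop.
  have base : ∀ x, glue cupDiagram capDiagram x (.inr (.inl 0)) := by
    rintro ((x | x) | (x | x))
    · exact x.elim0
    · exact Setoid.trans' _ (glue_seam cupDiagram capDiagram x) (glue_right _ _ trivial)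
    · exact glue_right _ _ trivial
    · exact x.elim0
  have : Unique {c : Quotient (glue cupDiagram capDiagram) //
      ∀ o, Quotient.mk (glue cupDiagram capDiagram) (outer 0 2 0 o) ≠ c} :=
    { default := ⟨Quotient.mk _ (.inr (.inl 0)), by rintro (o | o) <;> exact o.elim0⟩
      uniq := by
        rintro ⟨c, hc⟩
        induction c using Quotient.ind with | _ y =>
        exact Subtype.ext (Quotient.sound (base y)) }
  exact Nat.card_unique

theorem glue_comp_rel {n m p : ℕ} {D : Diagram n m} {E : Diagram m p} {x y : Fin n ⊕ Fin p}
    (h : glue D E (outer n m p x) (outer n m p y)) : (D.comp E).rel x y := h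

theorem zigzag_right_comp : ((Diagram.id 1).tensor cupDiagram).comp
    (capDiagram.tensor (Diagram.id 1)) = Diagram.id 1 :=
  Subsingleton.elim (α := Diagram 1 1) _ _

theorem zigzag_left_comp : (cupDiagram.tensor (Diagram.id 1)).comp
    ((Diagram.id 1).tensor capDiagram) = Diagram.id 1 :=
  Subsingleton.elim (α := Diagram 1 1) _ _

/-- A single curve passes through all eight points of the picture, starting at the outer lower
point. Every class thus meets an outer point and nothing is closed. -/
theorem zigzag_right_loops : loops ((Diagram.id 1).tensor cupDiagram)
    (capDiagram.tensor (Diagram.id 1)) = 0 := by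
  set D := (Diagram.id 1).tensor cupDiagram with hD
  set E := capDiagram.tensor (Diagram.id 1) with hE
  have d1 : D.rel (.inl 0) (.inr 0) :=
    (Diagram.tensor_rel_iff (Diagram.id 1) cupDiagram (.inl (.inl 0)) (.inl (.inr 0))).2
      (.inl rfl)
  have d2 : D.rel (.inr 1) (.inr 2) :=
    (Diagram.tensor_rel_iff (Diagram.id 1) cupDiagram (.inr (.inr 0)) (.inr (.inr 1))).2
      (.inr trivial)
  have e1 : E.rel (.inl 0) (.inl 1) :=
    (Diagram.tensor_rel_iff capDiagram (Diagram.id 1) (.inl (.inl 0)) (.inl (.inl 1))).2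
      (.inl trivial)
  have e2 : E.rel (.inl 2) (.inr 0) :=
    (Diagram.tensor_rel_iff capDiagram (Diagram.id 1) (.inr (.inl 0)) (.inr (.inr 0))).2
      (.inr rfl)
  have s := glue_seam D E
  refine missing_eq_zero _ _ fun v => ⟨.inl 0, ?_⟩
  -- The curve is followed point by point: `a i` reaches the upper point `i` of `D`, `b i` the lower
  -- point `i` of `E`, and `c0` the outer upper point.
  have a0 : glue D E (.inl (.inl 0)) (.inl (.inr 0)) := glue_left D E d1
  have b0 := Setoid.trans' _ a0 (s 0)
  have b1 := Setoid.trans' _ b0 (glue_right D E e1)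
  have a1 := Setoid.trans' _ b1 (Setoid.symm' _ (s 1))
  have a2 := Setoid.trans' _ a1 (glue_left D E d2)
  have b2 := Setoid.trans' _ a2 (s 2)
  have c0 := Setoid.trans' _ b2 (glue_right D E e2)
  rcases v with (v | v) | (v | v)
  · rw [show v = 0 from Subsingleton.elim (α := Fin 1) v 0]; exact Setoid.refl' _ _
  · change Fin 3 at v
    fin_cases v
    exacts [a0, a1, a2]
  · change Fin 3 at v
    fin_cases v
    exacts [b0, b1, b2]
  · rw [show v = 0 from Subsingleton.elim (α := Fin 1) v 0]; exact c0

theorem zigzag_left_loops : loops (cupDiagram.tensor (Diagram.id 1))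
    ((Diagram.id 1).tensor capDiagram) = 0 := by
  set D := cupDiagram.tensor (Diagram.id 1) with hD
  set E := (Diagram.id 1).tensor capDiagram with hE
  have d1 : D.rel (.inr 0) (.inr 1) :=
    (Diagram.tensor_rel_iff cupDiagram (Diagram.id 1) (.inl (.inr 0)) (.inl (.inr 1))).2
      (.inl trivial)
  have d2 : D.rel (.inl 0) (.inr 2) :=
    (Diagram.tensor_rel_iff cupDiagram (Diagram.id 1) (.inr (.inl 0)) (.inr (.inr 0))).2
      (.inr rfl)
  have e1 : E.rel (.inl 0) (.inr 0) :=
    (Diagram.tensor_rel_iff (Diagram.id 1) capDiagram (.inl (.inl 0)) (.inl (.inr 0))).2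
      (.inl rfl)
  have e2 : E.rel (.inl 1) (.inl 2) :=
    (Diagram.tensor_rel_iff (Diagram.id 1) capDiagram (.inr (.inl 0)) (.inr (.inl 1))).2
      (.inr trivial)
  have s := glue_seam D E
  refine missing_eq_zero _ _ fun v => ⟨.inl 0, ?_⟩
  have a2 : glue D E (.inl (.inl 0)) (.inl (.inr 2)) := glue_left D E d2
  have b2 := Setoid.trans' _ a2 (s 2)
  have b1 := Setoid.trans' _ b2 (Setoid.symm' _ (glue_right D E e2))
  have a1 := Setoid.trans' _ b1 (Setoid.symm' _ (s 1))
  have a0 := Setoid.trans' _ a1 (Setoid.symm' _ (glue_left D E d1))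
  have b0 := Setoid.trans' _ a0 (s 0)
  have c0 := Setoid.trans' _ b0 (glue_right D E e1)
  rcases v with (v | v) | (v | v)
  · rw [show v = 0 from Subsingleton.elim (α := Fin 1) v 0]; exact Setoid.refl' _ _
  · change Fin 3 at v
    fin_cases v
    exacts [a0, a1, a2]
  · change Fin 3 at v
    fin_cases v
    exacts [b0, b1, b2]
  · rw [show v = 0 from Subsingleton.elim (α := Fin 1) v 0]; exact c0

/-! ### The elementary diagrams -/

theorem Diagram.rel_of_joins {n m : ℕ} {D : Diagram n m} {x y : Fin n ⊕ Fin m}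
    (h : D.Joins (Sum.map Fin.val Fin.val x) (Sum.map Fin.val Fin.val y)) : D.rel x y := by
  obtain ⟨x', y', hx, hy, h'⟩ := h
  have inj : Function.Injective (Sum.map Fin.val Fin.val : Fin n ⊕ Fin m → ℕ ⊕ ℕ) :=
    Sum.map_injective.2 ⟨Fin.val_injective, Fin.val_injective⟩
  rwa [inj hx, inj hy] at h'

theorem Diagram.id_joins {n a : ℕ} (ha : a < n) : (Diagram.id n).Joins (.inl a) (.inr a) :=
  ⟨.inl ⟨a, ha⟩, .inr ⟨a, ha⟩, rfl, rfl, rfl⟩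

/-- The diagram in `End (X ^ 2)` with an arc at the bottom and an arc at the top. -/
def capCup : Diagram 2 2 := capDiagram.comp cupDiagram

theorem capCup_joins_lower : capCup.Joins (.inl 0) (.inl 1) :=
  ⟨.inl 0, .inl 1, rfl, rfl, glue_comp_rel (glue_left capDiagram cupDiagram trivial)⟩

theorem capCup_joins_upper : capCup.Joins (.inr 0) (.inr 1) :=
  ⟨.inr 0, .inr 1, rfl, rfl, glue_comp_rel (glue_right capDiagram cupDiagram trivial)⟩

theorem loops_cap_cup : loops capDiagram cupDiagram = 0 := by
  refine missing_eq_zero _ _ ?_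
  rintro ((x | x) | (x | x))
  · exact ⟨.inl x, Setoid.refl' _ _⟩
  · exact x.elim0
  · exact x.elim0
  · exact ⟨.inr x, Setoid.refl' _ _⟩

/-- The elementary diagram with arcs joining the end points `i` and `i + 1` on both edges. -/
def elementary (i t : ℕ) : Diagram (i + 2 + t) (i + 2 + t) :=
  ((Diagram.id i).tensor capCup).tensor (Diagram.id t)

theorem elementary_zero (i : ℕ) : elementary i 0 = (Diagram.id i).tensor capCup :=
  Diagram.tensor_id_zero _

/-- Wenzl's recursion also adds strands on the right, so this carries the annihilation of arcs from
`f_n` to `f_{n+1}`. -/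
theorem elementary_succ (i t : ℕ) :
    elementary i (t + 1) = (elementary i t).tensor (Diagram.id 1) := by
  unfold elementary
  rw [Diagram.tensor_assoc_one, Diagram.id_tensor_id]

theorem elementary_joins_lower (i t : ℕ) : (elementary i t).Joins (.inl i) (.inl (i + 1)) := by
  refine (Diagram.tensor_joins_iff _ _ _ _).2 (.inl ?_)
  exact (Diagram.tensor_joins_iff _ _ _ _).2 (.inr ⟨_, _, capCup_joins_lower, rfl, rfl⟩)

theorem elementary_joins_upper (i t : ℕ) : (elementary i t).Joins (.inr i) (.inr (i + 1)) := by
  refine (Diagram.tensor_joins_iff _ _ _ _).2 (.inl ?_)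
  exact (Diagram.tensor_joins_iff _ _ _ _).2 (.inr ⟨_, _, capCup_joins_upper, rfl, rfl⟩)

theorem elementary_joins_strand {i t a : ℕ} (ha : a < i + 2 + t) (h : a ≠ i) (h' : a ≠ i + 1) :
    (elementary i t).Joins (.inl a) (.inr a) := by
  refine (Diagram.tensor_joins_iff _ _ _ _).2 ?_
  rcases lt_or_ge a i with hlt | hge
  · exact .inl ((Diagram.tensor_joins_iff _ _ _ _).2 (.inl (Diagram.id_joins hlt)))
  · obtain ⟨b, rfl⟩ := Nat.exists_eq_add_of_le (show i + 2 ≤ a by omega)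
    exact .inr ⟨_, _, Diagram.id_joins (by omega : b < t), rfl, rfl⟩

theorem elementary_rel_strand {i t : ℕ} {a : Fin (i + 2 + t)} (h : a.val ≠ i)
    (h' : a.val ≠ i + 1) : (elementary i t).rel (.inl a) (.inr a) :=
  Diagram.rel_of_joins (elementary_joins_strand a.2 h h')

theorem elementary_rel_lower {i t : ℕ} {a b : Fin (i + 2 + t)} (ha : a.val = i)
    (hb : b.val = i + 1) : (elementary i t).rel (.inl a) (.inl b) :=
  Diagram.rel_of_joins (by simpa [ha, hb] using elementary_joins_lower i t)

theorem elementary_rel_upper {i t : ℕ} {a b : Fin (i + 2 + t)} (ha : a.val = i)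
    (hb : b.val = i + 1) : (elementary i t).rel (.inr a) (.inr b) :=
  Diagram.rel_of_joins (by simpa [ha, hb] using elementary_joins_upper i t)

/-- Stacking replaces the arc of `D` by the lower arc of the elementary diagram and changes nothing
else, up to removed loops. Anything annihilating the elementary diagram therefore annihilates `D`,
provided the loop parameter is invertible. -/
theorem elementary_comp {i t m : ℕ} (D : Diagram (i + 2 + t) m) {a b : Fin (i + 2 + t)}
    (ha : a.val = i) (hb : b.val = i + 1) (h : D.rel (.inl a) (.inl b)) :
    (elementary i t).comp D = D := by
  symm
  refine Diagram.eq_of_le fun x y hxy => glue_comp_rel ?_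
  have hab : b ≠ a := fun e => by rw [e, ha] at hb; omega
  -- Away from the arc, an end point of the composite slides along a vertical strand to the same end
  -- point of `D`.
  have key : ∀ z, z ≠ .inl a → z ≠ .inl b →
      glue (elementary i t) D (outer _ _ m z) (.inr z) := by
    rintro (z | z) h1 h2
    · refine Setoid.trans' _ (glue_left _ _ (elementary_rel_strand ?_ ?_)) (glue_seam _ _ z)
      · exact fun e => h1 (congrArg _ (Fin.ext (e.trans ha.symm)))
      · exact fun e => h2 (congrArg _ (Fin.ext (e.trans hb.symm)))
    · exact Setoid.refl' _ _
  have hl := glue_left (elementary i t) D (elementary_rel_lower ha hb)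
  have pa : ∀ z, D.rel (.inl a) z → z = .inl a ∨ z = .inl b := fun z hz => by
    by_contra! hne
    exact hne.2 ((D.pairing (.inl a)).unique ⟨hne.1, hz⟩ ⟨by simpa using hab, h⟩)
  have pb : ∀ z, D.rel (.inl b) z → z = .inl a ∨ z = .inl b := fun z hz =>
    pa z (D.rel.trans' h hz)
  have special : ∀ z w, (z = .inl a ∨ z = .inl b) → (w = .inl a ∨ w = .inl b) →
      glue (elementary i t) D (outer _ _ m z) (outer _ _ m w) := by
    rintro z w (rfl | rfl) (rfl | rfl)
    · exact Setoid.refl' _ _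
    · exact hl
    · exact Setoid.symm' _ hl
    · exact Setoid.refl' _ _
  by_cases hx : x = .inl a ∨ x = .inl b
  · refine special x y hx ?_
    rcases hx with rfl | rfl
    · exact pa _ hxy
    · exact pb _ hxy
  by_cases hy : y = .inl a ∨ y = .inl b
  · refine special x y ?_ hy
    rcases hy with rfl | rfl
    · exact pa _ (D.rel.symm' hxy)
    · exact pb _ (D.rel.symm' hxy)
  push Not at hx hy
  exact Setoid.trans' _ (key x hx.1 hx.2)
    (Setoid.trans' _ (glue_right _ _ hxy) (Setoid.symm' _ (key y hy.1 hy.2)))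

theorem comp_elementary {i t n : ℕ} (D : Diagram n (i + 2 + t)) {a b : Fin (i + 2 + t)}
    (ha : a.val = i) (hb : b.val = i + 1) (h : D.rel (.inr a) (.inr b)) :
    D.comp (elementary i t) = D := by
  symm
  refine Diagram.eq_of_le fun x y hxy => glue_comp_rel ?_
  have hab : b ≠ a := fun e => by rw [e, ha] at hb; omega
  have key : ∀ z, z ≠ .inr a → z ≠ .inr b →
      glue D (elementary i t) (outer n _ _ z) (.inl z) := by
    rintro (z | z) h1 h2
    · exact Setoid.refl' _ _
    · refine Setoid.symm' _ (Setoid.trans' _ (glue_seam _ _ z)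
        (glue_right _ _ (elementary_rel_strand ?_ ?_)))
      · exact fun e => h1 (congrArg _ (Fin.ext (e.trans ha.symm)))
      · exact fun e => h2 (congrArg _ (Fin.ext (e.trans hb.symm)))
  have hl := glue_right D (elementary i t) (elementary_rel_upper ha hb)
  have pa : ∀ z, D.rel (.inr a) z → z = .inr a ∨ z = .inr b := fun z hz => by
    by_contra! hne
    exact hne.2 ((D.pairing (.inr a)).unique ⟨hne.1, hz⟩ ⟨by simpa using hab, h⟩)
  have pb : ∀ z, D.rel (.inr b) z → z = .inr a ∨ z = .inr b := fun z hz =>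
    pa z (D.rel.trans' h hz)
  have special : ∀ z w, (z = .inr a ∨ z = .inr b) → (w = .inr a ∨ w = .inr b) →
      glue D (elementary i t) (outer n _ _ z) (outer n _ _ w) := by
    rintro z w (rfl | rfl) (rfl | rfl)
    · exact Setoid.refl' _ _
    · exact hl
    · exact Setoid.symm' _ hl
    · exact Setoid.refl' _ _
  by_cases hx : x = .inr a ∨ x = .inr b
  · refine special x y hx ?_
    rcases hx with rfl | rfl
    · exact pa _ hxy
    · exact pb _ hxy
  by_cases hy : y = .inr a ∨ y = .inr b
  · refine special x y ?_ hy
    rcases hy with rfl | rfl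
    · exact pa _ (D.rel.symm' hxy)
    · exact pb _ (D.rel.symm' hxy)
  push Not at hx hy
  exact Setoid.trans' _ (key x hx.1 hx.2)
    (Setoid.trans' _ (glue_left _ _ hxy) (Setoid.symm' _ (key y hy.1 hy.2)))

/-! ### Closing the last strand -/

section CloseRight

variable (n : ℕ)

/-- Closing the last strand turns the two arcs into one path: lower `n`, lower `n + 1`, upper `n +
1`, upper `n`. It replaces the missing vertical strand in position `n` and closes no loop. -/
theorem elementary_seamRight_path {r : Setoid (Fin (n + 1 + 1) ⊕ Fin (n + 1 + 1))}
    (hr : r = (show Diagram (n + 1 + 1) (n + 1 + 1) from elementary n 0).rel ⊔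
      seamRight (n + 1) (n + 1) 1) :
    (∀ a : Fin (n + 1), r (.inl (Fin.castAdd 1 a)) (.inr (Fin.castAdd 1 a))) ∧
      r (.inl (Fin.castAdd 1 (Fin.last n))) (.inl (Fin.last (n + 1))) ∧
      r (.inr (Fin.castAdd 1 (Fin.last n))) (.inr (Fin.last (n + 1))) := by
  have l : ∀ x y, (elementary n 0).rel x y → r x y := fun x y h => by
    rw [hr]
    exact (le_sup_left : _ ≤ (elementary n 0).rel ⊔ seamRight (n + 1) (n + 1) 1) h
  have s : r (.inl (Fin.last (n + 1))) (.inr (Fin.last (n + 1))) := by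
    rw [hr]
    exact (le_sup_right : _ ≤ (elementary n 0).rel ⊔ seamRight (n + 1) (n + 1) 1)
      (Relation.EqvGen.rel _ _ ⟨0, rfl, rfl⟩)
  have h1 : r (.inl (Fin.castAdd 1 (Fin.last n))) (.inl (Fin.last (n + 1))) :=
    l _ _ (elementary_rel_lower rfl rfl)
  have h2 : r (.inr (Fin.castAdd 1 (Fin.last n))) (.inr (Fin.last (n + 1))) :=
    l _ _ (elementary_rel_upper rfl rfl)
  refine ⟨fun a => ?_, h1, h2⟩
  by_cases ha : a = Fin.last n
  · rw [ha]
    exact r.trans' h1 (r.trans' s (r.symm' h2))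
  · have hlt : a.val ≠ n := fun e => ha (Fin.ext e)
    exact l _ _ (elementary_rel_strand (t := 0) (a := Fin.castAdd 1 a) hlt
      (by have := a.2; simp only [Fin.val_castAdd]; omega))

theorem closeRight_elementary :
    Diagram.closeRight (m := n + 1) (n := n + 1) (k := 1) (elementary n 0) = Diagram.id (n + 1) := by
  symm
  refine Diagram.eq_of_le ?_
  obtain ⟨h, -⟩ := elementary_seamRight_path n rfl
  rintro (x | x) (y | y) hxy <;> rw [show x = y from hxy]
  · exact h y
  · exact Setoid.symm' _ (h y)

theorem missing_closeRight_elementary :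
    missing ((show Diagram (n + 1 + 1) (n + 1 + 1) from elementary n 0).rel ⊔
      seamRight (n + 1) (n + 1) 1) (keepRight (n + 1) (n + 1) 1) = 0 := by
  obtain ⟨-, h1, h2⟩ := elementary_seamRight_path n rfl
  refine missing_eq_zero _ _ ?_
  rintro (x | x)
  · refine Fin.lastCases ?_ (fun x => ?_) x
    · exact ⟨.inl (Fin.last n), h1⟩
    · exact ⟨.inl x, Setoid.refl' _ _⟩
  · refine Fin.lastCases ?_ (fun x => ?_) x
    · exact ⟨.inr (Fin.last n), h2⟩
    · exact ⟨.inr x, Setoid.refl' _ _⟩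

end CloseRight

theorem pairLoops_id {n : ℕ} (D : Diagram n n) : pairLoops D (Diagram.id n) = closedLoops D := by
  rw [← closedLoops_comp, Diagram.comp_id, loops_id_right, add_zero]

/-- This is the diagrammatic content of the invariance of the Markov trace under partial closing:
pairing `D ⊗ 1` with the last elementary diagram closes `D`. -/
theorem pairLoops_elementary {n : ℕ} (D : Diagram (n + 1) (n + 1)) :
    pairLoops (D.tensor (Diagram.id 1)) (elementary n 0) = closedLoops D := by
  have h := pairLoops_closeRight (k := 1) D (elementary n 0)
  rw [closeRight_elementary, pairLoops_id] at h
  exact h.trans (congrArg _ (missing_closeRight_elementary n))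

theorem closedLoops_id_zero : closedLoops (Diagram.id 0) = 0 := by
  unfold closedLoops
  rw [Nat.card_eq_zero]
  left
  constructor
  intro c
  induction c using Quotient.ind with | _ y =>
  rcases y with y | y <;> exact y.elim0

/-! ### Innermost arcs -/

section Innermost

variable {n m : ℕ} (D : Diagram n m)

/-- An arc separates the boundary circle, so the partner of a point enclosed by it is enclosed as
well; leaving would force a crossing. -/
theorem Diagram.partner_between {x y z : Fin n ⊕ Fin m} (h : D.rel x z)
    (h1 : boundaryPos n m x < boundaryPos n m y) (h2 : boundaryPos n m y < boundaryPos n m z) :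
    ∃ w, w ≠ y ∧ D.rel y w ∧ boundaryPos n m x < boundaryPos n m w ∧
      boundaryPos n m w < boundaryPos n m z := by
  obtain ⟨w, ⟨hw, hyw⟩, -⟩ := D.pairing y
  -- The partner of `x` is `z`, and `y` differs from both in position.
  have hyx : ¬ D.rel y x := fun hyx => by
    have := (D.pairing x).unique ⟨by rintro rfl; exact lt_irrefl _ h1, D.rel.symm' hyx⟩
      ⟨by rintro rfl; exact lt_irrefl _ (h1.trans h2), h⟩
    rw [this] at h2
    exact lt_irrefl _ h2
  refine ⟨w, hw, hyw, ?_, ?_⟩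
  · by_contra hcon
    have hne : boundaryPos n m w ≠ boundaryPos n m x := fun e =>
      hyx (by rwa [boundaryPos_injective _ _ e] at hyw)
    exact D.noncrossing w x y z (by omega) h1 h2 (D.rel.symm' hyw) h
  · by_contra hcon
    have hne : boundaryPos n m w ≠ boundaryPos n m z := fun e => by
      rw [boundaryPos_injective _ _ e] at hyw
      exact hyx (D.rel.trans' hyw (D.rel.symm' h))
    exact D.noncrossing x y z w h1 h2 (by omega) h hyw

/-- Here `g` bounds the width of an arc. A lower arc from `i` of width greater than one encloses `i
+ 1`, whose own arc lies inside and is shorter; an enclosed partner cannot be an upper point, since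
those come later along the boundary. Descent ends at an arc between neighbours. -/
theorem Diagram.not_rel_lower
    (h : ∀ i j : Fin n, j.val = i.val + 1 → ¬ D.rel (.inl i) (.inl j)) :
    ∀ g, ∀ i j : Fin n, i.val < j.val → j.val ≤ i.val + g → ¬ D.rel (.inl i) (.inl j) := by
  intro g
  induction g with
  | zero => intro i j h1 h2; omega
  | succ g ih =>
    intro i j hij hg hrel
    rcases Nat.lt_or_ge (i.val + 1) j.val with hlt | hge
    · obtain ⟨w, hw, hyw, h3, h4⟩ := D.partner_between (y := .inl ⟨i.val + 1, by omega⟩) hrel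
        (by simp) (by simpa using hlt)
      rcases w with w | w
      · simp only [boundaryPos_inl] at h3 h4
        have : w.val ≠ i.val + 1 := fun e => hw (congrArg _ (Fin.ext e))
        exact ih ⟨i.val + 1, by omega⟩ w (by simp only; omega) (by simp only; omega) hyw
      · simp only [boundaryPos_inl, boundaryPos_inr] at h3 h4
        omega
    · exact h i j (by omega) hrel

theorem Diagram.not_rel_upper
    (h : ∀ i j : Fin m, j.val = i.val + 1 → ¬ D.rel (.inr i) (.inr j)) :
    ∀ g, ∀ i j : Fin m, i.val < j.val → j.val ≤ i.val + g → ¬ D.rel (.inr i) (.inr j) := by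
  intro g
  induction g with
  | zero => intro i j h1 h2; omega
  | succ g ih =>
    intro i j hij hg hrel
    rcases Nat.lt_or_ge (i.val + 1) j.val with hlt | hge
    -- Boundary positions on the upper edge decrease from left to right, so the arc is read
    -- backwards.
    · obtain ⟨w, hw, hyw, h3, h4⟩ := D.partner_between (y := .inr ⟨i.val + 1, by omega⟩)
        (D.rel.symm' hrel) (by simp only [boundaryPos_inr]; omega)
        (by simp only [boundaryPos_inr]; omega)
      rcases w with w | w
      · simp only [boundaryPos_inl, boundaryPos_inr] at h3 h4
        omega
      · simp only [boundaryPos_inr] at h3 h4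
        have : w.val ≠ i.val + 1 := fun e => hw (congrArg _ (Fin.ext e))
        exact ih ⟨i.val + 1, by omega⟩ w (by simp only; omega) (by simp only; omega) hyw
    · exact h i j (by omega) hrel

/-- A diagram without innermost arcs on its two edges consists of vertical strands. -/
theorem Diagram.eq_strands_of_no_arcs
    (hl : ∀ i j : Fin n, j.val = i.val + 1 → ¬ D.rel (.inl i) (.inl j))
    (hu : ∀ i j : Fin m, j.val = i.val + 1 → ¬ D.rel (.inr i) (.inr j)) :
    n = m ∧ ∀ i j, D.rel (.inl i) (.inr j) → i.val = j.val := by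
  have l0 : ∀ i j, D.rel (.inl i) (.inl j) → i = j := fun i j hij => by
    rcases lt_trichotomy i j with h | h | h
    · exact absurd hij (D.not_rel_lower hl n i j h (by omega))
    · exact h
    · exact absurd (D.rel.symm' hij) (D.not_rel_lower hl n j i h (by omega))
  have u0 : ∀ i j, D.rel (.inr i) (.inr j) → i = j := fun i j hij => by
    rcases lt_trichotomy i j with h | h | h
    · exact absurd hij (D.not_rel_upper hu m i j h (by omega))
    · exact h
    · exact absurd (D.rel.symm' hij) (D.not_rel_upper hu m j i h (by omega))
  have hσ : ∀ i : Fin n, ∃ j : Fin m, D.rel (.inl i) (.inr j) := fun i => by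
    obtain ⟨w | w, ⟨hw, h⟩, -⟩ := D.pairing (.inl i)
    · exact absurd (congrArg _ (l0 _ _ h).symm) hw
    · exact ⟨w, h⟩
  have hτ : ∀ j : Fin m, ∃ i : Fin n, D.rel (.inl i) (.inr j) := fun j => by
    obtain ⟨w | w, ⟨hw, h⟩, -⟩ := D.pairing (.inr j)
    · exact ⟨w, D.rel.symm' h⟩
    · exact absurd (congrArg _ (u0 _ _ h).symm) hw
  choose σ hσ using hσ
  -- With no arc inside an edge, every curve crosses from bottom to top; two such curves in the
  -- wrong order would intersect.
  have mono : StrictMono σ := fun i i' hii => by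
    rcases lt_trichotomy (σ i) (σ i') with h | h | h
    · exact h
    · refine absurd (l0 i i' (D.rel.trans' (hσ i) ?_)) hii.ne
      rw [h]
      exact D.rel.symm' (hσ i')
    · exfalso
      refine D.noncrossing (.inl i) (.inl i') (.inr (σ i)) (.inr (σ i')) hii ?_ ?_ (hσ i) (hσ i')
      · simp only [boundaryPos_inl, boundaryPos_inr]; omega
      · simp only [boundaryPos_inr]
        have : (σ i').val < (σ i).val := h
        omega
  have surj : Function.Surjective σ := fun j => by
    obtain ⟨i, hi⟩ := hτ j
    exact ⟨i, u0 _ _ (D.rel.trans' (D.rel.symm' (hσ i)) hi)⟩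
  have hnm : n = m := by
    simpa using Fintype.card_congr (Equiv.ofBijective σ ⟨mono.injective, surj⟩)
  refine ⟨hnm, fun i j hij => ?_⟩
  subst hnm
  -- A finite linear order has no order automorphism except the identity.
  have hid : σ = _root_.id := by
    have := Subsingleton.elim (mono.orderIsoOfSurjective σ surj) (OrderIso.refl _)
    funext i
    exact congrArg (fun e => e i) this
  have := u0 _ _ (D.rel.trans' (D.rel.symm' hij) (hσ i))
  rw [this, hid]
  rfl

end Innermost

theorem Diagram.eq_id_of_no_arcs {n : ℕ} (D : Diagram n n)
    (hl : ∀ i j : Fin n, j.val = i.val + 1 → ¬ D.rel (.inl i) (.inl j))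
    (hu : ∀ i j : Fin n, j.val = i.val + 1 → ¬ D.rel (.inr i) (.inr j)) : D = Diagram.id n := by
  refine Diagram.eq_of_le fun x y hxy => ?_
  obtain ⟨-, h⟩ := D.eq_strands_of_no_arcs hl hu
  by_cases hne : y = x
  · rw [hne]
  rcases x with x | x <;> rcases y with y | y
  · rcases lt_trichotomy x y with h' | h' | h'
    · exact absurd hxy (D.not_rel_lower hl n x y h' (by omega))
    · exact absurd (congrArg _ h'.symm) hne
    · exact absurd (D.rel.symm' hxy) (D.not_rel_lower hl n y x h' (by omega))
  · exact Fin.ext (h _ _ hxy)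
  · exact (Fin.ext (h _ _ (D.rel.symm' hxy))).symm
  · rcases lt_trichotomy x y with h' | h' | h'
    · exact absurd hxy (D.not_rel_upper hu n x y h' (by omega))
    · exact absurd (congrArg _ h'.symm) hne
    · exact absurd (D.rel.symm' hxy) (D.not_rel_upper hu n y x h' (by omega))

/-! ### Calculus in the Temperley-Lieb category -/

/-- The morphism given by a diagram. -/
noncomputable def TL.ofDiagram (d : ℂ) {n m : ℕ} (D : Diagram n m) : TL.X d n ⟶ TL.X d m :=
  Finsupp.single D (1 : ℂ)

/-- Juxtaposition of morphisms between powers of the generating object. -/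
noncomputable def TL.tens {d : ℂ} {n m n' m' : ℕ} (f : TL.X d n ⟶ TL.X d m)
    (g : TL.X d n' ⟶ TL.X d m') : TL.X d (n + n') ⟶ TL.X d (m + m') :=
  TL.tensorHom f g

namespace TL

variable {d : ℂ} {n m p n' m' p' : ℕ}

-- Diagrams span the Hom-spaces, so linear identities need checking on multiples of a single diagram
-- only.
@[elab_as_elim]
theorem ofDiagram_induction {P : (TL.X d n ⟶ TL.X d m) → Prop} (f : TL.X d n ⟶ TL.X d m)
    (zero : P 0) (add : ∀ f g, P f → P g → P (f + g))
    (smul : ∀ (c : ℂ) D, P (c • ofDiagram d D)) : P f := by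
  refine Finsupp.induction_linear (motive := P) f zero add fun D c => ?_
  have h := smul c D
  have e : c • ofDiagram d D = Finsupp.single D c :=
    (Finsupp.smul_single c D 1).trans (by rw [smul_eq_mul, mul_one])
  rwa [e] at h

theorem ofDiagram_comp (D : Diagram n m) (E : Diagram m p) :
    ofDiagram d D ≫ ofDiagram d E = d ^ loops D E • ofDiagram d (D.comp E) := by
  refine (compLin_single d D E 1 1).trans ?_
  refine Eq.trans ?_ (Finsupp.smul_single (d ^ loops D E) (D.comp E) (1 : ℂ)).symm
  simp

theorem ofDiagram_tens (D : Diagram n m) (E : Diagram n' m') :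
    tens (ofDiagram d D) (ofDiagram d E) = ofDiagram d (D.tensor E) := by
  refine (tensorLin_single D E 1 1).trans ?_
  rw [mul_one]; rfl

theorem ofDiagram_id (n : ℕ) : ofDiagram d (Diagram.id n) = 𝟙 (TL.X d n) := rfl

theorem tens_comp (f : TL.X d n ⟶ TL.X d m) (g : TL.X d m ⟶ TL.X d p)
    (f' : TL.X d n' ⟶ TL.X d m') (g' : TL.X d m' ⟶ TL.X d p') :
    tens f f' ≫ tens g g' = tens (f ≫ g) (f' ≫ g') :=
  tensorLin_comp d f g f' g'

theorem tens_id (n k : ℕ) : tens (𝟙 (TL.X d n)) (𝟙 (TL.X d k)) = 𝟙 (TL.X d (n + k)) :=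
  idLin_tensor n k

theorem tens_add_left (f f' : TL.X d n ⟶ TL.X d m) (g : TL.X d n' ⟶ TL.X d m') :
    tens (f + f') g = tens f g + tens f' g :=
  LinearMap.map_add₂ (tensorLin n m n' m') f f' g

theorem tens_sub_left (f f' : TL.X d n ⟶ TL.X d m) (g : TL.X d n' ⟶ TL.X d m') :
    tens (f - f') g = tens f g - tens f' g :=
  LinearMap.map_sub₂ (tensorLin n m n' m') f f' g

theorem tens_smul_left (c : ℂ) (f : TL.X d n ⟶ TL.X d m) (g : TL.X d n' ⟶ TL.X d m') :
    tens (c • f) g = c • tens f g :=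
  LinearMap.map_smul₂ (tensorLin n m n' m') c f g

theorem tens_zero_left (g : TL.X d n' ⟶ TL.X d m') :
    tens (0 : TL.X d n ⟶ TL.X d m) g = 0 :=
  LinearMap.map_zero₂ (tensorLin n m n' m') g

theorem tens_add_right (f : TL.X d n ⟶ TL.X d m) (g g' : TL.X d n' ⟶ TL.X d m') :
    tens f (g + g') = tens f g + tens f g' :=
  map_add (tensorLin n m n' m' f) g g'

theorem tens_smul_right (c : ℂ) (f : TL.X d n ⟶ TL.X d m) (g : TL.X d n' ⟶ TL.X d m') :
    tens f (c • g) = c • tens f g :=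
  map_smul (tensorLin n m n' m' f) c g

theorem tens_zero_right (f : TL.X d n ⟶ TL.X d m) :
    tens f (0 : TL.X d n' ⟶ TL.X d m') = 0 :=
  map_zero (tensorLin n m n' m' f)

/-- `f ↦ f ⊗ 1`, for morphisms between different powers. -/
noncomputable def strand (f : TL.X d n ⟶ TL.X d m) : TL.X d (n + 1) ⟶ TL.X d (m + 1) :=
  tens f (𝟙 (TL.X d 1))

theorem strand_comp (f : TL.X d n ⟶ TL.X d m) (g : TL.X d m ⟶ TL.X d p) :
    strand (f ≫ g) = strand f ≫ strand g := by
  unfold strand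
  rw [tens_comp, Category.id_comp]

theorem strand_sub (f f' : TL.X d n ⟶ TL.X d m) : strand (f - f') = strand f - strand f' :=
  tens_sub_left _ _ _

theorem strand_smul (c : ℂ) (f : TL.X d n ⟶ TL.X d m) : strand (c • f) = c • strand f :=
  tens_smul_left _ _ _

theorem strand_id : strand (𝟙 (TL.X d n)) = 𝟙 (TL.X d (n + 1)) := tens_id n 1

theorem strand_zero : strand (0 : TL.X d n ⟶ TL.X d m) = 0 := tens_zero_left _

/-- The two sides have the same type because `n + (n' + 1)` and `(n + n') + 1` agree definitionally.
Bilinearity reduces the claim to associativity of juxtaposition of diagrams. -/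
theorem tens_strand (f : TL.X d n ⟶ TL.X d m) (g : TL.X d n' ⟶ TL.X d m') :
    tens f (strand g) = strand (tens f g) := by
  induction f using ofDiagram_induction with
  | zero => rw [tens_zero_left, tens_zero_left, strand_zero]
  | add f f' h h' =>
    rw [tens_add_left, tens_add_left, h, h']
    exact (tens_add_left _ _ _).symm
  | smul c D =>
    rw [tens_smul_left, tens_smul_left, strand_smul]
    refine congrArg (c • ·) ?_
    induction g using ofDiagram_induction with
    | zero => rw [strand_zero, tens_zero_right, tens_zero_right, strand_zero]
    | add f f' h h' =>
      have e : strand (f + f') = strand f + strand f' := tens_add_left _ _ _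
      rw [e, tens_add_right, tens_add_right, h, h']
      exact (tens_add_left _ _ _).symm
    | smul c E =>
      rw [strand_smul, tens_smul_right, tens_smul_right, strand_smul]
      refine congrArg (c • ·) ?_
      unfold strand
      rw [← ofDiagram_id, ofDiagram_tens, ofDiagram_tens, ofDiagram_tens, ofDiagram_tens]
      exact congrArg _ (Diagram.tensor_assoc_one D E (Diagram.id 1)).symm

theorem tens_id_zero (f : TL.X d n ⟶ TL.X d m) : tens f (𝟙 (TL.X d 0)) = f := by
  induction f using ofDiagram_induction with
  | zero => exact tens_zero_left _
  | add f f' h h' => rw [tens_add_left, h, h']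
  | smul c D =>
    rw [tens_smul_left, ← ofDiagram_id, ofDiagram_tens, Diagram.tensor_id_zero]

/-! ### Arcs on the last two strands: loop value, interchange and zigzag relations. -/

/-- The arc joining the last two lower end points. -/
noncomputable def capLast (d : ℂ) (n : ℕ) : TL.X d (n + 2) ⟶ TL.X d n :=
  tens (𝟙 (TL.X d n)) (ε d)

/-- The arc joining the last two upper end points. -/
noncomputable def cupLast (d : ℂ) (n : ℕ) : TL.X d n ⟶ TL.X d (n + 2) :=
  tens (𝟙 (TL.X d n)) (δ d)

theorem hLast_eq (n : ℕ) : hLast d n = capLast d n ≫ cupLast d n := by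
  unfold capLast cupLast
  refine Eq.trans ?_ (tens_comp _ _ _ _).symm
  rw [Category.id_comp]; rfl

theorem hLast_eq_ofDiagram (n : ℕ) : hLast d n = ofDiagram d (elementary n 0) := by
  have h : ε d ≫ δ d = ofDiagram d capCup := by
    refine (ofDiagram_comp capDiagram cupDiagram).trans ?_
    rw [loops_cap_cup, pow_zero, one_smul]; rfl
  have e : hLast d n = tens (𝟙 (TL.X d n)) (ε d ≫ δ d) := rfl
  rw [e, h, elementary_zero, ← ofDiagram_id, ofDiagram_tens]

theorem cupLast_capLast (n : ℕ) : cupLast d n ≫ capLast d n = d • 𝟙 (TL.X d n) := by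
  have h : δ d ≫ ε d = d • 𝟙 (TL.X d 0) := by
    refine (ofDiagram_comp cupDiagram capDiagram).trans ?_
    rw [loops_cup_cap, pow_one, cup_comp_cap]; rfl
  refine (tens_comp _ _ _ _).trans ?_
  rw [Category.id_comp, h, tens_smul_right, tens_id]; rfl

theorem two_strands (f : TL.X d n ⟶ TL.X d m) :
    strand (strand f) = tens f (𝟙 (TL.X d 2)) := by
  have h := tens_strand f (𝟙 (TL.X d 1))
  rw [strand_id] at h
  exact h.symm

/-- Interchange law: `f` and the cap act on disjoint groups of strands, so `f` slides past the cap.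
-/
theorem strand_capLast (f : TL.X d n ⟶ TL.X d m) :
    strand (strand f) ≫ capLast d m = capLast d n ≫ f := by
  rw [two_strands]
  refine (tens_comp _ _ _ _).trans ?_
  have h := tens_comp (𝟙 _) f (ε d) (𝟙 (TL.X d 0))
  rw [tens_id_zero] at h
  refine Eq.trans ?_ h.symm
  rw [Category.comp_id, Category.id_comp, Category.id_comp, Category.comp_id]

theorem cupLast_strand (f : TL.X d n ⟶ TL.X d m) :
    cupLast d n ≫ strand (strand f) = f ≫ cupLast d m := by
  rw [two_strands]
  refine (tens_comp _ _ _ _).trans ?_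
  have h := tens_comp f (𝟙 _) (𝟙 (TL.X d 0)) (δ d)
  rw [tens_id_zero] at h
  refine Eq.trans ?_ h.symm
  rw [Category.comp_id, Category.id_comp, Category.id_comp, Category.comp_id]

theorem zigzag_right (n : ℕ) :
    cupLast d (n + 1) ≫ strand (capLast d n) = 𝟙 (TL.X d (n + 1)) := by
  have h1 : cupLast d (n + 1) =
      tens (𝟙 (TL.X d n)) (ofDiagram d ((Diagram.id 1).tensor cupDiagram)) := by
    refine (ofDiagram_tens (Diagram.id (n + 1)) cupDiagram).trans ?_
    rw [Diagram.tensor_assoc_cup, ← ofDiagram_id, ofDiagram_tens]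
  have h2 : strand (capLast d n) =
      tens (𝟙 (TL.X d n)) (ofDiagram d (capDiagram.tensor (Diagram.id 1))) := by
    rw [← ofDiagram_tens]
    exact (tens_strand _ _).symm
  rw [h1, h2]
  refine (tens_comp _ _ _ _).trans ?_
  rw [Category.id_comp]
  have h3 := ofDiagram_comp (d := d) ((Diagram.id 1).tensor cupDiagram)
    (capDiagram.tensor (Diagram.id 1))
  rw [zigzag_right_loops, pow_zero, one_smul, zigzag_right_comp] at h3
  rw [h3]
  exact tens_id n 1

theorem zigzag_left (n : ℕ) :
    strand (cupLast d n) ≫ capLast d (n + 1) = 𝟙 (TL.X d (n + 1)) := by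
  have h1 : capLast d (n + 1) =
      tens (𝟙 (TL.X d n)) (ofDiagram d ((Diagram.id 1).tensor capDiagram)) := by
    refine (ofDiagram_tens (Diagram.id (n + 1)) capDiagram).trans ?_
    rw [Diagram.tensor_assoc_cap, ← ofDiagram_id, ofDiagram_tens]
  have h2 : strand (cupLast d n) =
      tens (𝟙 (TL.X d n)) (ofDiagram d (cupDiagram.tensor (Diagram.id 1))) := by
    rw [← ofDiagram_tens]
    exact (tens_strand _ _).symm
  rw [h1, h2]
  refine (tens_comp _ _ _ _).trans ?_
  rw [Category.id_comp]
  have h3 := ofDiagram_comp (d := d) (cupDiagram.tensor (Diagram.id 1))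
    ((Diagram.id 1).tensor capDiagram)
  rw [zigzag_left_loops, pow_zero, one_smul, zigzag_left_comp] at h3
  rw [h3]
  exact tens_id n 1

/-! ### The partial trace -/

/-- Closing the last strand. -/
noncomputable def partialTrace (f : TL.X d (n + 1) ⟶ TL.X d (n + 1)) : TL.X d n ⟶ TL.X d n :=
  cupLast d n ≫ strand f ≫ capLast d n

theorem partialTrace_strand (f : TL.X d n ⟶ TL.X d n) : partialTrace (strand f) = d • f := by
  unfold partialTrace
  rw [strand_capLast, ← Category.assoc, cupLast_capLast, Linear.smul_comp, Category.id_comp]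

/-- The partial trace is a conditional expectation: factors not involving the last strand come out
on both sides. -/
theorem partialTrace_conj (f g : TL.X d n ⟶ TL.X d n) (h : TL.X d (n + 1) ⟶ TL.X d (n + 1)) :
    partialTrace (strand f ≫ h ≫ strand g) = f ≫ partialTrace h ≫ g := by
  unfold partialTrace
  simp only [strand_comp, Category.assoc]
  rw [strand_capLast, ← Category.assoc, cupLast_strand, Category.assoc]

/-- Closing the last strand leaves an S-shaped curve, straightened by one zigzag relation on each
side. -/
theorem partialTrace_hLast (n : ℕ) : partialTrace (hLast d n) = 𝟙 (TL.X d (n + 1)) := by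
  unfold partialTrace
  rw [hLast_eq, strand_comp, Category.assoc, zigzag_left, Category.comp_id, zigzag_right]

theorem partialTrace_sub_smul (f g : TL.X d (n + 1) ⟶ TL.X d (n + 1)) (c : ℂ) :
    partialTrace (f - c • g) = partialTrace f - c • partialTrace g := by
  unfold partialTrace
  rw [strand_sub, strand_smul, Preadditive.sub_comp, Preadditive.comp_sub, Linear.smul_comp,
    Linear.comp_smul]

/-- The Markov trace of an endomorphism of `X ^ n`. -/
noncomputable def trace (f : TL.X d n ⟶ TL.X d n) : ℂ := markovTrace d n f

theorem trace_comm (f : TL.X d n ⟶ TL.X d m) (g : TL.X d m ⟶ TL.X d n) :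
    trace (f ≫ g) = trace (g ≫ f) :=
  markovTrace_comm d f g

theorem trace_smul (c : ℂ) (f : TL.X d n ⟶ TL.X d n) : trace (c • f) = c * trace f :=
  map_smul (markovTrace d n) c f

theorem trace_add (f g : TL.X d n ⟶ TL.X d n) : trace (f + g) = trace f + trace g :=
  map_add (markovTrace d n) f g

theorem trace_zero : trace (0 : TL.X d n ⟶ TL.X d n) = 0 :=
  map_zero (markovTrace d n)

theorem trace_ofDiagram (D : Diagram n n) : trace (ofDiagram d D) = d ^ closedLoops D :=
  (markovTrace_single d D 1).trans (one_mul _)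

/-- Cyclicity moves the cap in front of the cup, which turns the left side into the trace of `strand
f ≫ hLast`. For a diagram, the loops removed in this product and those in its closure together count
the loops of the closed diagram. -/
theorem trace_partialTrace (f : TL.X d (n + 1) ⟶ TL.X d (n + 1)) :
    trace (partialTrace f) = trace f := by
  have h : trace (partialTrace f) = trace (strand f ≫ hLast d n) := by
    unfold partialTrace
    rw [trace_comm, hLast_eq, Category.assoc]
  rw [h]
  clear h
  induction f using ofDiagram_induction with
  | zero => rw [strand_zero, Limits.zero_comp, trace_zero, trace_zero]
  | add f f' h h' =>
    have e : strand (f + f') = strand f + strand f' := tens_add_left _ _ _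
    rw [e, Preadditive.add_comp, trace_add, trace_add, h, h']
  | smul c D =>
    rw [strand_smul, Linear.smul_comp, trace_smul, trace_smul, hLast_eq_ofDiagram]
    have e : strand (ofDiagram d D) = ofDiagram d (D.tensor (Diagram.id 1)) :=
      ofDiagram_tens D (Diagram.id 1)
    rw [e]
    have e2 := ofDiagram_comp (d := d) (D.tensor (Diagram.id 1)) (elementary n 0)
    refine congrArg (c * ·) ((congrArg trace e2).trans ?_)
    rw [trace_smul, trace_ofDiagram, trace_ofDiagram, ← pow_add, add_comm]
    exact congrArg _ ((closedLoops_comp (D.tensor (Diagram.id 1)) (elementary n 0)).trans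
      (pairLoops_elementary D))

end TL

/-! ### Quantum integers -/

theorem qInt_zero (q : ℂ) : qInt q 0 = 0 := by simp [qInt]

theorem qInt_add_two {q : ℂ} (hq : q ≠ 0) (k : ℕ) :
    qInt q (k + 2) = (q + q⁻¹) * qInt q (k + 1) - qInt q k := by
  unfold qInt
  rw [← mul_div_assoc, ← sub_div]
  congr 1
  have h : q * q⁻¹ = 1 := mul_inv_cancel₀ hq
  simp only [pow_succ]
  linear_combination (q⁻¹ ^ k - q ^ k) * h

section Root

variable {q : ℂ} {l : ℕ}

theorem root_ne_zero (hl : 2 ≤ l) (hq : IsPrimitiveRoot (q ^ 2) l) : q ≠ 0 := by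
  rintro rfl
  have h := hq.pow_eq_one
  rw [zero_pow two_ne_zero, zero_pow (by omega)] at h
  exact zero_ne_one h

theorem root_sub_inv_ne_zero (hl : 2 ≤ l) (hq : IsPrimitiveRoot (q ^ 2) l) : q - q⁻¹ ≠ 0 := by
  have h0 := root_ne_zero hl hq
  intro h
  refine hq.ne_one (by omega) ?_
  calc q ^ 2 = q * q := sq q
    _ = q * q⁻¹ := by rw [← sub_eq_zero.1 h]
    _ = 1 := mul_inv_cancel₀ h0

/-- The numerator vanishes exactly when `q ^ k = q⁻¹ ^ k`, that is, when `(q ^ 2) ^ k = 1`. -/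
theorem qInt_eq_zero_iff (hl : 2 ≤ l) (hq : IsPrimitiveRoot (q ^ 2) l) (k : ℕ) :
    qInt q k = 0 ↔ l ∣ k := by
  have h0 := root_ne_zero hl hq
  rw [← hq.pow_eq_one_iff_dvd]
  unfold qInt
  rw [div_eq_zero_iff, or_iff_left (root_sub_inv_ne_zero hl hq), sub_eq_zero, inv_pow,
    ← mul_eq_one_iff_eq_inv₀ (pow_ne_zero _ h0), ← pow_mul, two_mul, pow_add]

theorem qInt_ne_zero (hl : 2 ≤ l) (hq : IsPrimitiveRoot (q ^ 2) l) {k : ℕ} (h1 : 1 ≤ k)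
    (h2 : k < l) : qInt q k ≠ 0 := fun h =>
  absurd (Nat.le_of_dvd h1 ((qInt_eq_zero_iff hl hq k).1 h)) (by omega)

theorem qInt_one (hl : 2 ≤ l) (hq : IsPrimitiveRoot (q ^ 2) l) : qInt q 1 = 1 := by
  unfold qInt
  rw [pow_one, pow_one, div_self (root_sub_inv_ne_zero hl hq)]

theorem qInt_two (hl : 2 ≤ l) (hq : IsPrimitiveRoot (q ^ 2) l) : qInt q 2 = q + q⁻¹ := by
  rw [qInt_add_two (root_ne_zero hl hq), qInt_zero, qInt_one hl hq]; ring

end Root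

/-! ### The Jones-Wenzl idempotents -/

theorem wenzl_add_two (q : ℂ) (n : ℕ) : wenzl q (n + 2) =
    strand (wenzl q (n + 1)) - (qInt q (n + 1) / qInt q (n + 2)) •
      (strand (wenzl q (n + 1)) ≫ hLast (q + q⁻¹) n ≫ strand (wenzl q (n + 1))) := rfl

/-- The inductive properties of the elements `f_n` and `f_{n+1}`. -/
structure WenzlStep (q : ℂ) (n : ℕ) : Prop where
  idem_self : wenzl q n ≫ wenzl q n = wenzl q n
  idem_succ : wenzl q (n + 1) ≫ wenzl q (n + 1) = wenzl q (n + 1)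
  strand_comp_succ : strand (wenzl q n) ≫ wenzl q (n + 1) = wenzl q (n + 1)
  succ_comp_strand : wenzl q (n + 1) ≫ strand (wenzl q n) = wenzl q (n + 1)
  partialTrace_succ : partialTrace (wenzl q (n + 1)) =
    (qInt q (n + 2) / qInt q (n + 1)) • wenzl q n

theorem WenzlStep.absorb_left {q : ℂ} {n : ℕ} (h : WenzlStep q n) :
    strand (strand (wenzl q n)) ≫ strand (wenzl q (n + 1)) = strand (wenzl q (n + 1)) := by
  rw [← strand_comp, h.strand_comp_succ]

theorem WenzlStep.absorb_right {q : ℂ} {n : ℕ} (h : WenzlStep q n) :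
    strand (wenzl q (n + 1)) ≫ strand (strand (wenzl q n)) = strand (wenzl q (n + 1)) := by
  rw [← strand_comp, h.succ_comp_strand]

theorem WenzlStep.strand_idem {q : ℂ} {n : ℕ} (h : WenzlStep q n) :
    strand (wenzl q (n + 1)) ≫ strand (wenzl q (n + 1)) = strand (wenzl q (n + 1)) := by
  rw [← strand_comp, h.idem_succ]

/-- Capping the correction term of the recursion produces the partial trace of `f_{n+1}`. Its
coefficient `[n+2]/[n+1]` cancels the coefficient `[n+1]/[n+2]`, and since `f_{n+1}` absorbs `f_n`,
what remains is the capped first term. -/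
theorem WenzlStep.wenzl_capLast {q : ℂ} {n : ℕ} (h : WenzlStep q n) (h1 : qInt q (n + 1) ≠ 0)
    (h2 : qInt q (n + 2) ≠ 0) : wenzl q (n + 2) ≫ capLast _ n = 0 := by
  have hp : cupLast _ n ≫ strand (wenzl q (n + 1)) ≫ capLast _ n =
      (qInt q (n + 2) / qInt q (n + 1)) • wenzl q n := h.partialTrace_succ
  rw [wenzl_add_two, hLast_eq, Preadditive.sub_comp, Linear.smul_comp]
  simp only [Category.assoc]
  rw [hp, Linear.comp_smul, Linear.comp_smul, smul_smul, div_mul_div_cancel₀ h2, div_self h1,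
    one_smul, ← strand_capLast, ← Category.assoc, h.absorb_right, sub_self]

theorem WenzlStep.cupLast_wenzl {q : ℂ} {n : ℕ} (h : WenzlStep q n) (h1 : qInt q (n + 1) ≠ 0)
    (h2 : qInt q (n + 2) ≠ 0) : cupLast _ n ≫ wenzl q (n + 2) = 0 := by
  have hp : cupLast _ n ≫ strand (wenzl q (n + 1)) ≫ capLast _ n =
      (qInt q (n + 2) / qInt q (n + 1)) • wenzl q n := h.partialTrace_succ
  have hp' : ∀ {m} (x : TL.X _ n ⟶ TL.X _ m),
      cupLast _ n ≫ strand (wenzl q (n + 1)) ≫ capLast _ n ≫ x =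
      (qInt q (n + 2) / qInt q (n + 1)) • (wenzl q n ≫ x) := fun x => by
    rw [← Linear.smul_comp, ← hp]; simp only [Category.assoc]
  rw [wenzl_add_two, hLast_eq, Preadditive.comp_sub, Linear.comp_smul]
  simp only [Category.assoc]
  rw [hp', smul_smul, div_mul_div_cancel₀ h2, div_self h1,
    one_smul, ← Category.assoc, ← cupLast_strand, Category.assoc, h.absorb_left, sub_self]

theorem WenzlStep.succ {q : ℂ} {n : ℕ} (hq : q ≠ 0) (h : WenzlStep q n)
    (h1 : qInt q (n + 1) ≠ 0) (h2 : qInt q (n + 2) ≠ 0) : WenzlStep q (n + 1) := by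
  have hl : strand (wenzl q (n + 1)) ≫ wenzl q (n + 2) = wenzl q (n + 2) := by
    rw [wenzl_add_two, Preadditive.comp_sub, Linear.comp_smul, ← Category.assoc (strand _),
      h.strand_idem]
  have hr : wenzl q (n + 2) ≫ strand (wenzl q (n + 1)) = wenzl q (n + 2) := by
    rw [wenzl_add_two, Preadditive.sub_comp, Linear.smul_comp]
    simp only [Category.assoc, h.strand_idem]
  refine ⟨h.idem_succ, ?_, hl, hr, ?_⟩
  -- Only the right factor is expanded: its first term is absorbed by `f_{n+2}`, and its correction
  -- term dies because `f_{n+2}` kills the cap in `hLast`.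
  · have e : wenzl q (n + 2) ≫ wenzl q (n + 2) = wenzl q (n + 2) ≫
        (strand (wenzl q (n + 1)) - (qInt q (n + 1) / qInt q (n + 2)) •
        (strand (wenzl q (n + 1)) ≫ hLast (q + q⁻¹) n ≫ strand (wenzl q (n + 1)))) := rfl
    have e2 : wenzl q (n + 2) ≫ strand (wenzl q (n + 1)) ≫ hLast (q + q⁻¹) n ≫
        strand (wenzl q (n + 1)) = 0 := by
      rw [← Category.assoc, hr, hLast_eq]
      simp only [Category.assoc]
      rw [← Category.assoc, h.wenzl_capLast h1 h2, Limits.zero_comp]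
    exact e.trans (by rw [Preadditive.comp_sub, Linear.comp_smul, e2, hr, smul_zero, sub_zero])
  -- The coefficient is `d - [n+1]/[n+2]`, which equals `[n+3]/[n+2]` by the recursion for quantum
  -- integers. Nothing is divided by `[n+3]`, so the induction also covers the step where `[n+3] =
  -- [l] = 0`.
  · rw [wenzl_add_two, partialTrace_sub_smul, partialTrace_strand, partialTrace_conj,
      partialTrace_hLast, Category.id_comp, h.idem_succ, ← sub_smul, qInt_add_two hq (n + 1)]
    congr 1
    rw [sub_div, mul_div_cancel_right₀ _ h2]

theorem wenzlStep_zero {q : ℂ} (h1 : qInt q 1 = 1) (h2 : qInt q 2 = q + q⁻¹) :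
    WenzlStep q 0 := by
  refine ⟨Category.id_comp _, Category.id_comp _, ?_, ?_, ?_⟩
  · exact (congrArg (· ≫ wenzl q 1) strand_id).trans (Category.id_comp _)
  · exact (congrArg (wenzl q 1 ≫ ·) strand_id).trans (Category.comp_id _)
  · have e : wenzl q 1 = strand (wenzl q 0) := (strand_id (n := 0)).symm
    rw [e, partialTrace_strand, h1, h2, div_one]

section Root

variable {q : ℂ} {l : ℕ}

/-- The range includes `f_{l-1}`, whose negligibility will produce the truncation. -/
theorem wenzlStep (hl : 2 ≤ l) (hq : IsPrimitiveRoot (q ^ 2) l) {n : ℕ} (hn : n + 1 < l) :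
    WenzlStep q n := by
  induction n with
  | zero => exact wenzlStep_zero (qInt_one hl hq) (qInt_two hl hq)
  | succ n ih =>
    exact (ih (by omega)).succ (root_ne_zero hl hq)
      (qInt_ne_zero hl hq (by omega) (by omega)) (qInt_ne_zero hl hq (by omega) (by omega))

theorem wenzl_idem (hl : 2 ≤ l) (hq : IsPrimitiveRoot (q ^ 2) l) {n : ℕ} (hn : n < l) :
    wenzl q n ≫ wenzl q n = wenzl q n := by
  cases n with
  | zero => exact Category.id_comp _
  | succ n => exact (wenzlStep hl hq hn).idem_succ

/-! ### Annihilation of arcs and Schur's lemma for the Jones–Wenzl idempotents. -/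

theorem wenzl_elementary (hl : 2 ≤ l) (hq : IsPrimitiveRoot (q ^ 2) l) (i t : ℕ)
    (hn : i + 2 + t < l) : wenzl q (i + 2 + t) ≫ ofDiagram _ (elementary i t) = 0 := by
  induction t with
  | zero =>
    have h := (wenzlStep hl hq (show i + 1 < l by omega)).wenzl_capLast
      (qInt_ne_zero hl hq (by omega) (by omega)) (qInt_ne_zero hl hq (by omega) (by omega))
    have h2 : wenzl q (i + 2) ≫ hLast _ i = 0 := by
      rw [hLast_eq, ← Category.assoc, h, Limits.zero_comp]
    rwa [hLast_eq_ofDiagram] at h2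
  | succ t ih =>
    have h := (wenzlStep hl hq (show i + 2 + t + 1 < l by omega)).succ_comp_strand
    have e : ofDiagram (q + q⁻¹) (elementary i (t + 1)) =
        strand (ofDiagram (q + q⁻¹) (elementary i t)) := by
      rw [elementary_succ]
      exact (ofDiagram_tens _ _).symm
    rw [e]
    change wenzl q (i + 2 + t + 1) ≫ strand (ofDiagram (q + q⁻¹) (elementary i t)) = 0
    -- `f_{n+1}` factors through `f_n ⊗ 1`, and `f_n` already kills the smaller elementary diagram.
    rw [← h, Category.assoc, ← strand_comp, ih (by omega), strand_zero, Limits.comp_zero]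

theorem elementary_wenzl (hl : 2 ≤ l) (hq : IsPrimitiveRoot (q ^ 2) l) (i t : ℕ)
    (hn : i + 2 + t < l) : ofDiagram _ (elementary i t) ≫ wenzl q (i + 2 + t) = 0 := by
  induction t with
  | zero =>
    have h := (wenzlStep hl hq (show i + 1 < l by omega)).cupLast_wenzl
      (qInt_ne_zero hl hq (by omega) (by omega)) (qInt_ne_zero hl hq (by omega) (by omega))
    have h2 : hLast _ i ≫ wenzl q (i + 2) = 0 := by
      rw [hLast_eq, Category.assoc, h, Limits.comp_zero]
    rwa [hLast_eq_ofDiagram] at h2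
  | succ t ih =>
    have h := (wenzlStep hl hq (show i + 2 + t + 1 < l by omega)).strand_comp_succ
    have e : ofDiagram (q + q⁻¹) (elementary i (t + 1)) =
        strand (ofDiagram (q + q⁻¹) (elementary i t)) := by
      rw [elementary_succ]
      exact (ofDiagram_tens _ _).symm
    rw [e]
    change strand (ofDiagram (q + q⁻¹) (elementary i t)) ≫ wenzl q (i + 2 + t + 1) = 0
    rw [← h, ← Category.assoc, ← strand_comp, ih (by omega), strand_zero, Limits.zero_comp]

/-- The loop parameter is `[2]`, which vanishes when `l = 2`. It is needed only in the presence of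
an arc, which takes two points on an edge with fewer than `l` points and so forces `l ≥ 3`. -/
theorem loop_ne_zero (hl : 3 ≤ l) (hq : IsPrimitiveRoot (q ^ 2) l) : q + q⁻¹ ≠ 0 := by
  rw [← qInt_two (by omega) hq]
  exact qInt_ne_zero (by omega) hq (by omega) (by omega)

/-- Such a diagram absorbs an elementary one at the cost of a power of the loop parameter. The
elementary diagram is killed and the power can be cancelled. -/
theorem wenzl_comp_of_arc (hl : 2 ≤ l) (hq : IsPrimitiveRoot (q ^ 2) l) {n m : ℕ} (hn : n < l)
    (D : Diagram n m) {a b : Fin n} (hab : b.val = a.val + 1) (h : D.rel (.inl a) (.inl b)) :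
    wenzl q n ≫ ofDiagram _ D = 0 := by
  obtain ⟨a, ha⟩ := a
  obtain ⟨t, rfl⟩ := Nat.exists_eq_add_of_le
    (show a + 2 ≤ n by have := b.2; simp only at hab; omega)
  have e := ofDiagram_comp (d := q + q⁻¹) (elementary a t) D
  rw [elementary_comp D rfl hab h] at e
  have hz : (q + q⁻¹) ^ loops (elementary a t) D • (wenzl q (a + 2 + t) ≫ ofDiagram _ D) = 0 := by
    rw [← Linear.comp_smul, ← e, ← Category.assoc, wenzl_elementary hl hq a t hn,
      Limits.zero_comp]
  exact (smul_eq_zero.1 hz).resolve_left (pow_ne_zero _ (loop_ne_zero (by omega) hq))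

theorem comp_wenzl_of_arc (hl : 2 ≤ l) (hq : IsPrimitiveRoot (q ^ 2) l) {n m : ℕ} (hn : n < l)
    (D : Diagram m n) {a b : Fin n} (hab : b.val = a.val + 1) (h : D.rel (.inr a) (.inr b)) :
    ofDiagram _ D ≫ wenzl q n = 0 := by
  obtain ⟨a, ha⟩ := a
  obtain ⟨t, rfl⟩ := Nat.exists_eq_add_of_le
    (show a + 2 ≤ n by have := b.2; simp only at hab; omega)
  have e := ofDiagram_comp (d := q + q⁻¹) D (elementary a t)
  rw [comp_elementary D rfl hab h] at e
  have hz : (q + q⁻¹) ^ loops D (elementary a t) • (ofDiagram _ D ≫ wenzl q (a + 2 + t)) = 0 := by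
    rw [← Linear.smul_comp, ← e, Category.assoc, elementary_wenzl hl hq a t hn, Limits.comp_zero]
  exact (smul_eq_zero.1 hz).resolve_left (pow_ne_zero _ (loop_ne_zero (by omega) hq))

/-- A diagram with an arc between neighbours is killed from one side; one without such arcs consists
of vertical strands, which is impossible for `n ≠ m`. -/
theorem wenzl_comp_wenzl_of_ne (hl : 2 ≤ l) (hq : IsPrimitiveRoot (q ^ 2) l) {n m : ℕ}
    (hn : n < l) (hm : m < l) (hnm : n ≠ m) (φ : TL.X _ n ⟶ TL.X _ m) :
    wenzl q n ≫ φ ≫ wenzl q m = 0 := by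
  induction φ using ofDiagram_induction with
  | zero => rw [Limits.zero_comp, Limits.comp_zero]
  | add f g hf hg => rw [Preadditive.add_comp, Preadditive.comp_add, hf, hg, add_zero]
  | smul c D =>
    rw [Linear.smul_comp, Linear.comp_smul]
    by_cases h1 : ∃ a b : Fin n, b.val = a.val + 1 ∧ D.rel (.inl a) (.inl b)
    · obtain ⟨a, b, hab, h⟩ := h1
      rw [← Category.assoc, wenzl_comp_of_arc hl hq hn D hab h, Limits.zero_comp, smul_zero]
    by_cases h2 : ∃ a b : Fin m, b.val = a.val + 1 ∧ D.rel (.inr a) (.inr b)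
    · obtain ⟨a, b, hab, h⟩ := h2
      rw [comp_wenzl_of_arc hl hq hm D hab h, Limits.comp_zero, smul_zero]
    push Not at h1 h2
    exact absurd (D.eq_strands_of_no_arcs h1 h2).1 hnm

theorem wenzl_comp_wenzl_self (hl : 2 ≤ l) (hq : IsPrimitiveRoot (q ^ 2) l) {n : ℕ}
    (hn : n < l) (φ : TL.X _ n ⟶ TL.X _ n) :
    ∃ c : ℂ, wenzl q n ≫ φ ≫ wenzl q n = c • wenzl q n := by
  induction φ using ofDiagram_induction with
  | zero => exact ⟨0, by rw [Limits.zero_comp, Limits.comp_zero, zero_smul]⟩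
  | add f g hf hg =>
    obtain ⟨a, ha⟩ := hf
    obtain ⟨b, hb⟩ := hg
    exact ⟨a + b, by rw [Preadditive.add_comp, Preadditive.comp_add, ha, hb, add_smul]⟩
  | smul c D =>
    by_cases h1 : ∃ a b : Fin n, b.val = a.val + 1 ∧ D.rel (.inl a) (.inl b)
    · obtain ⟨a, b, hab, h⟩ := h1
      refine ⟨0, ?_⟩
      rw [Linear.smul_comp, Linear.comp_smul, ← Category.assoc, wenzl_comp_of_arc hl hq hn D hab h,
        Limits.zero_comp, smul_zero, zero_smul]
    by_cases h2 : ∃ a b : Fin n, b.val = a.val + 1 ∧ D.rel (.inr a) (.inr b)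
    · obtain ⟨a, b, hab, h⟩ := h2
      refine ⟨0, ?_⟩
      rw [Linear.smul_comp, Linear.comp_smul, comp_wenzl_of_arc hl hq hn D hab h,
        Limits.comp_zero, smul_zero, zero_smul]
    push Not at h1 h2
    -- Only the identity diagram survives, so the resulting scalar is the coefficient of the
    -- identity.
    refine ⟨c, ?_⟩
    rw [D.eq_id_of_no_arcs h1 h2, Linear.smul_comp, Linear.comp_smul, ofDiagram_id,
      Category.id_comp, wenzl_idem hl hq hn]

/-! ### Traces of the idempotents and negligibility of the last one. -/

theorem trace_wenzl (hl : 2 ≤ l) (hq : IsPrimitiveRoot (q ^ 2) l) {n : ℕ} (hn : n < l) :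
    trace (wenzl q n) = qInt q (n + 1) := by
  induction n with
  | zero =>
    refine (trace_ofDiagram (Diagram.id 0)).trans ?_
    rw [closedLoops_id_zero, pow_zero, qInt_one hl hq]
  | succ n ih =>
    -- Each closed strand contributes a ratio of consecutive quantum integers; the product
    -- telescopes from `tr f_0 = [1] = 1`.
    rw [← trace_partialTrace, (wenzlStep hl hq hn).partialTrace_succ, trace_smul,
      ih (by omega), div_mul_cancel₀ _ (qInt_ne_zero hl hq (by omega) hn)]

/-- The top Jones-Wenzl idempotent is negligible. -/
theorem reduction_wenzl_eq_zero (hl : 2 ≤ l) (hq : IsPrimitiveRoot (q ^ 2) l) :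
    (reduction (q + q⁻¹)).map (wenzl q (l - 1)) = 0 := by
  have hn : l - 1 < l := by omega
  refine (Submodule.Quotient.mk_eq_zero _).2 fun g => ?_
  change trace (wenzl q (l - 1) ≫ (g : TL.X _ (l - 1) ⟶ TL.X _ (l - 1))) = 0
  obtain ⟨c, hc⟩ := wenzl_comp_wenzl_self hl hq hn (g : TL.X _ (l - 1) ⟶ TL.X _ (l - 1))
  -- By idempotency and cyclicity `tr (f g) = tr (f g f) = c tr f`, and `tr f_{l-1} = [l] = 0`.
  rw [← wenzl_idem hl hq hn, Category.assoc, trace_comm, Category.assoc, hc, trace_smul,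
    trace_wenzl hl hq hn, Nat.sub_add_cancel (by omega), (qInt_eq_zero_iff hl hq l).2 dvd_rfl,
    mul_zero]

/-- Pairing `f_n` with the identity gives `[n+1]`, which is nonzero for `n + 1 < l`. -/
theorem reduction_wenzl_ne_zero (hl : 2 ≤ l) (hq : IsPrimitiveRoot (q ^ 2) l) {n : ℕ}
    (hn : n + 1 < l) : (reduction (q + q⁻¹)).map (wenzl q n) ≠ 0 := by
  intro h
  have h2 := (Submodule.Quotient.mk_eq_zero _).1 h (𝟙 (TL.X (q + q⁻¹) n))
  have h3 : trace (wenzl q n ≫ 𝟙 _) = 0 := h2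
  rw [Category.comp_id, trace_wenzl hl hq (by omega)] at h3
  exact qInt_ne_zero hl hq (by omega) hn h3

end Root

/-! ### Linear structure on the idempotent completion -/

section Karoubi

variable {C : Type} [Category.{0} C] [Preadditive C] [Linear ℂ C]

/-- Multiplicities will be dimensions of Hom-spaces in the idempotent completion, so these need a
finite-dimensional complex structure, inherited from the underlying category. -/
instance (P Q : Karoubi C) : SMul ℂ (P ⟶ Q) where
  smul c f := ⟨c • f.f, by rw [Linear.smul_comp, Linear.comp_smul, f.comm]⟩

instance (P Q : Karoubi C) : Module ℂ (P ⟶ Q) :=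
  Function.Injective.module ℂ (Karoubi.inclusionHom P Q) (fun _ _ h => Karoubi.hom_ext _ _ h)
    (fun _ _ => rfl)

instance : Linear ℂ (Karoubi C) where
  homModule _ _ := inferInstance
  smul_comp _ _ _ c f g := Karoubi.hom_ext _ _ (Linear.smul_comp _ _ _ c f.f g.f)
  comp_smul _ _ _ f c g := Karoubi.hom_ext _ _ (Linear.comp_smul _ _ _ f.f c g.f)

instance [∀ X Y : C, Module.Finite ℂ (X ⟶ Y)] (P Q : Karoubi C) : Module.Finite ℂ (P ⟶ Q) :=
  Module.Finite.of_injective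
    ({ toFun := fun f => f.f
       map_add' := fun _ _ => rfl
       map_smul' := fun _ _ => rfl } : (P ⟶ Q) →ₗ[ℂ] (P.X ⟶ Q.X))
    (fun _ _ h => Karoubi.hom_ext _ _ h)

end Karoubi

/-! ### Direct sums in linear categories -/

/-- Applied to tensoring on either side, this gives distributivity of the tensor product over direct
sums. -/
theorem IsDirectSum.map {C D : Type} [Category.{0} C] [Category.{0} D] [Preadditive C]
    [Preadditive D] (F : C ⥤ D) [F.Additive] {ι : Type} [Fintype ι] {Y : C} {Z : ι → C}
    (h : IsDirectSum Y Z) : IsDirectSum (F.obj Y) (fun i => F.obj (Z i)) := by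
  obtain ⟨α, β, h1, h2, h3⟩ := h
  refine ⟨fun i => F.map (α i), fun i => F.map (β i), fun i => ?_, fun i j hij => ?_, ?_⟩
  · rw [← F.map_comp, h1, F.map_id]
  · rw [← F.map_comp, h2 i j hij, F.map_zero]
  · simp only [← F.map_comp]
    rw [← F.map_sum, h3, F.map_id]

section Abstract

variable {C : Type} [Category.{0} C] [Preadditive C] [Linear ℂ C]

/-- The post-composition isomorphism given by a direct sum decomposition. -/
theorem IsDirectSum.nonempty_linearEquiv {ι : Type} [Fintype ι] {Y : C} {Z : ι → C}
    (h : IsDirectSum Y Z) (T : C) : Nonempty ((T ⟶ Y) ≃ₗ[ℂ] (∀ i, T ⟶ Z i)) := by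
  classical
  obtain ⟨α, β, h1, h2, h3⟩ := h
  refine ⟨{ toFun := fun f i => f ≫ β i
            invFun := fun g => ∑ i, g i ≫ α i
            map_add' := fun f g => funext fun i => Preadditive.add_comp _ _ _ _ _ _
            map_smul' := fun c f => funext fun i => Linear.smul_comp _ _ _ _ _ _
            left_inv := fun f => ?_
            right_inv := fun g => ?_ }⟩
  · simp only [Category.assoc]
    rw [← Preadditive.comp_sum, h3, Category.comp_id]
  · funext i
    simp only [Preadditive.sum_comp, Category.assoc]
    rw [Finset.sum_eq_single i, h1, Category.comp_id]
    · intro j _ hji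
      rw [h2 i j (Ne.symm hji), Limits.comp_zero]
    · exact fun hi => absurd (Finset.mem_univ i) hi

theorem IsDirectSum.finrank_hom [∀ X Y : C, Module.Finite ℂ (X ⟶ Y)] {ι : Type} [Fintype ι]
    {Y : C} {Z : ι → C} (h : IsDirectSum Y Z) (T : C) :
    Module.finrank ℂ (T ⟶ Y) = ∑ i, Module.finrank ℂ (T ⟶ Z i) := by
  obtain ⟨e⟩ := h.nonempty_linearEquiv T
  rw [e.finrank_eq, Module.finrank_pi_fintype]

/-! ### Schur families and the objects they generate. -/

variable {A : Type} {S : A → C}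

/-- A family of pairwise non-isomorphic objects satisfying Schur's lemma. -/
structure IsSchurFamily (S : A → C) : Prop where
  eq_zero : ∀ a b, a ≠ b → ∀ f : S a ⟶ S b, f = 0
  eq_smul : ∀ a (f : S a ⟶ S a), ∃ c : ℂ, f = c • 𝟙 (S a)
  id_ne_zero : ∀ a, 𝟙 (S a) ≠ 0

theorem IsSchurFamily.finrank_hom [DecidableEq A] (hS : IsSchurFamily S) (a b : A) :
    Module.finrank ℂ (S a ⟶ S b) = if a = b then 1 else 0 := by
  split_ifs with h
  · subst h
    exact finrank_eq_one (𝟙 (S a)) (hS.id_ne_zero a) fun f => by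
      obtain ⟨c, hc⟩ := hS.eq_smul a f
      exact ⟨c, hc.symm⟩
  · have : Subsingleton (S a ⟶ S b) :=
      ⟨fun f g => (hS.eq_zero a b h f).trans (hS.eq_zero a b h g).symm⟩
    exact Module.finrank_zero_of_subsingleton

/-- The endomorphisms of `Y` which are sums of morphisms factoring through the family `S`. -/
def throughFamily (S : A → C) (Y : C) : Submodule ℂ (Y ⟶ Y) :=
  Submodule.span ℂ {f | ∃ a, ∃ (w : Y ⟶ S a) (v : S a ⟶ Y), w ≫ v = f}

/-- Sums of morphisms through the family are stable under composition on both sides. This is the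
substitute for semisimplicity: membership of the identity passes from summands to a sum and from a
sum to its summands. -/
theorem throughFamily_conj {Y Z : C} {x : Y ⟶ Y} (hx : x ∈ throughFamily S Y) (r : Z ⟶ Y)
    (s : Y ⟶ Z) : r ≫ x ≫ s ∈ throughFamily S Z := by
  induction hx using Submodule.span_induction with
  | mem x hx =>
    obtain ⟨a, w, v, rfl⟩ := hx
    exact Submodule.subset_span ⟨a, r ≫ w, v ≫ s, by simp only [Category.assoc]⟩
  | zero => rw [Limits.zero_comp, Limits.comp_zero]; exact Submodule.zero_mem _
  | add x y _ _ hx hy =>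
    rw [Preadditive.add_comp, Preadditive.comp_add]
    exact Submodule.add_mem _ hx hy
  | smul c x _ hx =>
    rw [Linear.smul_comp, Linear.comp_smul]
    exact Submodule.smul_mem _ c hx

theorem IsDirectSum.id_mem_throughFamily {ι : Type} [Fintype ι] {Y : C} {Z : ι → C}
    (h : IsDirectSum Y Z) (hZ : ∀ i, 𝟙 (Z i) ∈ throughFamily S (Z i)) :
    𝟙 Y ∈ throughFamily S Y := by
  obtain ⟨α, β, -, -, h3⟩ := h
  rw [← h3]
  refine Submodule.sum_mem _ fun i _ => ?_
  have := throughFamily_conj (hZ i) (β i) (α i)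
  rwa [Category.id_comp] at this

theorem IsDirectSum.summand_mem_throughFamily {ι : Type} [Fintype ι] {Y : C} {Z : ι → C}
    (h : IsDirectSum Y Z) (hY : 𝟙 Y ∈ throughFamily S Y) (i : ι) :
    𝟙 (Z i) ∈ throughFamily S (Z i) := by
  obtain ⟨α, β, h1, -, -⟩ := h
  have := throughFamily_conj hY (α i) (β i)
  rwa [Category.id_comp, h1] at this

theorem id_mem_throughFamily (a : A) : 𝟙 (S a) ∈ throughFamily S (S a) :=
  Submodule.subset_span ⟨a, 𝟙 _, 𝟙 _, Category.id_comp _⟩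

/-- An object generated by a Schur family, in which each member occurs at most once, is a direct
sum of members of the family. -/
theorem IsSchurFamily.isDirectSum [∀ X Y : C, Module.Finite ℂ (X ⟶ Y)] (hS : IsSchurFamily S)
    {Y : C} (hY : 𝟙 Y ∈ throughFamily S Y) {ι : Type} [Fintype ι] {c : ι → A}
    (hc : Function.Injective c) (h1 : ∀ i, Module.finrank ℂ (S (c i) ⟶ Y) = 1)
    (h0 : ∀ a, a ∉ Set.range c → Module.finrank ℂ (S a ⟶ Y) = 0) :
    IsDirectSum Y (fun i => S (c i)) := by
  classical
  -- The inclusion of each summand is a spanning vector of the one-dimensional space of morphisms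
  -- from it.
  have hv : ∀ i, ∃ v : S (c i) ⟶ Y, v ≠ 0 ∧ ∀ w : S (c i) ⟶ Y, ∃ z : ℂ, z • v = w := fun i =>
    finrank_eq_one_iff'.1 (h1 i)
  choose v hv0 hv using hv
  -- In a factorization through `S a`, the second factor is a multiple of some `v i`, or zero when
  -- `a` does not occur. The scalar is moved into the first factor.
  have hw : ∀ x ∈ throughFamily S Y, ∃ w : ∀ i, Y ⟶ S (c i), ∑ i, w i ≫ v i = x := by
    intro x hx
    induction hx using Submodule.span_induction with
    | mem x hx =>
      obtain ⟨a, w, u, rfl⟩ := hx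
      by_cases ha : a ∈ Set.range c
      · obtain ⟨i, rfl⟩ := ha
        obtain ⟨z, rfl⟩ := hv i u
        refine ⟨fun j => if h : i = j then z • (w ≫ eqToHom (by rw [h])) else 0, ?_⟩
        rw [Finset.sum_eq_single i]
        · simp
        · intro j _ hj
          beta_reduce
          rw [dif_neg (Ne.symm hj), Limits.zero_comp]
        · exact fun hi => absurd (Finset.mem_univ i) hi
      · have : Subsingleton (S a ⟶ Y) := Module.finrank_zero_iff.1 (h0 a ha)
        refine ⟨fun _ => 0, ?_⟩
        rw [Subsingleton.elim u 0, Limits.comp_zero]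
        simp
    | zero => exact ⟨fun _ => 0, by simp⟩
    | add x y _ _ hx hy =>
      obtain ⟨w, rfl⟩ := hx
      obtain ⟨w', rfl⟩ := hy
      exact ⟨fun i => w i + w' i, by simp only [Preadditive.add_comp, Finset.sum_add_distrib]⟩
    | smul z x _ hx =>
      obtain ⟨w, rfl⟩ := hx
      exact ⟨fun i => z • w i, by simp only [Linear.smul_comp, Finset.smul_sum]⟩
  obtain ⟨w, hw⟩ := hw _ hY
  have hne : ∀ i j, i ≠ j → v j ≫ w i = 0 := fun i j hij =>
    hS.eq_zero _ _ (fun e => hij (hc e).symm) _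
  refine ⟨v, w, fun i => ?_, hne, hw⟩
  obtain ⟨z, hz⟩ := hS.eq_smul _ (v i ≫ w i)
  -- Terms with `j ≠ i` vanish by Schur's lemma and the remaining one is `z • v i`, so `v i ≠ 0`
  -- forces `z = 1`.
  have h : v i ≫ ∑ j, w j ≫ v j = v i := by rw [hw, Category.comp_id]
  rw [Preadditive.comp_sum, Finset.sum_eq_single i, ← Category.assoc, hz, Linear.smul_comp,
    Category.id_comp] at h
  · have hz1 : z = 1 := by
      have h' : (z - 1) • v i = 0 := by rw [sub_smul, one_smul, h, sub_self]
      exact sub_eq_zero.1 ((smul_eq_zero.1 h').resolve_right (hv0 i))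
    rw [hz, hz1, one_smul]
  · intro j _ hj
    rw [← Category.assoc, hne j i hj, Limits.zero_comp]
  · exact fun hi => absurd (Finset.mem_univ i) hi

end Abstract

/-! ### Finite-dimensionality -/

instance (n m : ℕ) : Finite (Diagram n m) :=
  Finite.of_injective (fun D : Diagram n m => fun x y => D.rel x y) fun _ _ h =>
    Diagram.ext (Setoid.ext fun x y => iff_of_eq (congrFun (congrFun h x) y))

instance (d : ℂ) (X Y : ReducedTL d) : Module.Finite ℂ (X ⟶ Y) :=
  inferInstanceAs (Module.Finite ℂ
    (DiagramSpace X.exponent Y.exponent ⧸ traceKer d X.exponent Y.exponent))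

/-! ### Tensor products in the idempotent completion -/

section Tensor

variable {d : ℂ}

theorem ReducedTL.tensorHom_add_left {X Y X' Y' : ReducedTL d} (f f' : X ⟶ Y) (g : X' ⟶ Y') :
    ReducedTL.tensorHom (f + f') g = ReducedTL.tensorHom f g + ReducedTL.tensorHom f' g := by
  induction f using Submodule.Quotient.induction_on with | _ f =>
  induction f' using Submodule.Quotient.induction_on with | _ f' =>
  induction g using Submodule.Quotient.induction_on with | _ g =>
  exact congrArg Submodule.Quotient.mk (LinearMap.map_add₂ (tensorLin _ _ _ _) f f' g)

theorem ReducedTL.tensorHom_add_right {X Y X' Y' : ReducedTL d} (f : X ⟶ Y) (g g' : X' ⟶ Y') :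
    ReducedTL.tensorHom f (g + g') = ReducedTL.tensorHom f g + ReducedTL.tensorHom f g' := by
  induction f using Submodule.Quotient.induction_on with | _ f =>
  induction g using Submodule.Quotient.induction_on with | _ g =>
  induction g' using Submodule.Quotient.induction_on with | _ g' =>
  exact congrArg Submodule.Quotient.mk (map_add (tensorLin _ _ _ _ f) g g')

/-- Tensoring on the left with `P`. -/
noncomputable def tensorLeftFunctor (P : Karoubi (ReducedTL d)) :
    Karoubi (ReducedTL d) ⥤ Karoubi (ReducedTL d) where
  obj Q := karoubiTensor P Q
  map {Q R} f := ⟨ReducedTL.tensorHom P.p f.f, by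
    change ReducedTL.tensorHom P.p Q.p ≫ ReducedTL.tensorHom P.p f.f ≫
      ReducedTL.tensorHom P.p R.p = _
    rw [ReducedTL.tensorHom_comp, ReducedTL.tensorHom_comp, P.idem, P.idem, f.comm]⟩
  map_id _ := rfl
  map_comp f g := Karoubi.hom_ext _ _ (by
    refine Eq.trans ?_ (ReducedTL.tensorHom_comp _ _ _ _).symm
    exact congrArg (fun t => ReducedTL.tensorHom t (f.f ≫ g.f)) P.idem.symm)

instance (P : Karoubi (ReducedTL d)) : (tensorLeftFunctor P).Additive where
  map_add := Karoubi.hom_ext _ _ (ReducedTL.tensorHom_add_right _ _ _)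

/-- Tensoring on the right with `Q`. -/
noncomputable def tensorRightFunctor (Q : Karoubi (ReducedTL d)) :
    Karoubi (ReducedTL d) ⥤ Karoubi (ReducedTL d) where
  obj P := karoubiTensor P Q
  map {P R} f := ⟨ReducedTL.tensorHom f.f Q.p, by
    change ReducedTL.tensorHom P.p Q.p ≫ ReducedTL.tensorHom f.f Q.p ≫
      ReducedTL.tensorHom R.p Q.p = _
    rw [ReducedTL.tensorHom_comp, ReducedTL.tensorHom_comp, Q.idem, Q.idem, f.comm]⟩
  map_id _ := rfl
  map_comp f g := Karoubi.hom_ext _ _ (by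
    refine Eq.trans ?_ (ReducedTL.tensorHom_comp _ _ _ _).symm
    exact congrArg (fun t => ReducedTL.tensorHom (f.f ≫ g.f) t) Q.idem.symm)

instance (Q : Karoubi (ReducedTL d)) : (tensorRightFunctor Q).Additive where
  map_add := Karoubi.hom_ext _ _ (ReducedTL.tensorHom_add_left _ _ _)

/-! ### Objects and morphisms presented by idempotents of the Temperley–Lieb category. -/

/-- The object of the idempotent completion of the reduced category given by an idempotent of the
Temperley-Lieb category. -/
noncomputable def idempotentObj {n : ℕ} (p : TL.X d n ⟶ TL.X d n) (h : p ≫ p = p) :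
    Karoubi (ReducedTL d) where
  X := (reduction d).obj (TL.X d n)
  p := (reduction d).map p
  idem := by rw [← Functor.map_comp, h]

/-- The generating object. -/
noncomputable def generator (d : ℂ) : Karoubi (ReducedTL d) :=
  idempotentObj (𝟙 (TL.X d 1)) (Category.id_comp _)

theorem strand_idem {n : ℕ} {p : TL.X d n ⟶ TL.X d n} (h : p ≫ p = p) :
    TL.strand p ≫ TL.strand p = TL.strand p := by
  rw [← TL.strand_comp, h]

theorem tens_idem {n m : ℕ} {p : TL.X d n ⟶ TL.X d n} {r : TL.X d m ⟶ TL.X d m}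
    (hp : p ≫ p = p) (hr : r ≫ r = r) : TL.tens p r ≫ TL.tens p r = TL.tens p r := by
  rw [TL.tens_comp, hp, hr]

theorem idempotentObj_congr {n : ℕ} {p r : TL.X d n ⟶ TL.X d n} (h : p = r) (hp : p ≫ p = p)
    (hr : r ≫ r = r) : idempotentObj p hp = idempotentObj r hr := by
  subst h; rfl

/-- Associativity holds as an equality of objects, not merely up to isomorphism: with one last
strand the two bracketings of the exponent agree definitionally, and `tens_strand` identifies the
idempotents. -/
theorem idempotentObj_tensor_assoc {n m : ℕ} {p : TL.X d n ⟶ TL.X d n}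
    {r : TL.X d m ⟶ TL.X d m} (hp : p ≫ p = p) (hr : r ≫ r = r) :
    karoubiTensor (idempotentObj p hp) (karoubiTensor (idempotentObj r hr) (generator d)) =
      karoubiTensor (karoubiTensor (idempotentObj p hp) (idempotentObj r hr)) (generator d) :=
  idempotentObj_congr (n := n + m + 1) (TL.tens_strand p r) (tens_idem hp (strand_idem hr))
    (strand_idem (tens_idem hp hr))

/-- The morphism of the idempotent completion induced by a morphism of the Temperley-Lieb
category. -/
noncomputable def idempotentHom {n m : ℕ} {p : TL.X d n ⟶ TL.X d n} {r : TL.X d m ⟶ TL.X d m}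
    (hp : p ≫ p = p) (hr : r ≫ r = r) (f : TL.X d n ⟶ TL.X d m) :
    idempotentObj p hp ⟶ idempotentObj r hr where
  f := (reduction d).map (p ≫ f ≫ r)
  comm := by
    change (reduction d).map p ≫ (reduction d).map (p ≫ f ≫ r) ≫ (reduction d).map r = _
    rw [← Functor.map_comp, ← Functor.map_comp]
    simp only [Category.assoc, hr]
    rw [← Category.assoc p p, hp]

theorem idempotentHom_comp {n m k : ℕ} {p : TL.X d n ⟶ TL.X d n} {r : TL.X d m ⟶ TL.X d m}
    {s : TL.X d k ⟶ TL.X d k} (hp : p ≫ p = p) (hr : r ≫ r = r) (hs : s ≫ s = s)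
    (f : TL.X d n ⟶ TL.X d m) (g : TL.X d m ⟶ TL.X d k) :
    idempotentHom hp hr f ≫ idempotentHom hr hs g = idempotentHom hp hs (f ≫ r ≫ g) := by
  refine Karoubi.hom_ext _ _ ?_
  change (reduction d).map (p ≫ f ≫ r) ≫ (reduction d).map (r ≫ g ≫ s) = _
  rw [← Functor.map_comp]
  refine congrArg (reduction d).map ?_
  simp only [Category.assoc]
  rw [← Category.assoc r r, hr]

theorem idempotentHom_eq_id {n : ℕ} {p : TL.X d n ⟶ TL.X d n} (hp : p ≫ p = p)
    {f : TL.X d n ⟶ TL.X d n} (h : p ≫ f ≫ p = p) :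
    idempotentHom hp hp f = 𝟙 (idempotentObj p hp) :=
  Karoubi.hom_ext _ _ (congrArg (reduction d).map h)

theorem idempotentHom_eq_zero {n m : ℕ} {p : TL.X d n ⟶ TL.X d n} {r : TL.X d m ⟶ TL.X d m}
    (hp : p ≫ p = p) (hr : r ≫ r = r) {f : TL.X d n ⟶ TL.X d m} (h : p ≫ f ≫ r = 0) :
    idempotentHom hp hr f = 0 :=
  Karoubi.hom_ext _ _ (congrArg (reduction d).map h)

theorem idempotentHom_add {n m : ℕ} {p : TL.X d n ⟶ TL.X d n} {r : TL.X d m ⟶ TL.X d m}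
    (hp : p ≫ p = p) (hr : r ≫ r = r) (f g : TL.X d n ⟶ TL.X d m) :
    idempotentHom hp hr f + idempotentHom hp hr g = idempotentHom hp hr (f + g) := by
  refine Karoubi.hom_ext _ _ ?_
  change (reduction d).map (p ≫ f ≫ r) + (reduction d).map (p ≫ g ≫ r) = _
  have e : p ≫ (f + g) ≫ r = p ≫ f ≫ r + p ≫ g ≫ r := by
    rw [Preadditive.add_comp, Preadditive.comp_add]
  exact (congrArg (reduction d).map e).symm

theorem exists_idempotentHom {n m : ℕ} {p : TL.X d n ⟶ TL.X d n} {r : TL.X d m ⟶ TL.X d m}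
    (hp : p ≫ p = p) (hr : r ≫ r = r) (f : idempotentObj p hp ⟶ idempotentObj r hr) :
    ∃ g, f = idempotentHom hp hr g := by
  obtain ⟨f, hf⟩ := f
  obtain ⟨g, rfl⟩ := Submodule.Quotient.mk_surjective _ f
  exact ⟨g, Karoubi.hom_ext _ _ hf.symm⟩

end Tensor

/-! ### The tensor product of a simple object with the generating object -/

section Fusion

variable {q : ℂ} {l : ℕ}

/-- Wenzl's recursion, read as a formula for `f_{n+1} ⊗ 1`, is the decomposition. The term `f_{n+2}`
gives one summand; the term through `hLast` factors over `X ^ n` by the cap and the cup and gives a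
copy of the image of `f_n`. Mixed composites vanish because `f_{n+2}` kills cap and cup. -/
theorem isDirectSum_strand_wenzl (hl : 2 ≤ l) (hq : IsPrimitiveRoot (q ^ 2) l) {n : ℕ}
    (hn : n + 2 < l) :
    IsDirectSum (idempotentObj (strand (wenzl q (n + 1)))
        (strand_idem (wenzl_idem hl hq (show n + 1 < l by omega))))
      (fun b : Bool => cond b (idempotentObj (wenzl q (n + 2)) (wenzl_idem hl hq hn))
        (idempotentObj (wenzl q n) (wenzl_idem hl hq (show n < l by omega)))) := by
  have h := wenzlStep hl hq (show n + 1 < l by omega)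
  have h' := wenzlStep hl hq (show n + 1 + 1 < l by omega)
  have h1 : qInt q (n + 1) ≠ 0 := qInt_ne_zero hl hq (by omega) (by omega)
  have h2 : qInt q (n + 2) ≠ 0 := qInt_ne_zero hl hq (by omega) (by omega)
  have hcap := h.wenzl_capLast h1 h2
  have hcup := h.cupLast_wenzl h1 h2
  set p := strand (wenzl q (n + 1)) with hp
  have pp : p ≫ p = p := h.strand_idem
  have i0 : wenzl q n ≫ wenzl q n = wenzl q n := h.idem_self
  have i2 : wenzl q (n + 2) ≫ wenzl q (n + 2) = wenzl q (n + 2) := h'.idem_succ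
  have pw : p ≫ wenzl q (n + 2) = wenzl q (n + 2) := h'.strand_comp_succ
  have wp : wenzl q (n + 2) ≫ p = wenzl q (n + 2) := h'.succ_comp_strand
  have pt : cupLast _ n ≫ p ≫ capLast _ n = (qInt q (n + 2) / qInt q (n + 1)) • wenzl q n :=
    h.partialTrace_succ
  have pcap : p ≫ capLast _ n ≫ wenzl q n = p ≫ capLast _ n := by
    rw [← strand_capLast, ← Category.assoc, h.absorb_right]
  -- The inverse of the partial trace coefficient in `pt`: it normalizes cup followed by cap to
  -- `f_n`, and is also the coefficient in the recursion.
  set c := qInt q (n + 1) / qInt q (n + 2) with hc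
  refine ⟨fun b => match b with
      | true => idempotentHom i2 pp (wenzl q (n + 2))
      | false => idempotentHom i0 pp (cupLast _ n),
    fun b => match b with
      | true => idempotentHom pp i2 (wenzl q (n + 2))
      | false => idempotentHom pp i0 (c • capLast _ n), ?_, ?_, ?_⟩
  · rintro (_ | _)
    · refine (idempotentHom_comp _ _ _ _ _).trans (idempotentHom_eq_id _ ?_)
      simp only [Linear.comp_smul, Linear.smul_comp, pt, smul_smul, i0]
      rw [hc, div_mul_div_cancel₀ h2, div_self h1, one_smul]
    · refine (idempotentHom_comp _ _ _ _ _).trans (idempotentHom_eq_id _ ?_)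
      rw [pw, i2, i2, i2]
  · rintro (_ | _) (_ | _) hij
    · exact absurd rfl hij
    · refine (idempotentHom_comp _ _ _ _ _).trans (idempotentHom_eq_zero _ _ ?_)
      rw [← Category.assoc (wenzl q (n + 2)) p, wp, Linear.comp_smul, hcap, smul_zero,
        Limits.zero_comp, Limits.comp_zero]
    · refine (idempotentHom_comp _ _ _ _ _).trans (idempotentHom_eq_zero _ _ ?_)
      rw [pw, hcup, Limits.zero_comp, Limits.comp_zero]
    · exact absurd rfl hij
  · rw [Fintype.sum_bool]
    change idempotentHom pp i2 (wenzl q (n + 2)) ≫ idempotentHom i2 pp (wenzl q (n + 2)) +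
      idempotentHom pp i0 (c • capLast _ n) ≫ idempotentHom i0 pp (cupLast _ n) = _
    rw [idempotentHom_comp, idempotentHom_comp, idempotentHom_add]
    refine idempotentHom_eq_id _ ?_
    rw [i2, i2, Preadditive.add_comp, Preadditive.comp_add, wp, pw]
    have e : p ≫ ((c • capLast _ n) ≫ wenzl q n ≫ cupLast _ n) ≫ p =
        c • (p ≫ hLast _ n ≫ p) := by
      rw [Linear.smul_comp, Linear.smul_comp, Linear.comp_smul, hLast_eq]
      congr 1
      have := congrArg (· ≫ cupLast _ n ≫ p) pcap
      simpa only [Category.assoc] using this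
    rw [e, wenzl_add_two, sub_add_cancel]

/-! ### The simple objects and their products with the generator. -/

/-- The simple objects of the reduced category. -/
noncomputable def simple (hl : 2 ≤ l) (hq : IsPrimitiveRoot (q ^ 2) l) (n : Fin l) :
    Karoubi (ReducedTL (q + q⁻¹)) :=
  idempotentObj (wenzl q n) (wenzl_idem hl hq n.2)

variable (hl : 2 ≤ l) (hq : IsPrimitiveRoot (q ^ 2) l)

theorem simple_hom_eq_zero {a b : Fin l} (hab : a ≠ b) (f : simple hl hq a ⟶ simple hl hq b) :
    f = 0 := by
  obtain ⟨g, rfl⟩ := exists_idempotentHom _ _ f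
  exact idempotentHom_eq_zero _ _
    (wenzl_comp_wenzl_of_ne hl hq a.2 b.2 (fun e => hab (Fin.ext e)) g)

theorem simple_hom_eq_smul {a : Fin l} (f : simple hl hq a ⟶ simple hl hq a) :
    ∃ c : ℂ, f = c • 𝟙 (simple hl hq a) := by
  obtain ⟨g, rfl⟩ := exists_idempotentHom _ _ f
  obtain ⟨c, hc⟩ := wenzl_comp_wenzl_self hl hq a.2 g
  exact ⟨c, Karoubi.hom_ext _ _ (congrArg (reduction _).map hc)⟩

/-- Keeping this zero object in the family lets the product with the generator be written without a
case distinction at the end of the range. -/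
theorem simple_top (h : l - 1 < l) : 𝟙 (simple hl hq ⟨l - 1, h⟩) = 0 :=
  Karoubi.hom_ext _ _ (reduction_wenzl_eq_zero hl hq)

/-- The simple objects which are not zero. -/
noncomputable def simples (a : Fin (l - 1)) : Karoubi (ReducedTL (q + q⁻¹)) :=
  simple hl hq ⟨a, by omega⟩

theorem isSchurFamily_simples : IsSchurFamily (simples hl hq) where
  eq_zero a b hab f := simple_hom_eq_zero hl hq (fun e => hab (Fin.ext (Fin.mk.inj e))) f
  eq_smul a f := simple_hom_eq_smul hl hq f
  id_ne_zero a h := reduction_wenzl_ne_zero hl hq (n := a) (by omega)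
    ((Karoubi.hom_ext_iff).1 h)

theorem simple_mem_throughFamily (n : Fin l) :
    𝟙 (simple hl hq n) ∈ throughFamily (simples hl hq) (simple hl hq n) := by
  by_cases h : n.val < l - 1
  · exact id_mem_throughFamily (S := simples hl hq) ⟨n, h⟩
  · have e : n = ⟨l - 1, by omega⟩ := Fin.ext (by simp only; omega)
    rw [e, simple_top]
    exact Submodule.zero_mem _

/-- The formula stays true at `n = l - 1`, where the target is zero, because `a` never takes that
value. -/
theorem finrank_simple (a : Fin (l - 1)) (n : Fin l) :
    Module.finrank ℂ (simples hl hq a ⟶ simple hl hq n) = if a.val = n.val then 1 else 0 := by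
  by_cases h : n.val < l - 1
  · refine ((isSchurFamily_simples hl hq).finrank_hom a ⟨n, h⟩).trans ?_
    simp only [Fin.ext_iff]
  · rw [if_neg (by omega)]
    have : Subsingleton (simples hl hq a ⟶ simple hl hq n) :=
      ⟨fun f g => (simple_hom_eq_zero hl hq (by simp only [ne_eq, Fin.ext_iff]; omega) f).trans
        (simple_hom_eq_zero hl hq (by simp only [ne_eq, Fin.ext_iff]; omega) g).symm⟩
    exact Module.finrank_zero_of_subsingleton

theorem simple_zero_tensor_generator (h0 : 0 < l) (h1 : 1 < l) :
    karoubiTensor (simple hl hq ⟨0, h0⟩) (generator _) = simple hl hq ⟨1, h1⟩ :=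
  idempotentObj_congr (n := 1) (strand_id (n := 0)) (strand_idem (Category.id_comp _))
    (wenzl_idem hl hq h1)

theorem simple_tensor_simple_zero (n : Fin l) (h0 : 0 < l) :
    karoubiTensor (simple hl hq n) (simple hl hq ⟨0, h0⟩) = simple hl hq n :=
  idempotentObj_congr (n := n) (tens_id_zero (wenzl q n))
    (tens_idem (wenzl_idem hl hq n.2) (Category.id_comp _)) (wenzl_idem hl hq n.2)

theorem isDirectSum_simple_tensor_generator {n : ℕ} (hn : n + 2 < l) :
    IsDirectSum (karoubiTensor (simple hl hq ⟨n + 1, by omega⟩) (generator _))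
      (fun b : Bool => cond b (simple hl hq ⟨n + 2, hn⟩) (simple hl hq ⟨n, by omega⟩)) :=
  isDirectSum_strand_wenzl hl hq hn

theorem tensor_generator_mem_throughFamily (n : Fin l) (hn : n.val + 1 < l) :
    𝟙 (karoubiTensor (simple hl hq n) (generator _)) ∈ throughFamily (simples hl hq)
      (karoubiTensor (simple hl hq n) (generator _)) := by
  obtain ⟨n, hn'⟩ := n
  cases n with
  | zero =>
    rw [simple_zero_tensor_generator hl hq hn' hn]
    exact simple_mem_throughFamily hl hq _
  | succ n =>
    refine (isDirectSum_simple_tensor_generator hl hq hn).id_mem_throughFamily ?_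
    rintro (_ | _) <;> exact simple_mem_throughFamily hl hq _

theorem finrank_tensor_generator (a : Fin (l - 1)) (n : Fin l) (hn : n.val + 1 < l) :
    Module.finrank ℂ (simples hl hq a ⟶ karoubiTensor (simple hl hq n) (generator _)) =
      (if a.val = n.val + 1 then 1 else 0) + if a.val + 1 = n.val then 1 else 0 := by
  obtain ⟨n, hn'⟩ := n
  cases n with
  | zero =>
    rw [simple_zero_tensor_generator hl hq hn' hn, finrank_simple, if_neg (c := _ + 1 = _)]
    · rfl
    · simp
  | succ n =>
    rw [(isDirectSum_simple_tensor_generator hl hq hn).finrank_hom, Fintype.sum_bool]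
    simp only [cond_true, cond_false, finrank_simple, Nat.add_right_cancel_iff]

/-! ### The fusion rules -/

/-- The indices occurring in the truncated Clebsch-Gordan rule. -/
def Admissible (l j k a : ℕ) : Prop :=
  (a + j + k) % 2 = 0 ∧ a ≤ j + k ∧ j ≤ a + k ∧ k ≤ a + j ∧ a + j + k ≤ 2 * (l - 2)

instance (l j k a : ℕ) : Decidable (Admissible l j k a) :=
  inferInstanceAs (Decidable (_ ∧ _))

theorem admissible_zero {l j a : ℕ} (ha : a < l - 1) :
    (if Admissible l j 0 a then 1 else 0) = if a = j then 1 else 0 := by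
  have h : Admissible l j 0 a ↔ a = j := by unfold Admissible; omega
  simp only [h]

theorem admissible_one {l j a : ℕ} (ha : a < l - 1) (hj : j ≤ l - 2) (hl : 1 ≤ l - 2) :
    ((if 1 ≤ a ∧ Admissible l j 0 (a - 1) then 1 else 0) +
      if Admissible l j 0 (a + 1) then 1 else 0) = if Admissible l j 1 a then 1 else 0 := by
  by_cases h1 : 1 ≤ a ∧ Admissible l j 0 (a - 1) <;> by_cases h2 : Admissible l j 0 (a + 1) <;>
    by_cases h3 : Admissible l j 1 a <;>
    simp only [h1, h2, h3, and_self, if_true, if_false] <;>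
    exfalso <;> unfold Admissible at h1 h2 h3 <;> omega

/-- The recursion for Clebsch–Gordan multiplicities, `N(j,n+1,a-1) + N(j,n+1,a+1) = N(j,n+2,a) +
N(j,n,a)`. The guard `1 ≤ a` is needed because `a - 1` is truncated at `a = 0`. -/
theorem admissible_add_two {l j n a : ℕ} (ha : a < l - 1) (hj : j ≤ l - 2) (hn : n + 2 ≤ l - 2) :
    ((if 1 ≤ a ∧ Admissible l j (n + 1) (a - 1) then 1 else 0) +
      if Admissible l j (n + 1) (a + 1) then 1 else 0) =
    (if Admissible l j (n + 2) a then 1 else 0) + if Admissible l j n a then 1 else 0 := by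
  by_cases h1 : 1 ≤ a ∧ Admissible l j (n + 1) (a - 1) <;>
    by_cases h2 : Admissible l j (n + 1) (a + 1) <;>
    by_cases h3 : Admissible l j (n + 2) a <;> by_cases h4 : Admissible l j n a <;>
    simp only [h1, h2, h3, h4, and_self, if_true, if_false] <;>
    exfalso <;> unfold Admissible at h1 h2 h3 h4 <;> omega

theorem mem_range_fusionIndex {l j k : ℕ} (hj : j ≤ l - 2) (hk : k ≤ l - 2) (a : ℕ) :
    (∃ i, fusionIndex l j k i = a) ↔ Admissible l j k a := by
  constructor
  · rintro ⟨⟨i, hi⟩, rfl⟩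
    unfold fusionIndex Admissible
    simp only
    unfold fusionTop Nat.dist at *
    split_ifs at hi <;> omega
  · rintro ⟨h1, h2, h3, h4, h5⟩
    -- The parity condition makes this division exact.
    refine ⟨⟨(a - Nat.dist j k) / 2, ?_⟩, ?_⟩
    · unfold fusionTop Nat.dist
      split_ifs <;> omega
    · unfold fusionIndex Nat.dist
      simp only
      omega

theorem fusionIndex_injective (l j k : ℕ) : Function.Injective (fusionIndex l j k) := by
  intro x y h
  unfold fusionIndex at h
  exact Fin.ext (by omega)

theorem sum_fusionIndex {l j k : ℕ} (hj : j ≤ l - 2) (hk : k ≤ l - 2) (a : ℕ) :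
    (∑ i, if a = fusionIndex l j k i then 1 else 0) = if Admissible l j k a then 1 else 0 := by
  split_ifs with h
  · obtain ⟨i, rfl⟩ := (mem_range_fusionIndex hj hk a).2 h
    rw [Finset.sum_eq_single i]
    · rw [if_pos rfl]
    · intro i' _ hne
      exact if_neg fun e => hne (fusionIndex_injective _ _ _ e).symm
    · exact fun hi => absurd (Finset.mem_univ i) hi
  · exact Finset.sum_eq_zero fun i _ =>
      if_neg fun e => h ((mem_range_fusionIndex hj hk a).1 ⟨i, e.symm⟩)

/-! ### Induction on the second index. -/

/-- The truncated Clebsch-Gordan rule for the tensor product of two simple objects. -/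
def FusionRule (j k : Fin l) : Prop :=
  ∀ (hj : j.val ≤ l - 2) (hk : k.val ≤ l - 2),
    IsDirectSum (karoubiTensor (simple hl hq j) (simple hl hq k))
      (fun i => simple hl hq ⟨fusionIndex l j k i, by have := fusionIndex_le hj hk i; omega⟩)

variable {hl hq}

/-- Since all multiplicities are 0 or 1, the dimensions of the Hom-spaces determine the
decomposition once the object is generated by the simple ones. -/
theorem FusionRule.of_finrank {j k : Fin l}
    (h : 𝟙 (karoubiTensor (simple hl hq j) (simple hl hq k)) ∈ throughFamily (simples hl hq)
      (karoubiTensor (simple hl hq j) (simple hl hq k)))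
    (hr : ∀ a, Module.finrank ℂ (simples hl hq a ⟶ karoubiTensor (simple hl hq j)
      (simple hl hq k)) = if Admissible l j k a then 1 else 0) : FusionRule hl hq j k := by
  intro hj hk
  have hlt : ∀ i, fusionIndex l j k i < l - 1 := fun i => by
    have := fusionIndex_le hj hk i
    omega
  refine (isSchurFamily_simples hl hq).isDirectSum h
    (c := fun i => (⟨fusionIndex l j k i, hlt i⟩ : Fin (l - 1))) ?_ ?_ ?_
  · exact fun x y e => fusionIndex_injective _ _ _ (Fin.mk.inj e)
  · intro i
    rw [hr, if_pos ((mem_range_fusionIndex hj hk _).1 ⟨i, rfl⟩)]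
  · intro a ha
    rw [hr, if_neg]
    intro hadm
    obtain ⟨i, hi⟩ := (mem_range_fusionIndex hj hk _).2 hadm
    exact ha ⟨i, Fin.ext hi⟩

theorem FusionRule.finrank {j k : Fin l} (h : FusionRule hl hq j k) (hj : j.val ≤ l - 2)
    (hk : k.val ≤ l - 2) (a : Fin (l - 1)) :
    Module.finrank ℂ (simples hl hq a ⟶ karoubiTensor (simple hl hq j) (simple hl hq k)) =
      if Admissible l j k a then 1 else 0 := by
  rw [(h hj hk).finrank_hom]
  simp only [finrank_simple]
  exact sum_fusionIndex hj hk a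

theorem FusionRule.tensor_generator {j k : Fin l} (h : FusionRule hl hq j k) (hj : j.val ≤ l - 2)
    (hk : k.val ≤ l - 2) :
    IsDirectSum (karoubiTensor (simple hl hq j) (karoubiTensor (simple hl hq k) (generator _)))
      (fun i => karoubiTensor (simple hl hq ⟨fusionIndex l j k i, by
        have := fusionIndex_le hj hk i; omega⟩) (generator _)) := by
  have e : karoubiTensor (simple hl hq j) (karoubiTensor (simple hl hq k) (generator _)) =
      karoubiTensor (karoubiTensor (simple hl hq j) (simple hl hq k)) (generator _) :=
    idempotentObj_tensor_assoc _ _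
  rw [e]
  exact (h hj hk).map (tensorRightFunctor (generator _))

theorem FusionRule.mem_throughFamily {j k : Fin l} (h : FusionRule hl hq j k)
    (hj : j.val ≤ l - 2) (hk : k.val ≤ l - 2) :
    𝟙 (karoubiTensor (simple hl hq j) (karoubiTensor (simple hl hq k) (generator _))) ∈
      throughFamily (simples hl hq)
        (karoubiTensor (simple hl hq j) (karoubiTensor (simple hl hq k) (generator _))) := by
  refine (h.tensor_generator hj hk).id_mem_throughFamily fun i => ?_
  refine tensor_generator_mem_throughFamily hl hq _ ?_
  have := fusionIndex_le hj hk i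
  simp only
  omega

/-- A simple object `a` occurs in the product of `b` with the generator exactly when `a = b + 1` or
`a + 1 = b`; summing over the admissible `b` gives the two terms. -/
theorem FusionRule.finrank_tensor_generator {j k : Fin l} (h : FusionRule hl hq j k)
    (hj : j.val ≤ l - 2) (hk : k.val ≤ l - 2) (a : Fin (l - 1)) :
    Module.finrank ℂ (simples hl hq a ⟶
      karoubiTensor (simple hl hq j) (karoubiTensor (simple hl hq k) (generator _))) =
      (if 1 ≤ a.val ∧ Admissible l j k (a - 1) then 1 else 0) +
        if Admissible l j k (a + 1) then 1 else 0 := by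
  rw [(h.tensor_generator hj hk).finrank_hom, ← sum_fusionIndex hj hk (a + 1)]
  have e : (if 1 ≤ a.val ∧ Admissible l j k (a - 1) then 1 else 0) =
      ∑ i, if a.val = fusionIndex l j k i + 1 then 1 else 0 := by
    split_ifs with h1
    · have h2 := sum_fusionIndex hj hk (a.val - 1)
      rw [if_pos h1.2] at h2
      refine h2.symm.trans (Finset.sum_congr rfl fun i _ => ?_)
      have := h1.1
      congr 1
      exact propext ⟨fun _ => by omega, fun _ => by omega⟩
    · refine (Finset.sum_eq_zero fun i _ => if_neg fun e => h1 ⟨by omega, ?_⟩).symm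
      exact (mem_range_fusionIndex hj hk _).1 ⟨i, by omega⟩
  rw [e, ← Finset.sum_add_distrib]
  refine Finset.sum_congr rfl fun i _ => ?_
  refine TemperleyLieb.finrank_tensor_generator hl hq a _ ?_
  have := fusionIndex_le hj hk i
  simp only
  omega

variable (hl hq)

theorem fusionRule_zero (j : Fin l) (h0 : 0 < l) : FusionRule hl hq j ⟨0, h0⟩ := by
  refine fun hj hk => FusionRule.of_finrank ?_ (fun a => ?_) hj hk
  · rw [simple_tensor_simple_zero]
    exact simple_mem_throughFamily hl hq j
  · rw [simple_tensor_simple_zero, finrank_simple]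
    exact (admissible_zero (by omega)).symm

theorem fusionRule_one {j : Fin l} (hj : j.val ≤ l - 2) (h1 : 1 < l) (h1' : 1 ≤ l - 2) :
    FusionRule hl hq j ⟨1, h1⟩ := by
  -- The factor with index 1 is the unit object tensored with the generator, so this case is read
  -- off from the case of index 0.
  have h := fusionRule_zero hl hq j (by omega)
  have hm := h.mem_throughFamily hj (Nat.zero_le _)
  have hf := h.finrank_tensor_generator hj (Nat.zero_le _)
  rw [simple_zero_tensor_generator hl hq _ h1] at hm hf
  refine FusionRule.of_finrank hm fun a => ?_
  rw [hf]
  exact admissible_one a.2 hj h1'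

theorem fusionRule_succ {j : Fin l} (hj : j.val ≤ l - 2) {n : ℕ} (hn : n + 2 ≤ l - 2)
    (h0 : FusionRule hl hq j ⟨n, by omega⟩) (h1 : FusionRule hl hq j ⟨n + 1, by omega⟩) :
    FusionRule hl hq j ⟨n + 2, by omega⟩ := by
  -- Second computation of the triple product: splitting `X̄_{n+1} ⊗ X̄` before tensoring with
  -- `X̄_j` exhibits the product with `X̄_{n+2}` as a summand.
  have hd := (isDirectSum_simple_tensor_generator hl hq (n := n) (by omega)).map
    (tensorLeftFunctor (simple hl hq j))
  have hm := h1.mem_throughFamily hj (by simp only; omega)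
  refine FusionRule.of_finrank (hd.summand_mem_throughFamily hm true) fun a => ?_
  have hf := h1.finrank_tensor_generator hj (by simp only; omega) a
  have hs := hd.finrank_hom (simples hl hq a)
  rw [Fintype.sum_bool] at hs
  have hs' : _ = Module.finrank ℂ (simples hl hq a ⟶ karoubiTensor (simple hl hq j)
    (simple hl hq ⟨n + 2, by omega⟩)) + Module.finrank ℂ (simples hl hq a ⟶ karoubiTensor
      (simple hl hq j) (simple hl hq ⟨n, by omega⟩)) := hf.symm.trans hs
  rw [h0.finrank hj (by simp only; omega)] at hs'
  -- Equating the two counts and cancelling the multiplicity for index `n` leaves that for `n + 2`.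
  exact Nat.add_right_cancel (hs'.symm.trans (admissible_add_two a.2 hj hn))

theorem fusionRule {j : Fin l} (hj : j.val ≤ l - 2) (n : ℕ) (hn : n ≤ l - 2) :
    FusionRule hl hq j ⟨n, by omega⟩ := by
  induction n using Nat.twoStepInduction with
  | zero => exact fusionRule_zero hl hq j _
  | one => exact fusionRule_one hl hq hj _ hn
  | more n ih0 ih1 => exact fusionRule_succ hl hq hj hn (ih0 (by omega)) (ih1 (by omega))

end Fusion

end TemperleyLieb

theorem mainTheorem5 (q : ℂ) (l : ℕ) (hl : 2 ≤ l) (hq : IsPrimitiveRoot (q ^ 2) l) :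
    ∃ hf : ∀ k ≤ l - 2, TemperleyLieb.wenzl q k ≫ TemperleyLieb.wenzl q k = TemperleyLieb.wenzl q k,
      ∀ (j k : ℕ) (hj : j ≤ l - 2) (hk : k ≤ l - 2),
        TemperleyLieb.IsDirectSum
          (TemperleyLieb.karoubiTensor (TemperleyLieb.simpleObj q j (hf j hj))
            (TemperleyLieb.simpleObj q k (hf k hk)))
          (fun i => TemperleyLieb.simpleObj q (TemperleyLieb.fusionIndex l j k i)
            (hf _ (TemperleyLieb.fusionIndex_le hj hk i))) :=
  -- `simple` and `simpleObj` unfold to the same object, so the fusion rule applies as it stands.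
  ⟨fun _ hk => TemperleyLieb.wenzl_idem hl hq (by omega), fun j k hj hk =>
    TemperleyLieb.fusionRule hl hq (j := ⟨j, by omega⟩) hj k hk hj hk⟩
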